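/- Let $N\in\{2,3\}$, let $\gamma_1,\dots,\gamma_N>0$, $\gamma:=\min_j\gamma_j$, and $V(x)=\sum_{j=1}^N\gamma_j^2x_j^2$ on $\mathbb{R}^N$. Let $\Omega\in\mathbb{R}^3$, with $\Omega=(0,0,\Omega_3)$, $\Omega_3\in\mathbb{R}$, if $N=2$, and let $L_\Omega=-\Omega\cdot L$ with $L=-i\,x\wedge\nabla$ (for $N=2$, vectors are padded with a zero third component, so $L_\Omega=i\Omega_3(x_1\partial_{x_2}-x_2\partial_{x_1})$). Let $2^*=\infty$ if $N=2$ and $2^*=1+\frac{4}{N-2}=5$ if $N=3$. Put $$\Sigma=\{u\in H^1(\mathbb{R}^N;\mathbb{C}):|x|u\in L^2(\mathbb{R}^N)\},\qquad \|u\|_\Sigma^2=\int_{\mathbb{R}^N}\left(|\nabla u|^2+|x|^2|u|^2+|u|^2\right)dx,$$ and, for $u\in\Sigma$, $l_\Omega(u)=\int_{\mathbb{R}^N}(L_\Omega u)\,\overline{u}\,dx\in\mathbb{R}$, $$\|u\|_H^2=\mathfrak{t}[u]=\|\nabla u\|_2^2+\int_{\mathbb{R}^N}V|u|^2dx+2\,l_\Omega(u),\qquad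 E_\Omega(u)=\tfrac12\mathfrak{t}[u]-\tfrac{2}{p+1}\int_{\mathbb{R}^N}|u|^{p+1}dx,$$ $$\lambda_0=-\inf\{\mathfrak{t}[u]:u\in\Sigma,\ \|u\|_2^2=1\}.$$ For $q,r>0$ let $$J_q^r=\inf\{E_\Omega(u):u\in\Sigma,\ \|u\|_2^2=q,\ \|u\|_H^2\le r\}$$ and let $\mathcal{G}_q^r$ be the set of minimizers, that is, of those admissible $u$ with $E_\Omega(u)=J_q^r$. A minimizing sequence for $J_q^r$ is a sequence $(u_n)$ of admissible functions with $E_\Omega(u_n)\to J_q^r$. **Theorem.** Assume $|\Omega|<\gamma$ and $1+\frac4N<p<2^*$. For every $r>0$ there exist $q_0>0$ and $C>0$ such that for all $0<q<q_0$ the set $\mathcal{G}_q^r$ is nonempty and: (i) every minimizing sequence for $J_q^r$ is precompact in $\Sigma$, that is, each of its subsequences has a further subsequence converging in the norm of $\Sigma$ to an element of $\Sigma$; (ii) for every $\varphi\in\mathcal{G}_q^r$ there exists $\omega\in\mathbb{R}$ such that $\varphi\in\Sigma\setminus\{0\}$ solves $$-\Delta\varphi+\omega\varphi+V\varphi-2|\varphi|^{p-1}\varphi+2L_\Omega\varphi=0$$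 weakly (tested against every $v\in\Sigma$), with $$\lambda_0<\omega\le\lambda_0\left(1-Cq^{\frac{p-1}{2}}\right).$$ -/

import Mathlib

open MeasureTheory Filter Topology


namespace RotNLS

noncomputable section

/-- Euclidean space `ℝ^N`. -/
abbrev E (N : ℕ) : Type := EuclideanSpace ℝ (Fin N)

/-- The critical exponent: `2^* = ∞` if `N = 2`, and `2^* = 1 + 4 / (N - 2)` if `N = 3`. -/
def twoStar (N : ℕ) : EReal :=
  if N = 2 then ⊤ else (((1 : ℝ) + 4 / ((N : ℝ) - 2) : ℝ) : EReal)

/-- The harmonic potential `V(x) = ∑ j, γ_j² x_j²`. -/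
def V {N : ℕ} (γ : Fin N → ℝ) (x : E N) : ℝ := ∑ j, γ j ^ 2 * x j ^ 2

/-! ### Weak derivatives and the energy space -/

/-- `v` is the weak `j`-th partial derivative of `u` on `ℝ^N` (for locally integrable `u`, `v`). -/
def HasWeakPartial {N : ℕ} (u v : E N → ℂ) (j : Fin N) : Prop :=
  ∀ ψ : E N → ℝ, ContDiff ℝ ((⊤ : ℕ∞) : WithTop ℕ∞) ψ → HasCompactSupport ψ →
    ∫ x, ((fderiv ℝ ψ x (EuclideanSpace.single j 1) : ℝ) : ℂ) * u x
      = - ∫ x, ((ψ x : ℝ) : ℂ) * v x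

/-- The energy space `Σ = {u ∈ H¹(ℝ^N) : |x| u ∈ L²(ℝ^N)}` of complex-valued functions
(represented by functions; all the notions below depend only on almost-everywhere classes). -/
def MemSigma {N : ℕ} (u : E N → ℂ) : Prop :=
  MemLp u 2 volume ∧
  (∀ j, ∃ v : E N → ℂ, MemLp v 2 volume ∧ HasWeakPartial u v j) ∧
  MemLp (fun x : E N => ((‖x‖ : ℝ) : ℂ) * u x) 2 volume

open Classical in
/-- The weak partial derivative `∂_j u ∈ L²` (unique almost everywhere when it exists;
`0` by convention when it does not). -/
def weakPartial {N : ℕ} (u : E N → ℂ) (j : Fin N) : E N → ℂ :=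
  if h : ∃ v : E N → ℂ, MemLp v 2 volume ∧ HasWeakPartial u v j then h.choose else 0

/-- The mass `‖u‖₂²`. -/
def mass {N : ℕ} (u : E N → ℂ) : ℝ := ∫ x, ‖u x‖ ^ 2

/-- `‖∇u‖₂²`. -/
def gradSq {N : ℕ} (u : E N → ℂ) : ℝ := ∫ x, ∑ j, ‖weakPartial u j x‖ ^ 2

/-- The norm of `Σ`: `‖u‖_Σ² = ∫ (|∇u|² + |x|² |u|² + |u|²)`. -/
def sigmaNorm {N : ℕ} (u : E N → ℂ) : ℝ :=
  Real.sqrt (∫ x, ((∑ j, ‖weakPartial u j x‖ ^ 2) + ‖x‖ ^ 2 * ‖u x‖ ^ 2 + ‖u x‖ ^ 2))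

/-- A sequence in `Σ` is precompact if each of its subsequences has a further subsequence that
converges in the norm of `Σ` to an element of `Σ`. -/
def PrecompactInSigma {N : ℕ} (u : ℕ → E N → ℂ) : Prop :=
  ∀ k : ℕ → ℕ, StrictMono k → ∃ l : ℕ → ℕ, StrictMono l ∧
    ∃ φ : E N → ℂ, MemSigma φ ∧
      Tendsto (fun n => sigmaNorm (fun x => u (k (l n)) x - φ x)) atTop (𝓝 0)

/-! ### Rotation -/

/-- A vector with `N` components regarded as a vector with three components (missing ones are
zero). -/
def pad {N : ℕ} (v : Fin N → ℂ) : Fin 3 → ℂ :=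
  fun i => if h : (i : ℕ) < N then v ⟨i, h⟩ else 0

/-- The function `L u = -i x ∧ ∇u`, with values in `ℂ³`. -/
def angMom {N : ℕ} (u : E N → ℂ) (x : E N) : Fin 3 → ℂ :=
  (-Complex.I) • crossProduct (pad fun i => ((x i : ℝ) : ℂ)) (pad fun j => weakPartial u j x)

/-- The angular momentum operator `L_Ω u = -Ω · L u`. -/
def LOmega {N : ℕ} (Ω : EuclideanSpace ℝ (Fin 3)) (u : E N → ℂ) (x : E N) : ℂ :=
  - ∑ i, ((Ω i : ℝ) : ℂ) * angMom u x i

/-- The angular momentum `l_Ω(u) = ⟨L_Ω u, u⟩ = ∫ (L_Ω u) ū`, which is real for `u ∈ Σ`. -/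
def lOmega {N : ℕ} (Ω : EuclideanSpace ℝ (Fin 3)) (u : E N → ℂ) : ℝ :=
  (∫ x, LOmega Ω u x * (starRingEnd ℂ) (u x)).re

/-! ### Functionals -/

/-- The quadratic form `t[u] = ‖∇u‖₂² + ∫ V |u|² + 2 l_Ω(u)`, which is also `‖u‖_H²`. -/
def quadForm {N : ℕ} (γ : Fin N → ℝ) (Ω : EuclideanSpace ℝ (Fin 3)) (u : E N → ℂ) : ℝ :=
  gradSq u + (∫ x, V γ x * ‖u x‖ ^ 2) + 2 * lOmega Ω u

/-- The energy `E_Ω(u) = t[u] / 2 - 2 / (p + 1) ∫ |u|^(p+1)`. -/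
def energy {N : ℕ} (γ : Fin N → ℝ) (Ω : EuclideanSpace ℝ (Fin 3)) (p : ℝ) (u : E N → ℂ) : ℝ :=
  1 / 2 * quadForm γ Ω u - 2 / (p + 1) * ∫ x, ‖u x‖ ^ (p + 1)

/-- `λ₀ = - inf {t[u] : u ∈ Σ, ‖u‖₂² = 1}`. -/
def lambdaZero {N : ℕ} (γ : Fin N → ℝ) (Ω : EuclideanSpace ℝ (Fin 3)) : ℝ :=
  - sInf (quadForm γ Ω '' {u : E N → ℂ | MemSigma u ∧ mass u = 1})

/-! ### The local minimization problem -/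

/-- `D_q ∩ B_r = {u ∈ Σ : ‖u‖₂² = q, ‖u‖_H² ≤ r}`. -/
def admissible {N : ℕ} (γ : Fin N → ℝ) (Ω : EuclideanSpace ℝ (Fin 3)) (r q : ℝ) :
    Set (E N → ℂ) :=
  {u | MemSigma u ∧ mass u = q ∧ quadForm γ Ω u ≤ r}

/-- `J_q^r = inf {E_Ω(u) : u ∈ D_q ∩ B_r}`, as an extended real number. -/
def J {N : ℕ} (γ : Fin N → ℝ) (Ω : EuclideanSpace ℝ (Fin 3)) (p r q : ℝ) : EReal :=
  ⨅ u ∈ (admissible γ Ω r q : Set (E N → ℂ)), (energy γ Ω p u : EReal)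

/-- Minimizing sequences for `J_q^r`. -/
def IsMinimizingSeq {N : ℕ} (γ : Fin N → ℝ) (Ω : EuclideanSpace ℝ (Fin 3)) (p r q : ℝ)
    (u : ℕ → E N → ℂ) : Prop :=
  (∀ n, u n ∈ admissible γ Ω r q) ∧
    Tendsto (fun n => (energy γ Ω p (u n) : EReal)) atTop (𝓝 (J γ Ω p r q))

/-- The set `G_q^r` of minimizers for `J_q^r`. -/
def minimizers {N : ℕ} (γ : Fin N → ℝ) (Ω : EuclideanSpace ℝ (Fin 3)) (p r q : ℝ) :
    Set (E N → ℂ) :=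
  {u | u ∈ admissible γ Ω r q ∧ (energy γ Ω p u : EReal) = J γ Ω p r q}

/-- `φ ∈ Σ \ {0}` solves `-Δφ + ωφ + Vφ - 2|φ|^(p-1) φ + 2 L_Ω φ = 0` in the weak sense, that is,
in the dual of `Σ`: the equation is tested against all `v ∈ Σ`. -/
def IsStationarySol {N : ℕ} (γ : Fin N → ℝ) (Ω : EuclideanSpace ℝ (Fin 3)) (p ω : ℝ)
    (φ : E N → ℂ) : Prop :=
  MemSigma φ ∧ ¬ (φ =ᵐ[volume] 0) ∧
  ∀ v : E N → ℂ, MemSigma v →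
    (∫ x, ∑ j, weakPartial φ j x * (starRingEnd ℂ) (weakPartial v j x))
      + (ω : ℂ) * (∫ x, φ x * (starRingEnd ℂ) (v x))
      + (∫ x, ((V γ x : ℝ) : ℂ) * φ x * (starRingEnd ℂ) (v x))
      - 2 * (∫ x, ((‖φ x‖ ^ (p - 1) : ℝ) : ℂ) * φ x * (starRingEnd ℂ) (v x))
      + 2 * (∫ x, LOmega Ω φ x * (starRingEnd ℂ) (v x)) = 0

end

end RotNLS

/-!
The energy space is encoded as the Hilbert space `Sig N`: a closed subspace of a product of `2N + 1`
copies of `L²`, in which `u` is stored together with its weak derivatives and the products `x_j u`.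
Every function of class `Σ` is represented by an element of it (`MemSigma.exists_rep`), and the
functionals of the statement become continuous functions on it (`quadForm_of_rep`,
`energy_of_rep`). Cutting off and mollifying shows that test functions are dense (`dense_test`), so
closed properties need only be checked for them: integration by parts (`inner_X_D`), the translation
estimate and the Gagliardo–Nirenberg inequality are obtained in this way.

Three facts carry the argument. First, pointwise `2 |Ω ∧ x| |∇u| ≤ |Ω| (g |x|² + |∇u|² / g)` for
the number `g = min γ_j`, so `|Ω| < g` makes the form `t` coercive on `Σ` (`exists_coercive`).
Secondly, the potential energy `P(u) = ‖u‖_{p+1}^{p+1}` satisfies `P ≤ C t^b q^a` for functions of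
mass `q`, with `a + b = (p + 1) / 2`; here `b ≥ 1` because `p` is mass-supercritical and `a > 0`
because `p` is energy-subcritical (`gagliardoNirenberg`). Thirdly, the trap makes the embedding of
`Σ` into `L²` compact (`exists_subseq_cauchySeq_ι`).

Let `μ = -λ₀ > 0` be the bottom of the linear problem. In the ball `t ≤ r` the second fact reads
`P ≤ C r^(b-1) q^a t`, so for small `q` the nonlinear term is at most a fraction of `t`, and energy
at most `μ q / 2` forces `t ≤ 2 μ q < r` (`quad_le_of_enrg_le`). On the other hand the
infimum `J` is strictly smaller than `μ q / 2`: for functions of mass one that nearly attain `μ`, `P`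
is bounded below, since mass confined by the trap cannot spread out (`exists_enrg_lt`). Hence
minimizing sequences eventually stay away from the boundary of the ball. Along a subsequence that
is Cauchy in `L²`, the half differences have vanishing mass, hence vanishing `P` by interpolation;
as midpoints rescaled to mass `q` are admissible and so have energy at least `J`, the parallelogram
law for `t` makes the subsequence Cauchy in `Σ` (`exists_subseq_tendsto_minimizer`). No weak
limits in `Σ` are needed.

A minimizer `φ` lies in the interior of the ball, so it satisfies the Euler–Lagrange equation with
the multiplier `ω = (2 P(φ) - t(φ)) / q` (`euler_lagrange`). Only the one-sided bound coming from
convexity of `P` (`pot_tangent`) enters, so `P` is never differentiated. Finally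
`t(φ) / 2 - 2 P(φ) / (p + 1) < μ q / 2` and `p > 1` give `ω > -μ = λ₀`, whereas `t(φ) ≥ μ q` and
`P(φ) ≤ C (2 μ q)^b q^a`, of order `q^((p + 1) / 2)`, give the upper bound.
-/

namespace RotNLS

/-! ### Weak partial derivatives -/

section WeakPartial

variable {N : ℕ}

/-- The `j`-th coordinate vector. -/
noncomputable abbrev basisVec (j : Fin N) : E N := EuclideanSpace.single j 1

lemma integrable_test_mul {ψ u : E N → ℂ} (hψ : Continuous ψ) (hc : HasCompactSupport ψ)
    (hu : MemLp u 2 volume) : Integrable (fun x => ψ x * u x) :=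
  (hψ.memLp_of_hasCompactSupport (p := 2) hc).integrable_mul hu

lemma contDiff_ofReal_comp {ψ : E N → ℝ} (hψ : ContDiff ℝ ((⊤ : ℕ∞) : WithTop ℕ∞) ψ) :
    ContDiff ℝ ((⊤ : ℕ∞) : WithTop ℕ∞) (fun x => (ψ x : ℂ)) :=
  Complex.ofRealCLM.contDiff.comp hψ

lemma hasCompactSupport_ofReal {ψ : E N → ℝ} (hψ : HasCompactSupport ψ) :
    HasCompactSupport (fun x => (ψ x : ℂ)) :=
  hψ.comp_left (g := fun t : ℝ => (t : ℂ)) (by simp)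

lemma continuous_partial {F : Type*} [NormedAddCommGroup F] [NormedSpace ℝ F] {ψ : E N → F}
    (hψ : ContDiff ℝ ((⊤ : ℕ∞) : WithTop ℕ∞) ψ) (h : E N) :
    Continuous (fun x => fderiv ℝ ψ x h) :=
  (hψ.continuous_fderiv (by simp)).clm_apply continuous_const

lemma hasCompactSupport_partial {F : Type*} [NormedAddCommGroup F] [NormedSpace ℝ F]
    {ψ : E N → F} (hc : HasCompactSupport ψ) (h : E N) :
    HasCompactSupport (fun x => fderiv ℝ ψ x h) :=
  (hc.fderiv (𝕜 := ℝ)).comp_left (g := fun L : E N →L[ℝ] F => L h) (by simp)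

lemma HasWeakPartial.congr {u u' v v' : E N → ℂ} {j : Fin N} (h : HasWeakPartial u v j)
    (hu : u =ᵐ[volume] u') (hv : v =ᵐ[volume] v') : HasWeakPartial u' v' j := by
  intro ψ hψ hc
  have h1 : ∫ x, ((fderiv ℝ ψ x (EuclideanSpace.single j 1) : ℝ) : ℂ) * u' x
      = ∫ x, ((fderiv ℝ ψ x (EuclideanSpace.single j 1) : ℝ) : ℂ) * u x :=
    integral_congr_ae (by filter_upwards [hu] with x hx; rw [hx])
  have h2 : ∫ x, ((ψ x : ℝ) : ℂ) * v' x = ∫ x, ((ψ x : ℝ) : ℂ) * v x :=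
    integral_congr_ae (by filter_upwards [hv] with x hx; rw [hx])
  rw [h1, h2, h ψ hψ hc]

lemma integrable_realTest_mul {ψ : E N → ℝ} {u : E N → ℂ}
    (hψ : Continuous ψ) (hc : HasCompactSupport ψ)
    (hu : MemLp u 2 volume) : Integrable (fun x => ((ψ x : ℝ) : ℂ) * u x) :=
  integrable_test_mul (Complex.continuous_ofReal.comp hψ) (hasCompactSupport_ofReal hc) hu

lemma HasWeakPartial.add {u u' v v' : E N → ℂ} {j : Fin N} (h : HasWeakPartial u v j)
    (h' : HasWeakPartial u' v' j) (hu : MemLp u 2 volume) (hv : MemLp v 2 volume)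
    (hu' : MemLp u' 2 volume) (hv' : MemLp v' 2 volume) :
    HasWeakPartial (u + u') (v + v') j := by
  intro ψ hψ hc
  have cψ := hψ.continuous
  have cd := continuous_partial hψ (basisVec j)
  have sd := hasCompactSupport_partial hc (basisVec j)
  simp only [Pi.add_apply, mul_add]
  rw [integral_add (integrable_realTest_mul cd sd hu) (integrable_realTest_mul cd sd hu'),
    integral_add (integrable_realTest_mul cψ hc hv) (integrable_realTest_mul cψ hc hv'),
    h ψ hψ hc, h' ψ hψ hc]
  ring

lemma HasWeakPartial.const_smul {u v : E N → ℂ} {j : Fin N} (h : HasWeakPartial u v j) (c : ℂ) :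
    HasWeakPartial (c • u) (c • v) j := by
  intro ψ hψ hc
  simp only [Pi.smul_apply, smul_eq_mul]
  simp_rw [mul_left_comm _ c]
  rw [integral_const_mul, integral_const_mul, h ψ hψ hc]
  ring

lemma hasWeakPartial_zero (j : Fin N) : HasWeakPartial (0 : E N → ℂ) 0 j := by
  intro ψ _ _
  simp

lemma HasWeakPartial.ae_unique {u v v' : E N → ℂ} {j : Fin N} (h : HasWeakPartial u v j)
    (h' : HasWeakPartial u v' j) (hv : MemLp v 2 volume) (hv' : MemLp v' 2 volume) :
    v =ᵐ[volume] v' := by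
  refine ae_eq_of_integral_contDiff_smul_eq (hv.locallyIntegrable (by norm_num))
    (hv'.locallyIntegrable (by norm_num)) fun ψ hψ hc => ?_
  have := (h ψ hψ hc).symm.trans (h' ψ hψ hc)
  simpa [Complex.real_smul] using this

/-- The defining identity of a weak derivative holds for complex-valued test functions too. -/
lemma HasWeakPartial.integral_complex {u v : E N → ℂ} {j : Fin N} (h : HasWeakPartial u v j)
    (hu : MemLp u 2 volume) (hv : MemLp v 2 volume) {ψ : E N → ℂ}
    (hψ : ContDiff ℝ ((⊤ : ℕ∞) : WithTop ℕ∞) ψ) (hc : HasCompactSupport ψ) :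
    ∫ x, fderiv ℝ ψ x (basisVec j) * u x = - ∫ x, ψ x * v x := by
  have hre : ContDiff ℝ ((⊤ : ℕ∞) : WithTop ℕ∞) (fun x => (ψ x).re) :=
    Complex.reCLM.contDiff.comp hψ
  have him : ContDiff ℝ ((⊤ : ℕ∞) : WithTop ℕ∞) (fun x => (ψ x).im) :=
    Complex.imCLM.contDiff.comp hψ
  have cre : HasCompactSupport (fun x => (ψ x).re) := hc.comp_left (g := Complex.re) rfl
  have cim : HasCompactSupport (fun x => (ψ x).im) := hc.comp_left (g := Complex.im) rfl
  have dre : ∀ x, fderiv ℝ (fun x => (ψ x).re) x (basisVec j)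
      = (fderiv ℝ ψ x (basisVec j)).re := fun x => by
    have := (Complex.reCLM.hasFDerivAt.comp x
      ((hψ.differentiable (by simp)) x).hasFDerivAt).fderiv
    exact congrArg (fun L : E N →L[ℝ] ℝ => L (basisVec j)) this
  have dim : ∀ x, fderiv ℝ (fun x => (ψ x).im) x (basisVec j)
      = (fderiv ℝ ψ x (basisVec j)).im := fun x => by
    have := (Complex.imCLM.hasFDerivAt.comp x
      ((hψ.differentiable (by simp)) x).hasFDerivAt).fderiv
    exact congrArg (fun L : E N →L[ℝ] ℝ => L (basisVec j)) this
  have e1 := h _ hre cre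
  have e2 := h _ him cim
  have i1 := integrable_realTest_mul (continuous_partial hre (basisVec j))
    (hasCompactSupport_partial cre (basisVec j)) hu
  have i2 := integrable_realTest_mul (continuous_partial him (basisVec j))
    (hasCompactSupport_partial cim (basisVec j)) hu
  have i3 := integrable_realTest_mul hre.continuous cre hv
  have i4 := integrable_realTest_mul him.continuous cim hv
  have l : ∫ x, fderiv ℝ ψ x (basisVec j) * u x
      = (∫ x, ((fderiv ℝ (fun x => (ψ x).re) x (basisVec j) : ℝ) : ℂ) * u x)
        + Complex.I * ∫ x, ((fderiv ℝ (fun x => (ψ x).im) x (basisVec j) : ℝ) : ℂ) * u x := by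
    rw [← integral_const_mul, ← integral_add i1 (i2.const_mul _)]
    refine integral_congr_ae (ae_of_all _ fun x => ?_)
    simp only [dre, dim]
    conv_lhs => rw [← Complex.re_add_im (fderiv ℝ ψ x (basisVec j))]
    ring
  have r : ∫ x, ψ x * v x = (∫ x, (((ψ x).re : ℝ) : ℂ) * v x)
        + Complex.I * ∫ x, (((ψ x).im : ℝ) : ℂ) * v x := by
    rw [← integral_const_mul, ← integral_add i3 (i4.const_mul _)]
    refine integral_congr_ae (ae_of_all _ fun x => ?_)
    simp only
    conv_lhs => rw [← Complex.re_add_im (ψ x)]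
    ring
  rw [l, r, e1, e2]
  ring

end WeakPartial

/-! ### The energy space as a closed subspace of a product of `L²` spaces -/

section EnergySpace

/-- The Hilbert space `L²(ℝ^N; ℂ)`. -/
abbrev L2 (N : ℕ) : Type := Lp ℂ 2 (volume : Measure (E N))

/-- The product of `2N + 1` copies of `L²`, which will hold `u`, its weak partial derivatives
(indices `some (inl j)`) and the functions `x_j u` (indices `some (inr j)`). -/
abbrev Amb (N : ℕ) : Type := PiLp 2 (fun _ : Option (Fin N ⊕ Fin N) => L2 N)

variable {N : ℕ}

lemma L2.continuous_integral_mul {w : E N → ℂ} (hw : MemLp w 2 volume) :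
    Continuous fun f : L2 N => ∫ x, w x * f x := by
  have h : (fun f : L2 N => ∫ x, w x * f x)
      = fun f : L2 N => inner ℂ (hw.star.toLp _) f := by
    funext f
    rw [L2.inner_def]
    refine integral_congr_ae ?_
    filter_upwards [hw.star.coeFn_toLp] with x hx
    rw [hx]
    simp [mul_comm]
  rw [h]
  fun_prop

lemma memLp_test {ψ : E N → ℝ} (hψ : Continuous ψ) (hc : HasCompactSupport ψ) :
    MemLp (fun x => ((ψ x : ℝ) : ℂ)) 2 volume :=
  (Complex.continuous_ofReal.comp hψ).memLp_of_hasCompactSupport (hasCompactSupport_ofReal hc)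

/-- The energy space `Σ`, each element `u` being stored together with its weak partial derivatives
and the functions `x_j u`, so that the norm inherited from the product is the norm of `Σ`. -/
noncomputable def Sig (N : ℕ) : Submodule ℂ (Amb N) where
  carrier := {f | ∀ j, HasWeakPartial (f none) (f (some (Sum.inl j))) j ∧
    (f (some (Sum.inr j)) : E N → ℂ) =ᵐ[volume] fun x => ((x j : ℝ) : ℂ) * f none x}
  zero_mem' j := by
    refine ⟨(hasWeakPartial_zero j).congr (Lp.coeFn_zero _ _ _).symm (Lp.coeFn_zero _ _ _).symm, ?_⟩
    filter_upwards [Lp.coeFn_zero ℂ 2 (volume : Measure (E N))] with x _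
    simp
  add_mem' {f g} hf hg j := by
    refine ⟨((hf j).1.add (hg j).1 (Lp.memLp _) (Lp.memLp _) (Lp.memLp _) (Lp.memLp _)).congr
      (Lp.coeFn_add _ _).symm (Lp.coeFn_add _ _).symm, ?_⟩
    filter_upwards [(hf j).2, (hg j).2, Lp.coeFn_add (f none) (g none),
      Lp.coeFn_add (f (some (Sum.inr j))) (g (some (Sum.inr j)))] with x h1 h2 h3 h4
    simp only [PiLp.add_apply, h3, h4, Pi.add_apply, h1, h2, mul_add]
  smul_mem' c f hf j := by
    refine ⟨((hf j).1.const_smul c).congr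
      (Lp.coeFn_smul _ _).symm (Lp.coeFn_smul _ _).symm, ?_⟩
    filter_upwards [(hf j).2, Lp.coeFn_smul c (f none),
      Lp.coeFn_smul c (f (some (Sum.inr j)))] with x h1 h3 h4
    simp only [PiLp.smul_apply, h3, h4, Pi.smul_apply, h1, smul_eq_mul]
    ring

/-- A product `x_j u` is determined by its integrals against test functions. -/
lemma ae_eq_coord_mul_iff {f g : L2 N} {j : Fin N} :
    ((g : E N → ℂ) =ᵐ[volume] fun x => ((x j : ℝ) : ℂ) * f x) ↔
    ∀ ψ : E N → ℝ, ContDiff ℝ ((⊤ : ℕ∞) : WithTop ℕ∞) ψ → HasCompactSupport ψ →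
      ∫ x, ((ψ x : ℝ) : ℂ) * g x = ∫ x, ((x j * ψ x : ℝ) : ℂ) * f x := by
  constructor
  · intro h ψ _ _
    refine integral_congr_ae ?_
    filter_upwards [h] with x hx
    rw [hx]; push_cast; ring
  · intro h
    have hf : LocallyIntegrable (fun x : E N => ((x j : ℝ) : ℂ) * f x) volume := by
      have h0 := (Lp.memLp f).locallyIntegrable (by norm_num)
      have : LocallyIntegrable (fun x : E N => ((x j : ℝ) : ℂ) • f x) volume := by
        rw [← locallyIntegrableOn_univ] at h0 ⊢
        exact h0.continuousOn_smul isClosed_univ.isLocallyClosed (by fun_prop)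
      simpa using this
    refine ae_eq_of_integral_contDiff_smul_eq
      ((Lp.memLp g).locallyIntegrable (by norm_num)) hf fun ψ hψ hc => ?_
    have := h ψ hψ hc
    simp only [Complex.real_smul]
    rw [this]
    refine integral_congr_ae (ae_of_all _ fun x => ?_)
    simp only; push_cast; ring

lemma isClosed_Sig : IsClosed (Sig N : Set (Amb N)) := by
  have hset : (Sig N : Set (Amb N)) = ⋂ j : Fin N, ⋂ ψ : E N → ℝ,
      ⋂ _ : ContDiff ℝ ((⊤ : ℕ∞) : WithTop ℕ∞) ψ, ⋂ _ : HasCompactSupport ψ,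
      ({f : Amb N | ∫ x, ((fderiv ℝ ψ x (EuclideanSpace.single j 1) : ℝ) : ℂ) * f none x
      = - ∫ x, ((ψ x : ℝ) : ℂ) * f (some (Sum.inl j)) x} ∩
      {f : Amb N | ∫ x, ((ψ x : ℝ) : ℂ) * f (some (Sum.inr j)) x
        = ∫ x, ((x j * ψ x : ℝ) : ℂ) * f none x}) := by
    ext f
    simp only [Set.mem_iInter]
    constructor
    · intro hf j ψ hψ hc
      exact ⟨(hf j).1 ψ hψ hc, ae_eq_coord_mul_iff.1 (hf j).2 ψ hψ hc⟩
    · intro hf j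
      exact ⟨fun ψ hψ hc => (hf j ψ hψ hc).1,
        ae_eq_coord_mul_iff.2 fun ψ hψ hc => (hf j ψ hψ hc).2⟩
  rw [hset]
  refine isClosed_iInter fun j => isClosed_iInter fun ψ => isClosed_iInter fun hψ =>
    isClosed_iInter fun hc => IsClosed.inter ?_ ?_
  · have m1 := memLp_test (continuous_partial hψ (basisVec j))
      (hasCompactSupport_partial hc (basisVec j))
    have m2 := memLp_test hψ.continuous hc
    exact isClosed_eq ((L2.continuous_integral_mul m1).comp (PiLp.proj 2 _ none : Amb N →L[ℂ] L2 N).continuous)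
      ((L2.continuous_integral_mul m2).comp (PiLp.proj 2 _ _ : Amb N →L[ℂ] L2 N).continuous).neg
  · have m1 : MemLp (fun x : E N => ((x j * ψ x : ℝ) : ℂ)) 2 volume :=
      memLp_test (ψ := fun x => x j * ψ x)
        ((by fun_prop : Continuous fun x : E N => x j).mul hψ.continuous) hc.mul_left
    have m2 := memLp_test hψ.continuous hc
    exact isClosed_eq ((L2.continuous_integral_mul m2).comp (PiLp.proj 2 _ _ : Amb N →L[ℂ] L2 N).continuous)
      ((L2.continuous_integral_mul m1).comp (PiLp.proj 2 _ none : Amb N →L[ℂ] L2 N).continuous)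

instance : CompleteSpace (Sig N) := isClosed_Sig.completeSpace_coe

/-- The inclusion of `Σ` into `L²`. -/
noncomputable def ι : Sig N →L[ℂ] L2 N :=
  (PiLp.proj 2 _ none : Amb N →L[ℂ] L2 N).comp (Sig N).subtypeL

/-- The weak partial derivative `∂_j : Σ → L²`. -/
noncomputable def D (j : Fin N) : Sig N →L[ℂ] L2 N :=
  (PiLp.proj 2 _ (some (Sum.inl j)) : Amb N →L[ℂ] L2 N).comp (Sig N).subtypeL

/-- Multiplication by the coordinate `x_j`, from `Σ` to `L²`. -/
noncomputable def X (j : Fin N) : Sig N →L[ℂ] L2 N :=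
  (PiLp.proj 2 _ (some (Sum.inr j)) : Amb N →L[ℂ] L2 N).comp (Sig N).subtypeL

lemma hasWeakPartial_D (s : Sig N) (j : Fin N) : HasWeakPartial (ι s) (D j s) j := (s.2 j).1

lemma X_ae (s : Sig N) (j : Fin N) :
    (X j s : E N → ℂ) =ᵐ[volume] fun x => ((x j : ℝ) : ℂ) * ι s x := (s.2 j).2

lemma Sig.norm_sq (s : Sig N) :
    ‖s‖ ^ 2 = ‖ι s‖ ^ 2 + (∑ j, ‖D j s‖ ^ 2 + ∑ j, ‖X j s‖ ^ 2) := by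
  change ‖(s : Amb N)‖ ^ 2 = _
  rw [PiLp.norm_sq_eq_of_L2, Fintype.sum_option, Fintype.sum_sum_type]
  rfl

lemma norm_ι_sq_le_norm_sq (s : Sig N) : ‖ι s‖ ^ 2 ≤ ‖s‖ ^ 2 := by
  rw [Sig.norm_sq]
  have : 0 ≤ ∑ j, ‖D j s‖ ^ 2 + ∑ j, ‖X j s‖ ^ 2 := by positivity
  linarith

lemma sum_norm_X_sq_le (s : Sig N) : ∑ j, ‖X j s‖ ^ 2 ≤ ‖s‖ ^ 2 := by
  rw [Sig.norm_sq]
  have : 0 ≤ ∑ j, ‖D j s‖ ^ 2 := Finset.sum_nonneg fun j _ => sq_nonneg _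
  linarith [sq_nonneg ‖ι s‖]

end EnergySpace

/-! ### Functions representing elements of the energy space -/

section Representatives

variable {N : ℕ}

lemma L2.integrable_mul_conj (f g : L2 N) :
    Integrable fun x => f x * (starRingEnd ℂ) (g x) :=
  (Lp.memLp f).integrable_mul (Lp.memLp g).star

lemma L2.integral_mul_conj (f g : L2 N) :
    ∫ x, f x * (starRingEnd ℂ) (g x) = inner ℂ g f := by
  rw [L2.inner_def]
  rfl

lemma L2.integrable_norm_sq (f : L2 N) : Integrable fun x => ‖f x‖ ^ 2 :=
  (memLp_two_iff_integrable_sq_norm (Lp.memLp f).1).1 (Lp.memLp f)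

lemma L2.integral_norm_sq (f : L2 N) : ∫ x, ‖f x‖ ^ 2 = ‖f‖ ^ 2 := by
  have h := L2.integral_mul_conj f f
  rw [inner_self_eq_norm_sq_to_K] at h
  have h2 : (∫ x, f x * (starRingEnd ℂ) (f x)) = ((∫ x, ‖f x‖ ^ 2 : ℝ) : ℂ) := by
    rw [← integral_complex_ofReal]
    refine integral_congr_ae (ae_of_all _ fun x => ?_)
    simp only [Complex.mul_conj, Complex.normSq_eq_norm_sq]
  rw [h2] at h
  exact Complex.ofReal_injective (by simpa using h)

lemma memLp_coord_mul {u : E N → ℂ} (hu : MemLp u 2 volume)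
    (hx : MemLp (fun x : E N => ((‖x‖ : ℝ) : ℂ) * u x) 2 volume) (j : Fin N) :
    MemLp (fun x : E N => ((x j : ℝ) : ℂ) * u x) 2 volume := by
  refine hx.of_le ((Continuous.aestronglyMeasurable (by fun_prop)).mul hu.1)
    (ae_of_all _ fun x => ?_)
  rw [norm_mul, norm_mul]
  gcongr
  simpa using PiLp.norm_apply_le x j

/-- Every function of class `Σ` is represented by an element of the Hilbert space `Sig N`. -/
lemma MemSigma.exists_rep {u : E N → ℂ} (hu : MemSigma u) :
    ∃ s : Sig N, u =ᵐ[volume] ι s := by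
  obtain ⟨h1, h2, h3⟩ := hu
  choose v hv hw using h2
  let f : Amb N := WithLp.toLp 2 fun i => match i with
    | none => h1.toLp u
    | some (Sum.inl j) => (hv j).toLp (v j)
    | some (Sum.inr j) => (memLp_coord_mul h1 h3 j).toLp _
  have hf : f ∈ Sig N := by
    intro j
    refine ⟨(hw j).congr h1.coeFn_toLp.symm (hv j).coeFn_toLp.symm, ?_⟩
    refine (memLp_coord_mul h1 h3 j).coeFn_toLp.trans ?_
    filter_upwards [h1.coeFn_toLp] with x hx
    exact congrArg _ hx.symm
  exact ⟨⟨f, hf⟩, h1.coeFn_toLp.symm⟩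

lemma norm_mul_norm_sq_eq (x : E N) (z : ℂ) :
    ‖x‖ ^ 2 * ‖z‖ ^ 2 = ∑ j, ‖((x j : ℝ) : ℂ) * z‖ ^ 2 := by
  rw [EuclideanSpace.norm_sq_eq, Finset.sum_mul]
  refine Finset.sum_congr rfl fun j _ => ?_
  rw [norm_mul, mul_pow, Complex.norm_real]

lemma Sig.ae_norm_mul (s : Sig N) :
    ∀ᵐ x, ‖x‖ ^ 2 * ‖ι s x‖ ^ 2 = ∑ j, ‖X j s x‖ ^ 2 := by
  filter_upwards [ae_all_iff.2 (X_ae s)] with x hx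
  rw [norm_mul_norm_sq_eq]
  exact Finset.sum_congr rfl fun j _ => by rw [hx j]

lemma memSigma_of_rep {u : E N → ℂ} {s : Sig N} (h : u =ᵐ[volume] ι s) : MemSigma u := by
  have hu : MemLp u 2 volume := (memLp_congr_ae h).2 (Lp.memLp _)
  refine ⟨hu, fun j => ⟨D j s, Lp.memLp _, (hasWeakPartial_D s j).congr h.symm ae_eq_rfl⟩, ?_⟩
  have hm : AEStronglyMeasurable (fun x : E N => ((‖x‖ : ℝ) : ℂ) * u x) volume :=
    (Continuous.aestronglyMeasurable (by fun_prop)).mul hu.1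
  rw [memLp_two_iff_integrable_sq_norm hm]
  refine (integrable_finsetSum (f := fun j x => ‖X j s x‖ ^ 2) Finset.univ
    fun j _ => L2.integrable_norm_sq (X j s)).congr ?_
  filter_upwards [Sig.ae_norm_mul s, h] with x hx h'
  rw [← hx, h', norm_mul, mul_pow, Complex.norm_real, norm_norm]

lemma weakPartial_ae {u : E N → ℂ} {s : Sig N} (h : u =ᵐ[volume] ι s) (j : Fin N) :
    weakPartial u j =ᵐ[volume] D j s := by
  have hex : ∃ v : E N → ℂ, MemLp v 2 volume ∧ HasWeakPartial u v j :=
    (memSigma_of_rep h).2.1 j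
  rw [weakPartial, dif_pos hex]
  exact hex.choose_spec.2.ae_unique ((hasWeakPartial_D s j).congr h.symm ae_eq_rfl)
    hex.choose_spec.1 (Lp.memLp _)

lemma mass_of_rep {u : E N → ℂ} {s : Sig N} (h : u =ᵐ[volume] ι s) : mass u = ‖ι s‖ ^ 2 := by
  rw [mass, ← L2.integral_norm_sq]
  refine integral_congr_ae ?_
  filter_upwards [h] with x hx
  rw [hx]

lemma gradSq_of_rep {u : E N → ℂ} {s : Sig N} (h : u =ᵐ[volume] ι s) :
    gradSq u = ∑ j, ‖D j s‖ ^ 2 := by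
  simp_rw [gradSq, ← L2.integral_norm_sq]
  rw [← integral_finsetSum _ fun j _ => L2.integrable_norm_sq (D j s)]
  refine integral_congr_ae ?_
  filter_upwards [ae_all_iff.2 (weakPartial_ae h)] with x hx
  exact Finset.sum_congr rfl fun j _ => by rw [hx j]

lemma sigmaNorm_of_rep {u : E N → ℂ} {s : Sig N} (h : u =ᵐ[volume] ι s) :
    sigmaNorm u = ‖s‖ := by
  rw [sigmaNorm, ← Real.sqrt_sq (norm_nonneg s), Sig.norm_sq]
  congr 1
  simp_rw [← L2.integral_norm_sq]
  rw [← integral_finsetSum _ fun j _ => L2.integrable_norm_sq (D j s),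
    ← integral_finsetSum _ fun j _ => L2.integrable_norm_sq (X j s),
    ← integral_add, ← integral_add]
  · refine integral_congr_ae ?_
    filter_upwards [ae_all_iff.2 (weakPartial_ae h), h, Sig.ae_norm_mul s] with x h1 h2 h3
    simp only [h1, h2, h3]
    ring
  · exact L2.integrable_norm_sq _
  · exact (integrable_finsetSum _ fun j _ => L2.integrable_norm_sq (D j s)).add
      (integrable_finsetSum _ fun j _ => L2.integrable_norm_sq (X j s))
  · exact integrable_finsetSum _ fun j _ => L2.integrable_norm_sq (D j s)
  · exact integrable_finsetSum _ fun j _ => L2.integrable_norm_sq (X j s)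

lemma rep_sub {u v : E N → ℂ} {s s' : Sig N} (h : u =ᵐ[volume] ι s) (h' : v =ᵐ[volume] ι s') :
    (fun x => u x - v x) =ᵐ[volume] ι (s - s') := by
  rw [map_sub]
  filter_upwards [h, h', Lp.coeFn_sub (ι s) (ι s')] with x h1 h2 h3
  rw [h3, Pi.sub_apply, h1, h2]

lemma integral_gradient_of_rep {u v : E N → ℂ} {s s' : Sig N} (h : u =ᵐ[volume] ι s)
    (h' : v =ᵐ[volume] ι s') :
    ∫ x, ∑ j, weakPartial u j x * (starRingEnd ℂ) (weakPartial v j x)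
      = ∑ j, inner ℂ (D j s') (D j s) := by
  simp_rw [← L2.integral_mul_conj]
  rw [← integral_finsetSum _ fun j _ => L2.integrable_mul_conj _ _]
  refine integral_congr_ae ?_
  filter_upwards [ae_all_iff.2 (weakPartial_ae h), ae_all_iff.2 (weakPartial_ae h')] with x h1 h2
  exact Finset.sum_congr rfl fun j _ => by rw [h1 j, h2 j]

lemma integral_mul_conj_of_rep {u v : E N → ℂ} {s s' : Sig N} (h : u =ᵐ[volume] ι s)
    (h' : v =ᵐ[volume] ι s') :
    ∫ x, u x * (starRingEnd ℂ) (v x) = inner ℂ (ι s') (ι s) := by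
  rw [← L2.integral_mul_conj]
  refine integral_congr_ae ?_
  filter_upwards [h, h'] with x h1 h2
  rw [h1, h2]

lemma integral_potential_of_rep (γ : Fin N → ℝ) {u v : E N → ℂ} {s s' : Sig N}
    (h : u =ᵐ[volume] ι s) (h' : v =ᵐ[volume] ι s') :
    ∫ x, ((V γ x : ℝ) : ℂ) * u x * (starRingEnd ℂ) (v x)
      = ∑ j, (γ j ^ 2 : ℝ) * inner ℂ (X j s') (X j s) := by
  simp_rw [← L2.integral_mul_conj, ← integral_const_mul]
  rw [← integral_finsetSum _ fun j _ => (L2.integrable_mul_conj _ _).const_mul _]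
  refine integral_congr_ae ?_
  filter_upwards [ae_all_iff.2 (X_ae s), ae_all_iff.2 (X_ae s'), h, h'] with x h1 h2 h3 h4
  rw [V, h3, h4]
  push_cast
  rw [Finset.sum_mul, Finset.sum_mul]
  refine Finset.sum_congr rfl fun j _ => ?_
  rw [h1 j, h2 j, map_mul, Complex.conj_ofReal]
  ring

/-- The skew-symmetric real matrix of the linear map `x ↦ Ω ∧ x`, restricted to the first `N`
coordinates. -/
def rotCoef (Ω : EuclideanSpace ℝ (Fin 3)) (j k : Fin N) : ℝ :=
  (!![0, -Ω 2, Ω 1; Ω 2, 0, -Ω 0; -Ω 1, Ω 0, 0] : Matrix (Fin 3) (Fin 3) ℝ)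
    (Fin.ofNat 3 j) (Fin.ofNat 3 k)

lemma rotCoef_swap (Ω : EuclideanSpace ℝ (Fin 3)) (j k : Fin N) :
    rotCoef Ω k j = - rotCoef Ω j k := by
  unfold rotCoef
  generalize Fin.ofNat 3 (j : ℕ) = a
  generalize Fin.ofNat 3 (k : ℕ) = b
  fin_cases a <;> fin_cases b <;> simp

lemma rotCoef_self (Ω : EuclideanSpace ℝ (Fin 3)) (j : Fin N) : rotCoef Ω j j = 0 := by
  have := rotCoef_swap Ω j j
  linarith

/-- In coordinates, `L_Ω = i (Ω ∧ x) · ∇`. -/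
lemma LOmega_eq (hN : N = 2 ∨ N = 3) (Ω : EuclideanSpace ℝ (Fin 3)) (u : E N → ℂ) (x : E N) :
    LOmega Ω u x
      = ∑ j, ∑ k, Complex.I * rotCoef Ω j k * (((x k : ℝ) : ℂ) * weakPartial u j x) := by
  rcases hN with rfl | rfl
  · simp [LOmega, angMom, crossProduct, pad, Fin.sum_univ_succ, rotCoef]
    ring
  · simp [LOmega, angMom, crossProduct, pad, Fin.sum_univ_succ, rotCoef]
    ring

lemma integral_LOmega_of_rep (hN : N = 2 ∨ N = 3) (Ω : EuclideanSpace ℝ (Fin 3))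
    {u v : E N → ℂ} {s s' : Sig N}
    (h : u =ᵐ[volume] ι s) (h' : v =ᵐ[volume] ι s') :
    ∫ x, LOmega Ω u x * (starRingEnd ℂ) (v x)
      = ∑ j, ∑ k, Complex.I * rotCoef Ω j k * inner ℂ (X k s') (D j s) := by
  simp_rw [← L2.integral_mul_conj, ← integral_const_mul]
  simp_rw [← integral_finsetSum Finset.univ
    fun k _ => (L2.integrable_mul_conj (D _ s) (X k s')).const_mul (Complex.I * rotCoef Ω _ k)]
  rw [← integral_finsetSum Finset.univ fun j _ => integrable_finsetSum Finset.univ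
    fun k _ => (L2.integrable_mul_conj (D j s) (X k s')).const_mul (Complex.I * rotCoef Ω j k)]
  refine integral_congr_ae ?_
  filter_upwards [ae_all_iff.2 (weakPartial_ae h), ae_all_iff.2 (X_ae s'), h'] with x h1 h2 h3
  rw [LOmega_eq hN, Finset.sum_mul]
  refine Finset.sum_congr rfl fun j _ => ?_
  rw [Finset.sum_mul]
  refine Finset.sum_congr rfl fun k _ => ?_
  rw [h1 j, h2 k, h3, map_mul, Complex.conj_ofReal]
  ring

end Representatives

/-! ### Mollification in `L²` -/

section Mollification

variable {N : ℕ}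

open scoped ENNReal

lemma eLpNorm_two_rpow {F : Type*} [NormedAddCommGroup F] (g : E N → F) :
    eLpNorm g 2 volume ^ (2 : ℝ) = ∫⁻ x, ‖g x‖ₑ ^ (2 : ℝ) := by
  rw [eLpNorm_eq_lintegral_rpow_enorm_toReal (by norm_num) (by norm_num), ← ENNReal.rpow_mul]
  simp

/-- Translations act continuously on `L²`. -/
lemma eventually_eLpNorm_translate_sub_le (f : L2 N) {ε : ℝ≥0∞} (hε : 0 < ε) :
    ∀ᶠ h : E N in 𝓝 0, eLpNorm (fun x => f (x - h) - f x) 2 volume ≤ ε := by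
  let g : E N → C(E N, E N) := fun h => ⟨fun x => x - h, by fun_prop⟩
  have hg : Continuous g := by
    refine ContinuousMap.continuous_of_continuous_uncurry _ ?_
    change Continuous fun p : E N × E N => p.2 - p.1
    fun_prop
  have hmp : ∀ h, MeasurePreserving (g h) (volume : Measure (E N)) volume :=
    fun h => measurePreserving_sub_right volume h
  have key : Tendsto (fun h => Lp.compMeasurePreserving (g h) (hmp h) f) (𝓝 0)
      (𝓝 (Lp.compMeasurePreserving (g 0) (hmp 0) f)) :=
    Tendsto.compMeasurePreservingLp tendsto_const_nhds (hg.tendsto 0) hmp (hmp 0) (by simp)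
  have h2 := (EMetric.tendsto_nhds.1 key) ε hε
  filter_upwards [h2] with h hh
  refine le_of_eq_of_le ?_ hh.le
  rw [Lp.edist_def]
  refine eLpNorm_congr_ae ?_
  filter_upwards [Lp.coeFn_compMeasurePreserving f (hmp h),
    Lp.coeFn_compMeasurePreserving f (hmp 0)] with x h1 h2
  rw [Pi.sub_apply, h1, h2]
  simp [g]

open scoped Convolution in
/-- Jensen's inequality for mollifiers: averaging translates of `f` moves `f` no further than the
translates themselves do. -/
lemma eLpNorm_mollify_sub_le (φ : ContDiffBump (0 : E N)) (f : L2 N) {K : ℝ≥0∞}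
    (hK : ∀ h ∈ Metric.ball (0 : E N) φ.rOut, eLpNorm (fun x => f (x - h) - f x) 2 volume ≤ K) :
    eLpNorm (fun x => (φ.normed volume ⋆[ContinuousLinearMap.lsmul ℝ ℝ, volume] f) x - f x) 2
      volume ≤ K := by
  have hfm : Measurable f := (Lp.stronglyMeasurable f).measurable
  have hρm : Measurable (fun t => ‖φ.normed volume t‖ₑ) := φ.continuous_normed.measurable.enorm
  have hint1 : ∫⁻ t, ‖φ.normed volume t‖ₑ = 1 := by
    have h := φ.integral_normed (μ := (volume : Measure (E N)))
    rw [integral_eq_lintegral_of_nonneg_ae (ae_of_all _ fun x => φ.nonneg_normed x)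
      φ.continuous_normed.aestronglyMeasurable] at h
    have : ∀ t, ‖φ.normed volume t‖ₑ = ENNReal.ofReal (φ.normed volume t) := fun t =>
      Real.enorm_of_nonneg (φ.nonneg_normed t)
    simp_rw [this]
    have h3 := (ENNReal.toReal_eq_one_iff _).1 h
    exact h3
  have hpt : ∀ x, ‖(φ.normed volume ⋆[ContinuousLinearMap.lsmul ℝ ℝ, volume] f) x - f x‖ₑ ^ (2 : ℝ)
      ≤ ∫⁻ t, ‖φ.normed volume t‖ₑ * ‖f (x - t) - f x‖ₑ ^ (2 : ℝ) := by
    intro x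
    have hex : ConvolutionExistsAt (φ.normed volume) f x
        (ContinuousLinearMap.lsmul ℝ ℝ) volume :=
      (φ.hasCompactSupport_normed.convolutionExists_left _ φ.continuous_normed
        ((Lp.memLp f).locallyIntegrable (by norm_num))) x
    have hconst : f x = ∫ t, φ.normed volume t • f x := by
      rw [integral_smul_const, φ.integral_normed, one_smul]
    have hsub : (φ.normed volume ⋆[ContinuousLinearMap.lsmul ℝ ℝ, volume] f) x - f x
        = ∫ t, φ.normed volume t • (f (x - t) - f x) := by
      conv_lhs => rw [hconst]
      rw [convolution, ← integral_sub hex]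
      · refine integral_congr_ae (ae_of_all _ fun t => ?_)
        simp [mul_sub]
      · exact (φ.integrable_normed).smul_const _
    rw [hsub]
    have h1 : ‖∫ t, φ.normed volume t • (f (x - t) - f x)‖ₑ
        ≤ ∫⁻ t, ‖φ.normed volume t‖ₑ * ‖f (x - t) - f x‖ₑ := by
      refine (enorm_integral_le_lintegral_enorm _).trans (le_of_eq ?_)
      simp_rw [enorm_smul]
    have hm : Measurable fun t => ‖f (x - t) - f x‖ₑ := by fun_prop
    have h2 := ENNReal.lintegral_mul_norm_pow_le (μ := (volume : Measure (E N)))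
      (f := fun t => ‖φ.normed volume t‖ₑ)
      (g := fun t => ‖φ.normed volume t‖ₑ * ‖f (x - t) - f x‖ₑ ^ (2 : ℝ))
      hρm.aemeasurable (hρm.mul (hm.pow_const _)).aemeasurable (p := 1 / 2) (q := 1 / 2)
      (by norm_num) (by norm_num) (by norm_num)
    rw [hint1, ENNReal.one_rpow, one_mul] at h2
    have h3 : ∀ t, ‖φ.normed volume t‖ₑ * ‖f (x - t) - f x‖ₑ
        = ‖φ.normed volume t‖ₑ ^ (1 / 2 : ℝ)
          * (‖φ.normed volume t‖ₑ * ‖f (x - t) - f x‖ₑ ^ (2 : ℝ)) ^ (1 / 2 : ℝ) := by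
      intro t
      rw [ENNReal.mul_rpow_of_nonneg _ _ (by norm_num), ← mul_assoc,
        ← ENNReal.rpow_add_of_nonneg _ _ (by norm_num) (by norm_num), ← ENNReal.rpow_mul]
      norm_num
    simp_rw [h3] at h1
    calc _ ≤ ((∫⁻ t, ‖φ.normed volume t‖ₑ * ‖f (x - t) - f x‖ₑ ^ (2 : ℝ)) ^ (1 / 2 : ℝ)) ^ (2 : ℝ) :=
          ENNReal.rpow_le_rpow (h1.trans h2) (by norm_num)
      _ = _ := by rw [← ENNReal.rpow_mul]; norm_num
  have hmain : eLpNorm (fun x => (φ.normed volume ⋆[ContinuousLinearMap.lsmul ℝ ℝ, volume] f) x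
      - f x) 2 volume ^ (2 : ℝ) ≤ K ^ (2 : ℝ) := by
    rw [eLpNorm_two_rpow]
    calc _ ≤ ∫⁻ x, ∫⁻ t, ‖φ.normed volume t‖ₑ * ‖f (x - t) - f x‖ₑ ^ (2 : ℝ) :=
          lintegral_mono hpt
      _ = ∫⁻ t, ∫⁻ x, ‖φ.normed volume t‖ₑ * ‖f (x - t) - f x‖ₑ ^ (2 : ℝ) := by
          refine lintegral_lintegral_swap (Measurable.aemeasurable ?_)
          refine (hρm.comp measurable_snd).mul (Measurable.pow_const ?_ _)
          have : Measurable fun p : E N × E N => f (p.1 - p.2) - f p.1 :=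
            (hfm.comp (measurable_fst.sub measurable_snd)).sub (hfm.comp measurable_fst)
          exact this.enorm
      _ ≤ ∫⁻ t, ‖φ.normed volume t‖ₑ * K ^ (2 : ℝ) := by
          refine lintegral_mono fun t => ?_
          rw [lintegral_const_mul _ (by fun_prop)]
          by_cases ht : t ∈ Metric.ball (0 : E N) φ.rOut
          · gcongr
            rw [← eLpNorm_two_rpow fun x => f (x - t) - f x]
            exact ENNReal.rpow_le_rpow (hK t ht) (by norm_num)
          · rw [← φ.support_normed_eq (μ := (volume : Measure (E N)))] at ht
            rw [Function.notMem_support.1 ht]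
            simp
      _ = K ^ (2 : ℝ) := by rw [lintegral_mul_const _ hρm, hint1, one_mul]
  exact (ENNReal.rpow_le_rpow_iff (by norm_num)).1 hmain

end Mollification

/-! ### Density of test functions in the energy space -/

section Density

variable {N : ℕ}

lemma Sig.exists_of_components (f : L2 N) (g y : Fin N → L2 N)
    (hg : ∀ j, HasWeakPartial f (g j) j)
    (hy : ∀ j, (y j : E N → ℂ) =ᵐ[volume] fun x => ((x j : ℝ) : ℂ) * f x) :
    ∃ s : Sig N, ι s = f ∧ (∀ j, D j s = g j) ∧ ∀ j, X j s = y j :=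
  ⟨⟨WithLp.toLp 2 fun i => match i with
    | none => f
    | some (Sum.inl j) => g j
    | some (Sum.inr j) => y j, fun j => ⟨hg j, hy j⟩⟩, rfl, fun _ => rfl, fun _ => rfl⟩

lemma Sig.tendsto_of_components {s : ℕ → Sig N} {t : Sig N}
    (h0 : Tendsto (fun n => ‖ι (s n) - ι t‖) atTop (𝓝 0))
    (h1 : ∀ j, Tendsto (fun n => ‖D j (s n) - D j t‖) atTop (𝓝 0))
    (h2 : ∀ j, Tendsto (fun n => ‖X j (s n) - X j t‖) atTop (𝓝 0)) :
    Tendsto s atTop (𝓝 t) := by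
  rw [tendsto_iff_norm_sub_tendsto_zero]
  have h : Tendsto (fun n => ‖s n - t‖ ^ 2) atTop (𝓝 0) := by
    simp_rw [Sig.norm_sq, map_sub]
    have := (h0.pow 2).add ((tendsto_finsetSum Finset.univ fun j _ => (h1 j).pow 2).add
      (tendsto_finsetSum Finset.univ fun j _ => (h2 j).pow 2))
    simpa using this
  have h' := h.sqrt
  simpa [Real.sqrt_sq (norm_nonneg _)] using h'

/-- `s` is represented by the smooth compactly supported function `ψ`. -/
def IsTest (ψ : E N → ℂ) (s : Sig N) : Prop :=
  ContDiff ℝ ((⊤ : ℕ∞) : WithTop ℕ∞) ψ ∧ HasCompactSupport ψ ∧ ψ =ᵐ[volume] ι s ∧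
    ∀ j, (fun x => fderiv ℝ ψ x (basisVec j)) =ᵐ[volume] D j s

lemma hasWeakPartial_of_contDiff {ψ : E N → ℂ} (hψ : ContDiff ℝ ((⊤ : ℕ∞) : WithTop ℕ∞) ψ)
    (j : Fin N) :
    HasWeakPartial ψ (fun x => fderiv ℝ ψ x (basisVec j)) j := by
  intro η hη hc
  have hηC := contDiff_ofReal_comp hη
  have hcC := hasCompactSupport_ofReal hc
  have hd : ∀ x, fderiv ℝ (fun x => (η x : ℂ)) x (basisVec j)
      = ((fderiv ℝ η x (basisVec j) : ℝ) : ℂ) := fun x => by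
    have := (Complex.ofRealCLM.hasFDerivAt.comp x
      ((hη.differentiable (by simp)) x).hasFDerivAt).fderiv
    exact congrArg (fun L : E N →L[ℝ] ℂ => L (basisVec j)) this
  have key := integral_mul_fderiv_eq_neg_fderiv_mul_of_integrable (𝕜 := ℂ)
    (μ := (volume : Measure (E N))) (f := fun x => (η x : ℂ)) (g := ψ) (v := basisVec j)
    (((continuous_partial hηC _).mul hψ.continuous).integrable_of_hasCompactSupport
      (hasCompactSupport_partial hcC _).mul_right)
    ((hηC.continuous.mul (continuous_partial hψ _)).integrable_of_hasCompactSupport hcC.mul_right)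
    ((hηC.continuous.mul hψ.continuous).integrable_of_hasCompactSupport hcC.mul_right)
    (fun x _ => (hηC.differentiable (by simp)) x) (fun x _ => (hψ.differentiable (by simp)) x)
  rw [key, neg_neg]
  simp_rw [hd]

lemma exists_isTest {ψ : E N → ℂ} (hψ : ContDiff ℝ ((⊤ : ℕ∞) : WithTop ℕ∞) ψ)
    (hc : HasCompactSupport ψ) : ∃ s : Sig N, IsTest ψ s := by
  have h0 : MemLp ψ 2 volume := hψ.continuous.memLp_of_hasCompactSupport hc
  have h1 : ∀ j, MemLp (fun x => fderiv ℝ ψ x (basisVec j)) 2 volume := fun j =>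
    (continuous_partial hψ _).memLp_of_hasCompactSupport (hasCompactSupport_partial hc _)
  have h2 : ∀ j, MemLp (fun x : E N => ((x j : ℝ) : ℂ) * ψ x) 2 volume := fun j =>
    (Continuous.mul (by fun_prop) hψ.continuous).memLp_of_hasCompactSupport hc.mul_left
  obtain ⟨s, e0, e1, -⟩ := Sig.exists_of_components (h0.toLp ψ) (fun j => (h1 j).toLp _)
    (fun j => (h2 j).toLp _)
    (fun j => (hasWeakPartial_of_contDiff hψ j).congr h0.coeFn_toLp.symm (h1 j).coeFn_toLp.symm)
    (fun j => (h2 j).coeFn_toLp.trans (by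
      filter_upwards [h0.coeFn_toLp] with x hx
      rw [hx]))
  refine ⟨s, hψ, hc, ?_, fun j => ?_⟩
  · rw [e0]; exact h0.coeFn_toLp.symm
  · rw [e1]; exact (h1 j).coeFn_toLp.symm

lemma HasWeakPartial.mul_smooth {u v : E N → ℂ} {j : Fin N} (h : HasWeakPartial u v j)
    (hu : MemLp u 2 volume) (hv : MemLp v 2 volume) {χ : E N → ℝ}
    (hχ : ContDiff ℝ ((⊤ : ℕ∞) : WithTop ℕ∞) χ) :
    HasWeakPartial (fun x => (χ x : ℂ) * u x)
      (fun x => (χ x : ℂ) * v x + ((fderiv ℝ χ x (basisVec j) : ℝ) : ℂ) * u x) j := by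
  intro ψ hψ hc
  have hprod : ContDiff ℝ ((⊤ : ℕ∞) : WithTop ℕ∞) (fun x => ψ x * χ x) := hψ.mul hχ
  have hcp : HasCompactSupport (fun x => ψ x * χ x) := hc.mul_right
  have key := h _ hprod hcp
  have hd : ∀ x, fderiv ℝ (fun x => ψ x * χ x) x (basisVec j)
      = fderiv ℝ ψ x (basisVec j) * χ x + ψ x * fderiv ℝ χ x (basisVec j) := fun x => by
    rw [fderiv_fun_mul ((hψ.differentiable (by simp)) x) ((hχ.differentiable (by simp)) x)]
    simp
    ring
  have i1 : Integrable fun x => ((fderiv ℝ ψ x (basisVec j) * χ x : ℝ) : ℂ) * u x :=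
    integrable_realTest_mul (ψ := fun x => fderiv ℝ ψ x (basisVec j) * χ x)
      ((continuous_partial hψ _).mul hχ.continuous) (hasCompactSupport_partial hc _).mul_right hu
  have i2 : Integrable fun x => ((ψ x * fderiv ℝ χ x (basisVec j) : ℝ) : ℂ) * u x :=
    integrable_realTest_mul (ψ := fun x => ψ x * fderiv ℝ χ x (basisVec j))
      (hψ.continuous.mul (continuous_partial hχ _)) hc.mul_right hu
  have i3 : Integrable fun x => ((ψ x * χ x : ℝ) : ℂ) * v x :=
    integrable_realTest_mul (ψ := fun x => ψ x * χ x) hprod.continuous hcp hv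
  have e1 : (∫ x, ((fderiv ℝ (fun x => ψ x * χ x) x (EuclideanSpace.single j 1) : ℝ) : ℂ) * u x)
      = (∫ x, ((fderiv ℝ ψ x (basisVec j) * χ x : ℝ) : ℂ) * u x)
        + ∫ x, ((ψ x * fderiv ℝ χ x (basisVec j) : ℝ) : ℂ) * u x := by
    rw [← integral_add i1 i2]
    refine integral_congr_ae (ae_of_all _ fun x => ?_)
    simp only [hd]; push_cast; ring
  have e2 : (∫ x, ((fderiv ℝ ψ x (EuclideanSpace.single j 1) : ℝ) : ℂ) * ((χ x : ℂ) * u x))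
      = ∫ x, ((fderiv ℝ ψ x (basisVec j) * χ x : ℝ) : ℂ) * u x := by
    refine integral_congr_ae (ae_of_all _ fun x => ?_)
    simp only; push_cast; ring
  have e3 : (∫ x, ((ψ x : ℝ) : ℂ) * ((χ x : ℂ) * v x
        + ((fderiv ℝ χ x (basisVec j) : ℝ) : ℂ) * u x))
      = (∫ x, ((ψ x * χ x : ℝ) : ℂ) * v x)
        + ∫ x, ((ψ x * fderiv ℝ χ x (basisVec j) : ℝ) : ℂ) * u x := by
    rw [← integral_add i3 i2]
    refine integral_congr_ae (ae_of_all _ fun x => ?_)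
    simp only; push_cast; ring
  rw [e1] at key
  rw [e2, e3, neg_add, ← key]
  ring

lemma memLp_mul_bounded {w : E N → ℝ} (hw : Continuous w) {C : ℝ} (hC : ∀ x, |w x| ≤ C)
    (f : L2 N) : MemLp (fun x => (w x : ℂ) * f x) 2 volume :=
  (Lp.memLp f).of_le_mul (c := C)
    ((Complex.continuous_ofReal.comp hw).aestronglyMeasurable.mul (Lp.memLp f).1)
    (ae_of_all _ fun x => by
      rw [norm_mul, Complex.norm_real]
      exact mul_le_mul_of_nonneg_right (hC x) (norm_nonneg _))

lemma L2.norm_le_mul_of_ae {f g : L2 N} {C : ℝ} (hC : 0 ≤ C) (h : ∀ᵐ x, ‖f x‖ ≤ C * ‖g x‖) :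
    ‖f‖ ≤ C * ‖g‖ := by
  have h1 : ‖f‖ ^ 2 ≤ (C * ‖g‖) ^ 2 := by
    rw [mul_pow, ← L2.integral_norm_sq, ← L2.integral_norm_sq, ← integral_const_mul]
    refine integral_mono_ae (L2.integrable_norm_sq f) ((L2.integrable_norm_sq g).const_mul _) ?_
    filter_upwards [h] with x hx
    calc ‖f x‖ ^ 2 ≤ (C * ‖g x‖) ^ 2 := by gcongr
      _ = _ := by ring
  exact le_of_sq_le_sq h1 (by positivity)

/-- Multiplying by bounded continuous functions that tend pointwise to `1` converges in `L²`. -/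
lemma L2.tendsto_mul_of_pointwise {w : ℕ → E N → ℝ} (hw : ∀ n, Continuous (w n))
    (h0 : ∀ n x, 0 ≤ w n x) (h1 : ∀ n x, w n x ≤ 1)
    (hlim : ∀ x, Tendsto (fun n => w n x) atTop (𝓝 1)) (f : L2 N) {F : ℕ → L2 N}
    (hF : ∀ n, (F n : E N → ℂ) =ᵐ[volume] fun x => (w n x : ℂ) * f x) :
    Tendsto (fun n => ‖F n - f‖) atTop (𝓝 0) := by
  have hFf : ∀ n, ∀ᵐ x, ‖(F n - f) x‖ ^ 2 = (1 - w n x) ^ 2 * ‖f x‖ ^ 2 := by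
    intro n
    filter_upwards [hF n, Lp.coeFn_sub (F n) f] with x hx hx'
    have : (w n x : ℂ) * f x - f x = ((w n x - 1 : ℝ) : ℂ) * f x := by push_cast; ring
    rw [hx', Pi.sub_apply, hx, this, norm_mul, Complex.norm_real, mul_pow, Real.norm_eq_abs, sq_abs]
    ring
  have h : Tendsto (fun n => ‖F n - f‖ ^ 2) atTop (𝓝 0) := by
    simp_rw [← L2.integral_norm_sq, fun n => integral_congr_ae (hFf n)]
    have h00 : (0 : ℝ) = ∫ x : E N, (0 : ℝ) := by simp
    rw [h00]
    refine tendsto_integral_of_dominated_convergence (fun x => ‖f x‖ ^ 2) (fun n => ?_)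
      (L2.integrable_norm_sq f) (fun n => ae_of_all _ fun x => ?_) (ae_of_all _ fun x => ?_)
    · exact ((continuous_const.sub (hw n)).pow 2).aestronglyMeasurable.mul
        (L2.integrable_norm_sq f).aestronglyMeasurable
    · rw [Real.norm_of_nonneg (by positivity)]
      have : (1 - w n x) ^ 2 ≤ 1 := by
        have := h0 n x
        have := h1 n x
        nlinarith
      exact mul_le_of_le_one_left (by positivity) this
    · have := (((hlim x).const_sub 1).pow 2).mul_const (‖f x‖ ^ 2)
      simpa using this
  have h' := h.sqrt
  simpa [Real.sqrt_sq (norm_nonneg _)] using h'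

/-- `s` vanishes outside a ball of radius `R`. -/
def SuppIn (R : ℝ) (s : Sig N) : Prop :=
  ∀ᵐ x, R ≤ ‖x‖ → ι s x = 0

/-- Elements of bounded support are dense: multiply by smooth cutoffs `χ(x / (n + 1))`. -/
lemma exists_cutoff_seq (s : Sig N) :
    ∃ F : ℕ → Sig N, (∀ n, ∃ R, SuppIn R (F n)) ∧ Tendsto F atTop (𝓝 s) := by
  let χ : ContDiffBump (0 : E N) := ⟨1, 2, one_pos, one_lt_two⟩
  have hχs : ContDiff ℝ ((⊤ : ℕ∞) : WithTop ℕ∞) (χ : E N → ℝ) := χ.contDiff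
  obtain ⟨C, hC⟩ : ∃ C, ∀ x, ‖fderiv ℝ (χ : E N → ℝ) x‖ ≤ C :=
    (hχs.continuous_fderiv (by simp)).bounded_above_of_compact_support
      (χ.hasCompactSupport.fderiv (𝕜 := ℝ))
  have hC0 : 0 ≤ C := (norm_nonneg _).trans (hC 0)
  let a : ℕ → ℝ := fun n => 1 / ((n : ℝ) + 1)
  have ha0 : ∀ n, 0 < a n := fun n => by positivity
  have halim : Tendsto a atTop (𝓝 0) := tendsto_one_div_add_atTop_nhds_zero_nat
  let w : ℕ → E N → ℝ := fun n x => χ (a n • x)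
  have hws : ∀ n, ContDiff ℝ ((⊤ : ℕ∞) : WithTop ℕ∞) (w n) := fun n =>
    hχs.comp (contDiff_const_smul (a n))
  have hw0 : ∀ n x, 0 ≤ w n x := fun n x => χ.nonneg
  have hw1 : ∀ n x, w n x ≤ 1 := fun n x => χ.le_one
  have hwlim : ∀ x, Tendsto (fun n => w n x) atTop (𝓝 1) := fun x => by
    have h1 : Tendsto (fun n => a n • x) atTop (𝓝 ((0 : ℝ) • x)) := halim.smul_const x
    have h2 := (hχs.continuous.tendsto ((0 : ℝ) • x)).comp h1
    rw [zero_smul, χ.one_of_mem_closedBall (by simp [χ])] at h2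
    exact h2
  have hwd : ∀ n j x, |fderiv ℝ (w n) x (basisVec j)| ≤ a n * C := fun n j x => by
    have hd : HasFDerivAt (w n) ((fderiv ℝ (χ : E N → ℝ) (a n • x)).comp
        (a n • ContinuousLinearMap.id ℝ (E N))) x :=
      ((hχs.differentiable (by simp)) (a n • x)).hasFDerivAt.comp x
        ((hasFDerivAt_id x).const_smul (a n))
    rw [hd.fderiv]
    have : ((fderiv ℝ (χ : E N → ℝ) (a n • x)).comp
        (a n • ContinuousLinearMap.id ℝ (E N))) (basisVec j)
        = a n * fderiv ℝ (χ : E N → ℝ) (a n • x) (basisVec j) := by simp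
    rw [this, abs_mul, abs_of_pos (ha0 n)]
    gcongr
    refine ((fderiv ℝ (χ : E N → ℝ) (a n • x)).le_opNorm _).trans ?_
    simpa using hC (a n • x)
  have hwb : ∀ n x, |w n x| ≤ 1 := fun n x => by rw [abs_of_nonneg (hw0 n x)]; exact hw1 n x
  have m0 : ∀ n (f : L2 N), MemLp (fun x => (w n x : ℂ) * f x) 2 volume := fun n f =>
    memLp_mul_bounded (hws n).continuous (hwb n) f
  have m1 : ∀ n j (f : L2 N),
      MemLp (fun x => ((fderiv ℝ (w n) x (basisVec j) : ℝ) : ℂ) * f x) 2 volume := fun n j f =>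
    memLp_mul_bounded (continuous_partial (hws n) _) (hwd n j) f
  have hex : ∀ n, ∃ t : Sig N, ι t = (m0 n (ι s)).toLp _ ∧
      (∀ j, D j t = (m0 n (D j s)).toLp _ + (m1 n j (ι s)).toLp _) ∧
      ∀ j, X j t = (m0 n (X j s)).toLp _ := by
    intro n
    refine Sig.exists_of_components _ _ _ (fun j => ?_) fun j => ?_
    · refine ((hasWeakPartial_D s j).mul_smooth (Lp.memLp _) (Lp.memLp _) (hws n)).congr
        (m0 n (ι s)).coeFn_toLp.symm ?_
      filter_upwards [(m0 n (D j s)).coeFn_toLp, (m1 n j (ι s)).coeFn_toLp,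
        Lp.coeFn_add ((m0 n (D j s)).toLp _) ((m1 n j (ι s)).toLp _)] with x h1 h2 h3
      rw [h3, Pi.add_apply, h1, h2]
    · filter_upwards [(m0 n (X j s)).coeFn_toLp, (m0 n (ι s)).coeFn_toLp, X_ae s j] with x h1 h2 h3
      rw [h1, h2, h3]
      ring
  choose F hF0 hF1 hF2 using hex
  refine ⟨F, fun n => ⟨2 * ((n : ℝ) + 1), ?_⟩, Sig.tendsto_of_components ?_ (fun j => ?_) fun j => ?_⟩
  · unfold SuppIn
    rw [hF0]
    filter_upwards [(m0 n (ι s)).coeFn_toLp] with x hx hR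
    rw [hx]
    have : w n x = 0 := by
      refine χ.zero_of_le_dist ?_
      rw [dist_zero_right, norm_smul, Real.norm_of_nonneg (ha0 n).le]
      change 2 ≤ 1 / ((n : ℝ) + 1) * ‖x‖
      have hn : (0 : ℝ) < (n : ℝ) + 1 := by positivity
      rw [div_mul_eq_mul_div, one_mul, le_div_iff₀ hn]
      exact hR
    simp [this]
  · exact L2.tendsto_mul_of_pointwise (fun n => (hws n).continuous) hw0 hw1 hwlim (ι s)
      fun n => by rw [hF0]; exact (m0 n (ι s)).coeFn_toLp
  · have t1 : Tendsto (fun n => ‖(m0 n (D j s)).toLp _ - D j s‖) atTop (𝓝 0) :=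
      L2.tendsto_mul_of_pointwise (fun n => (hws n).continuous) hw0 hw1 hwlim (D j s)
        fun n => (m0 n (D j s)).coeFn_toLp
    have t2 : Tendsto (fun n => a n * C * ‖ι s‖) atTop (𝓝 0) := by
      simpa using (halim.mul_const C).mul_const ‖ι s‖
    refine squeeze_zero (fun n => norm_nonneg _) (fun n => ?_) (by simpa using t1.add t2)
    rw [hF1, add_sub_right_comm]
    refine (norm_add_le _ _).trans ?_
    gcongr
    refine L2.norm_le_mul_of_ae (by positivity [ha0 n]) ?_
    filter_upwards [(m1 n j (ι s)).coeFn_toLp] with x hx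
    rw [hx, norm_mul, Complex.norm_real]
    exact mul_le_mul_of_nonneg_right (hwd n j x) (norm_nonneg _)
  · exact L2.tendsto_mul_of_pointwise (fun n => (hws n).continuous) hw0 hw1 hwlim (X j s)
      fun n => by rw [hF2]; exact (m0 n (X j s)).coeFn_toLp

end Density

/-! ### Mollification inside the energy space -/

section MollifiedDensity

variable {N : ℕ}

open scoped ENNReal

/-- The mollification `φ ⋆ f` of a function `f` by a normalised smooth bump function `φ`. -/
noncomputable def mollify (φ : ContDiffBump (0 : E N)) (f : E N → ℂ) : E N → ℂ :=
  convolution (φ.normed volume) f (ContinuousLinearMap.lsmul ℝ ℝ) volume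

lemma mollify_apply (φ : ContDiffBump (0 : E N)) (f : E N → ℂ) (x : E N) :
    mollify φ f x = ∫ t, ((φ.normed volume (x - t) : ℝ) : ℂ) * f t := by
  rw [mollify, convolution_eq_swap]
  rfl

lemma contDiff_mollify (φ : ContDiffBump (0 : E N)) (f : L2 N) :
    ContDiff ℝ ((⊤ : ℕ∞) : WithTop ℕ∞) (mollify φ f) :=
  φ.hasCompactSupport_normed.contDiff_convolution_left _ φ.contDiff_normed
    ((Lp.memLp f).locallyIntegrable (by norm_num))

/-- Weak derivatives commute with mollification. -/
lemma fderiv_mollify (φ : ContDiffBump (0 : E N)) {f g : L2 N} {j : Fin N}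
    (h : HasWeakPartial f g j) (x : E N) :
    fderiv ℝ (mollify φ f) x (basisVec j) = mollify φ g x := by
  have hφ : ContDiff ℝ ((⊤ : ℕ∞) : WithTop ℕ∞) (φ.normed (volume : Measure (E N))) :=
    φ.contDiff_normed
  have hloc := (Lp.memLp f).locallyIntegrable (by norm_num : (1 : ℝ≥0∞) ≤ 2)
  have hd := φ.hasCompactSupport_normed.hasFDerivAt_convolution_left
    (ContinuousLinearMap.lsmul ℝ ℝ) (hφ.of_le (by simp)) hloc x
  have hex : ConvolutionExistsAt (fderiv ℝ (φ.normed volume)) f x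
      ((ContinuousLinearMap.lsmul ℝ ℝ : ℝ →L[ℝ] ℂ →L[ℝ] ℂ).precompL (E N)) volume :=
    ((φ.hasCompactSupport_normed (μ := (volume : Measure (E N)))).fderiv
      (𝕜 := ℝ)).convolutionExists_left _ (hφ.continuous_fderiv (by simp)) hloc x
  rw [mollify, hd.fderiv, convolution_eq_swap, ContinuousLinearMap.integral_apply]
  · have hψ : ContDiff ℝ ((⊤ : ℕ∞) : WithTop ℕ∞)
        (fun t => φ.normed (volume : Measure (E N)) (x - t)) :=
      hφ.comp (contDiff_const.sub contDiff_id)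
    have hcs : HasCompactSupport (fun t => φ.normed (volume : Measure (E N)) (x - t)) :=
      φ.hasCompactSupport_normed.comp_homeomorph (Homeomorph.subLeft x)
    have hder : ∀ t, fderiv ℝ (fun t => φ.normed (volume : Measure (E N)) (x - t)) t
        (EuclideanSpace.single j 1) = - fderiv ℝ (φ.normed volume) (x - t) (basisVec j) := by
      intro t
      have h1 : HasFDerivAt (fun t => φ.normed (volume : Measure (E N)) (x - t))
          ((fderiv ℝ (φ.normed volume) (x - t)).comp (-ContinuousLinearMap.id ℝ (E N))) t :=
        ((hφ.differentiable (by simp)) (x - t)).hasFDerivAt.comp t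
          ((hasFDerivAt_id t).const_sub x)
      rw [h1.fderiv]
      simp
    have key := h _ hψ hcs
    have e : ∫ t, ((fderiv ℝ (fun t => φ.normed (volume : Measure (E N)) (x - t)) t
        (EuclideanSpace.single j 1) : ℝ) : ℂ) * f t
        = - ∫ t, ((fderiv ℝ (φ.normed volume) (x - t) (basisVec j) : ℝ) : ℂ) * f t := by
      rw [← integral_neg]
      refine integral_congr_ae (ae_of_all _ fun t => ?_)
      simp only [hder]
      push_cast
      ring
    rw [e, neg_inj] at key
    rw [mollify_apply, ← key]
    rfl
  · exact hex.integrable_swap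

lemma memLp_mollify (φ : ContDiffBump (0 : E N)) (f : L2 N) :
    MemLp (mollify φ f) 2 volume := by
  have h : eLpNorm (fun x => mollify φ f x - f x) 2 volume ≤ 2 * eLpNorm f 2 volume := by
    refine eLpNorm_mollify_sub_le φ f fun h _ => ?_
    refine (eLpNorm_sub_le ((Lp.memLp f).1.comp_measurePreserving
      (measurePreserving_sub_right volume h)) (Lp.memLp f).1 (by norm_num)).trans ?_
    have := eLpNorm_comp_measurePreserving (p := 2) (Lp.memLp f).1
      (measurePreserving_sub_right volume h)
    change eLpNorm (f ∘ fun x => x - h) 2 volume + _ ≤ _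
    rw [this, two_mul]
  have h2 : MemLp (fun x => mollify φ f x - f x) 2 volume :=
    ⟨((contDiff_mollify φ f).continuous.aestronglyMeasurable).sub (Lp.memLp f).1,
      h.trans_lt (ENNReal.mul_lt_top (by simp) (Lp.memLp f).2)⟩
  have := h2.add (Lp.memLp f)
  refine this.ae_eq (ae_of_all _ fun x => ?_)
  simp

/-- The mollification of an element of `L²`, as an element of `L²`. -/
noncomputable def mollifyL2 (φ : ContDiffBump (0 : E N)) (f : L2 N) : L2 N :=
  (memLp_mollify φ f).toLp _

lemma mollifyL2_ae (φ : ContDiffBump (0 : E N)) (f : L2 N) :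
    mollifyL2 φ f =ᵐ[volume] mollify φ f := MemLp.coeFn_toLp _

lemma norm_mollifyL2_sub_le (φ : ContDiffBump (0 : E N)) (f : L2 N) {K : ℝ} (hK0 : 0 ≤ K)
    (hK : ∀ h ∈ Metric.ball (0 : E N) φ.rOut,
      eLpNorm (fun x => f (x - h) - f x) 2 volume ≤ ENNReal.ofReal K) :
    ‖mollifyL2 φ f - f‖ ≤ K := by
  rw [← ENNReal.ofReal_le_ofReal_iff hK0, ofReal_norm, ← edist_eq_enorm_sub, Lp.edist_def]
  refine le_of_eq_of_le (eLpNorm_congr_ae ?_) (eLpNorm_mollify_sub_le φ f hK)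
  filter_upwards [mollifyL2_ae φ f] with x hx
  rw [Pi.sub_apply, hx, mollify]

/-- A sequence of bump functions whose supports shrink to the origin. -/
noncomputable def bumpSeq (n : ℕ) : ContDiffBump (0 : E N) where
  rIn := 1 / ((n : ℝ) + 2)
  rOut := 1 / ((n : ℝ) + 1)
  rIn_pos := by positivity
  rIn_lt_rOut := by
    apply one_div_lt_one_div_of_lt <;> linarith [(Nat.cast_nonneg n : (0 : ℝ) ≤ n)]

lemma tendsto_mollifyL2 (f : L2 N) :
    Tendsto (fun n => ‖mollifyL2 (bumpSeq n) f - f‖) atTop (𝓝 0) := by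
  rw [Metric.tendsto_atTop]
  intro ε hε
  obtain ⟨δ, hδ, hb⟩ := Metric.eventually_nhds_iff_ball.1
    (eventually_eLpNorm_translate_sub_le f (ε := ENNReal.ofReal (ε / 2)) (by simpa using hε))
  obtain ⟨n₀, hn₀⟩ := exists_nat_one_div_lt hδ
  refine ⟨n₀, fun n hn => ?_⟩
  rw [Real.dist_0_eq_abs, abs_of_nonneg (norm_nonneg _)]
  refine (norm_mollifyL2_sub_le _ f (by positivity) fun h hh => hb h ?_).trans_lt (half_lt_self hε)
  refine Metric.ball_subset_ball (le_trans ?_ hn₀.le) hh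
  exact one_div_le_one_div_of_le (by positivity) (by simpa using hn)

lemma mollify_eq_zero {R : ℝ} (n : ℕ) {f : L2 N} (hf : ∀ᵐ x, R ≤ ‖x‖ → f x = 0)
    {x : E N} (hx : R + 1 ≤ ‖x‖) : mollify (bumpSeq n) f x = 0 := by
  rw [mollify_apply]
  refine integral_eq_zero_of_ae ?_
  filter_upwards [hf] with t ht
  by_cases h : R ≤ ‖t‖
  · simp [ht h]
  · have h0 : x - t ∉ Metric.ball (0 : E N) (bumpSeq (N := N) n).rOut := by
      rw [mem_ball_zero_iff, not_lt]
      have h1 : ‖x‖ - ‖t‖ ≤ ‖x - t‖ := norm_sub_norm_le x t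
      have h2 : (bumpSeq (N := N) n).rOut ≤ 1 := by
        change 1 / ((n : ℝ) + 1) ≤ 1
        rw [div_le_one (by positivity)]
        linarith [(Nat.cast_nonneg n : (0 : ℝ) ≤ n)]
      linarith
    rw [← ContDiffBump.support_normed_eq (μ := (volume : Measure (E N)))] at h0
    simp [Function.notMem_support.1 h0]

/-- Mollifying an element of bounded support yields test functions converging to it. -/
lemma SuppIn.mem_closure_test {s : Sig N} {R : ℝ} (hs : SuppIn R s) :
    s ∈ closure {t : Sig N | ∃ ψ, IsTest ψ t} := by
  have hcs : ∀ n, HasCompactSupport (mollify (bumpSeq n) (ι s)) := fun n =>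
    HasCompactSupport.intro (isCompact_closedBall (0 : E N) (R + 1)) fun x hx =>
      mollify_eq_zero n hs (by simpa using (not_le.1 (by simpa using hx)).le)
  choose F hF using fun n => exists_isTest (contDiff_mollify (bumpSeq n) (ι s)) (hcs n)
  have e0 : ∀ n, ι (F n) = mollifyL2 (bumpSeq n) (ι s) := fun n =>
    Lp.ext ((hF n).2.2.1.symm.trans (mollifyL2_ae _ _).symm)
  have e1 : ∀ n j, D j (F n) = mollifyL2 (bumpSeq n) (D j s) := fun n j => by
    refine Lp.ext (((hF n).2.2.2 j).symm.trans (EventuallyEq.trans ?_ (mollifyL2_ae _ _).symm))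
    exact ae_of_all _ fun x => fderiv_mollify _ (hasWeakPartial_D s j) x
  have hlim : Tendsto F atTop (𝓝 s) := by
    refine Sig.tendsto_of_components ?_ (fun j => ?_) fun j => ?_
    · simp_rw [e0]
      exact tendsto_mollifyL2 _
    · simp_rw [e1]
      exact tendsto_mollifyL2 _
    · have t := (tendsto_mollifyL2 (ι s)).const_mul (|R| + 1)
      rw [mul_zero] at t
      refine squeeze_zero (fun n => norm_nonneg _) (fun n => ?_) t
      refine L2.norm_le_mul_of_ae (by positivity) ?_
      rw [← map_sub]
      filter_upwards [X_ae (F n - s) j, hs, mollifyL2_ae (bumpSeq n) (ι s),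
        Lp.coeFn_sub (mollifyL2 (bumpSeq n) (ι s)) (ι s)] with x h1 h2 h3 h4
      rw [h1, map_sub, e0, norm_mul, Complex.norm_real]
      by_cases hx : |R| + 1 ≤ ‖x‖
      · have hx1 : R + 1 ≤ ‖x‖ := by linarith [le_abs_self R]
        rw [h4, Pi.sub_apply, h3, h2 (by linarith), mollify_eq_zero n hs hx1]
        simp
      · have : ‖x j‖ ≤ ‖x‖ := PiLp.norm_apply_le x j
        gcongr
        linarith
  exact mem_closure_of_tendsto hlim (Eventually.of_forall fun n => ⟨_, hF n⟩)

/-- Test functions are dense in the energy space. -/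
theorem dense_test : Dense {t : Sig N | ∃ ψ, IsTest ψ t} := by
  intro s
  obtain ⟨F, hF, hlim⟩ := exists_cutoff_seq s
  exact isClosed_closure.mem_of_tendsto hlim
    (Eventually.of_forall fun n => (hF n).choose_spec.mem_closure_test)

/-- A closed property of elements of the energy space holds everywhere once it holds for test
functions. -/
lemma Sig.induction_test {p : Sig N → Prop} (hp : IsClosed {s | p s})
    (h : ∀ ψ s, IsTest ψ s → p s) (s : Sig N) : p s :=
  (closure_minimal (fun _ ht => h _ _ ht.choose_spec) hp) (dense_test s)

end MollifiedDensity

/-! ### Integration by parts against linear weights -/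

section IntegrationByParts

variable {N : ℕ}

/-- Integration by parts against the weight `x_k`. -/
lemma inner_X_D (v s : Sig N) (j k : Fin N) :
    inner ℂ (X k v) (D j s)
      = - inner ℂ (D j v) (X k s) - if j = k then inner ℂ (ι v) (ι s) else 0 := by
  refine Sig.induction_test (p := fun v => inner ℂ (X k v) (D j s)
      = - inner ℂ (D j v) (X k s) - if j = k then inner ℂ (ι v) (ι s) else 0) ?_ ?_ v
  · refine isClosed_eq (by fun_prop) ?_
    split_ifs <;> fun_prop
  intro ψ v ⟨hψ, hc, h0, h1⟩
  have hη : ContDiff ℝ ((⊤ : ℕ∞) : WithTop ℕ∞)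
      (fun x : E N => ((x k : ℝ) : ℂ) * (starRingEnd ℂ) (ψ x)) := by
    refine ContDiff.mul ?_ (Complex.conjCLE.contDiff.comp hψ)
    exact Complex.ofRealCLM.contDiff.comp (EuclideanSpace.proj (𝕜 := ℝ) k).contDiff
  have hηc : HasCompactSupport (fun x : E N => ((x k : ℝ) : ℂ) * (starRingEnd ℂ) (ψ x)) :=
    (hc.comp_left (g := starRingEnd ℂ) (by simp)).mul_left
  have hd : ∀ x : E N, fderiv ℝ (fun x : E N => ((x k : ℝ) : ℂ) * (starRingEnd ℂ) (ψ x)) x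
      (basisVec j) = (if j = k then (starRingEnd ℂ) (ψ x) else 0)
        + ((x k : ℝ) : ℂ) * (starRingEnd ℂ) (fderiv ℝ ψ x (basisVec j)) := by
    intro x
    have e1 : HasFDerivAt (fun x : E N => ((x k : ℝ) : ℂ))
        (Complex.ofRealCLM.comp (EuclideanSpace.proj (𝕜 := ℝ) k : E N →L[ℝ] ℝ)) x :=
      (Complex.ofRealCLM.comp (EuclideanSpace.proj (𝕜 := ℝ) k : E N →L[ℝ] ℝ)).hasFDerivAt
    have e2 : HasFDerivAt (fun x : E N => (starRingEnd ℂ) (ψ x))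
        ((Complex.conjCLE : ℂ →L[ℝ] ℂ).comp (fderiv ℝ ψ x)) x :=
      (Complex.conjCLE : ℂ →L[ℝ] ℂ).hasFDerivAt.comp x ((hψ.differentiable (by simp)) x).hasFDerivAt
    rw [(e1.fun_mul e2).fderiv]
    by_cases hjk : j = k
    · subst hjk; simp; ring
    · simp [hjk, Ne.symm hjk]
  have key := (hasWeakPartial_D s j).integral_complex (Lp.memLp _) (Lp.memLp _) hη hηc
  have l : ∫ x : E N, ((x k : ℝ) : ℂ) * (starRingEnd ℂ) (ψ x) * D j s x
      = inner ℂ (X k v) (D j s) := by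
    rw [← L2.integral_mul_conj]
    refine integral_congr_ae ?_
    filter_upwards [h0, X_ae v k] with x h2 h3
    rw [h3, ← h2, map_mul, Complex.conj_ofReal]
    ring
  have r : ∫ x : E N, fderiv ℝ (fun x : E N => ((x k : ℝ) : ℂ) * (starRingEnd ℂ) (ψ x)) x
      (basisVec j) * ι s x
      = inner ℂ (D j v) (X k s) + if j = k then inner ℂ (ι v) (ι s) else 0 := by
    have : (inner ℂ (D j v) (X k s) + if j = k then inner ℂ (ι v) (ι s) else 0)
        = ∫ x, (X k s x * (starRingEnd ℂ) (D j v x)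
          + (if j = k then (1 : ℂ) else 0) * (ι s x * (starRingEnd ℂ) (ι v x))) := by
      rw [integral_add (L2.integrable_mul_conj _ _) ((L2.integrable_mul_conj _ _).const_mul _),
        integral_const_mul, L2.integral_mul_conj, L2.integral_mul_conj]
      split_ifs <;> simp
    rw [this]
    refine integral_congr_ae ?_
    filter_upwards [h0, h1 j, X_ae s k] with x h2 h3 h4
    rw [hd, h4, ← h2, ← h3]
    split_ifs <;> ring
  rw [l, r] at key
  linear_combination key

/-- The inequality `‖u‖₂² ≤ ‖∂_j u‖₂² + ‖x_j u‖₂²` behind the uncertainty principle. -/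
lemma norm_ι_sq_le (s : Sig N) (j : Fin N) : ‖ι s‖ ^ 2 ≤ ‖D j s‖ ^ 2 + ‖X j s‖ ^ 2 := by
  have h := inner_X_D s s j j
  rw [if_pos rfl] at h
  have h1 : inner ℂ (ι s) (ι s) = - inner ℂ (D j s) (X j s) - inner ℂ (X j s) (D j s) := by
    linear_combination h
  have h2 : ‖ι s‖ ^ 2 ≤ 2 * (‖D j s‖ * ‖X j s‖) := by
    have e : ‖inner ℂ (ι s) (ι s)‖ = ‖ι s‖ ^ 2 := by
      rw [inner_self_eq_norm_sq_to_K]; simp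
    rw [← e, h1]
    refine (norm_sub_le _ _).trans ?_
    rw [norm_neg]
    have a := norm_inner_le_norm (𝕜 := ℂ) (D j s) (X j s)
    have b := norm_inner_le_norm (𝕜 := ℂ) (X j s) (D j s)
    linarith [mul_comm ‖D j s‖ ‖X j s‖]
  nlinarith [sq_nonneg (‖D j s‖ - ‖X j s‖)]

end IntegrationByParts

/-! ### The quadratic form -/

section QuadraticForm

variable {N : ℕ}

/-- The sesquilinear form of `-Δ + V + 2 L_Ω` on the energy space (linear in the second
argument). -/
noncomputable def form (γ : Fin N → ℝ) (Ω : EuclideanSpace ℝ (Fin 3)) (v s : Sig N) : ℂ :=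
  (∑ j, inner ℂ (D j v) (D j s)) + (∑ j, (γ j ^ 2 : ℝ) * inner ℂ (X j v) (X j s))
    + 2 * ∑ j, ∑ k, Complex.I * rotCoef Ω j k * inner ℂ (X k v) (D j s)

variable (γ : Fin N → ℝ) (Ω : EuclideanSpace ℝ (Fin 3))

lemma form_add_left (v w s : Sig N) : form γ Ω (v + w) s = form γ Ω v s + form γ Ω w s := by
  simp only [form, map_add, inner_add_left, mul_add, Finset.sum_add_distrib]
  ring

lemma form_add_right (v s t : Sig N) : form γ Ω v (s + t) = form γ Ω v s + form γ Ω v t := by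
  simp only [form, map_add, inner_add_right, mul_add, Finset.sum_add_distrib]
  ring

lemma form_smul_right (c : ℂ) (v s : Sig N) : form γ Ω v (c • s) = c * form γ Ω v s := by
  simp only [form, map_smul, inner_smul_right, mul_add, Finset.mul_sum]
  congr 1
  · congr 1
    exact Finset.sum_congr rfl fun j _ => by ring
  · exact Finset.sum_congr rfl fun j _ => Finset.sum_congr rfl fun k _ => by ring

/-- The form is Hermitian, because `L_Ω` is symmetric. -/
lemma form_conj (v s : Sig N) : (starRingEnd ℂ) (form γ Ω v s) = form γ Ω s v := by
  have h : ∀ j k, (starRingEnd ℂ) (Complex.I * rotCoef Ω j k * inner ℂ (X k v) (D j s))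
      = Complex.I * rotCoef Ω j k * inner ℂ (X k s) (D j v) := by
    intro j k
    rw [map_mul, map_mul, Complex.conj_I, Complex.conj_ofReal, inner_conj_symm]
    by_cases hjk : j = k
    · subst hjk; simp [rotCoef_self]
    · have := inner_X_D s v j k
      rw [if_neg hjk, sub_zero] at this
      rw [this]
      ring
  simp only [form, map_add, map_mul, map_sum, inner_conj_symm, Complex.conj_ofReal, map_ofNat]
  congr 2
  refine Finset.sum_congr rfl fun j _ => Finset.sum_congr rfl fun k _ => ?_
  rw [← h j k, map_mul, map_mul, inner_conj_symm, Complex.conj_ofReal]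

lemma form_smul_left (c : ℂ) (v s : Sig N) :
    form γ Ω (c • v) s = (starRingEnd ℂ) c * form γ Ω v s := by
  rw [← form_conj, form_smul_right, map_mul, form_conj]

/-- The quadratic form `t[u]` on the energy space. -/
noncomputable def quad (s : Sig N) : ℝ := (form γ Ω s s).re

lemma quad_add (v s : Sig N) :
    quad γ Ω (v + s) = quad γ Ω v + 2 * (form γ Ω s v).re + quad γ Ω s := by
  have h : (form γ Ω v s).re = (form γ Ω s v).re := by
    rw [← form_conj γ Ω s v, Complex.conj_re]
  simp only [quad, form_add_left, form_add_right, Complex.add_re, h]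
  ring

lemma quad_smul (c : ℝ) (s : Sig N) : quad γ Ω ((c : ℂ) • s) = c ^ 2 * quad γ Ω s := by
  rw [quad, form_smul_left, form_smul_right, Complex.conj_ofReal, ← mul_assoc, ← Complex.ofReal_mul,
    Complex.re_ofReal_mul, quad]
  ring

lemma quadForm_of_rep (hN : N = 2 ∨ N = 3) {u : E N → ℂ} {s : Sig N} (h : u =ᵐ[volume] ι s) :
    quadForm γ Ω u = quad γ Ω s := by
  have hV : ∫ x, V γ x * ‖u x‖ ^ 2 = ∑ j, γ j ^ 2 * ‖X j s‖ ^ 2 := by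
    have := integral_potential_of_rep γ h h
    have e : (∫ x, ((V γ x : ℝ) : ℂ) * u x * (starRingEnd ℂ) (u x))
        = ((∫ x, V γ x * ‖u x‖ ^ 2 : ℝ) : ℂ) := by
      rw [← integral_complex_ofReal]
      refine integral_congr_ae (ae_of_all _ fun x => ?_)
      simp only [mul_assoc, Complex.mul_conj, Complex.normSq_eq_norm_sq]
      push_cast; rfl
    rw [e] at this
    apply Complex.ofReal_injective
    rw [this]
    push_cast
    refine Finset.sum_congr rfl fun j _ => ?_
    rw [inner_self_eq_norm_sq_to_K]
    simp
  rw [quadForm, gradSq_of_rep h, hV, lOmega, integral_LOmega_of_rep hN Ω h h, quad, form]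
  simp only [Complex.add_re]
  congr 1
  · congr 1
    · rw [Complex.re_sum]
      refine Finset.sum_congr rfl fun j _ => ?_
      rw [inner_self_eq_norm_sq_to_K, ← RCLike.ofReal_pow]
      rfl
    · rw [Complex.re_sum]
      refine Finset.sum_congr rfl fun j _ => ?_
      rw [Complex.re_ofReal_mul, inner_self_eq_norm_sq_to_K, ← RCLike.ofReal_pow]
      rfl
  · rw [show (2 : ℂ) = ((2 : ℝ) : ℂ) by norm_num, Complex.re_ofReal_mul]

/-- The inequality `|Ω ∧ x| ≤ |Ω| |x|`. -/
lemma sum_rotCoef_mul_sq_le (hN : N = 2 ∨ N = 3) (x : Fin N → ℝ) :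
    ∑ j, (∑ k, rotCoef Ω j k * x k) ^ 2 ≤ ‖Ω‖ ^ 2 * ∑ k, x k ^ 2 := by
  rw [EuclideanSpace.norm_sq_eq]
  simp only [Real.norm_eq_abs, sq_abs]
  rcases hN with rfl | rfl
  · simp [Fin.sum_univ_succ, rotCoef]
    nlinarith [mul_nonneg (sq_nonneg (Ω 0)) (sq_nonneg (x 0)),
      mul_nonneg (sq_nonneg (Ω 0)) (sq_nonneg (x 1)),
      mul_nonneg (sq_nonneg (Ω 1)) (sq_nonneg (x 0)),
      mul_nonneg (sq_nonneg (Ω 1)) (sq_nonneg (x 1))]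
  · simp [Fin.sum_univ_succ, rotCoef]
    nlinarith [sq_nonneg (Ω 0 * x 0 + Ω 1 * x 1 + Ω 2 * x 2)]

lemma norm_rotation_le (hN : N = 2 ∨ N = 3) (z w : Fin N → ℂ) {θ : ℝ} (hθ : 0 < θ) :
    2 * ‖∑ j, ∑ k, Complex.I * rotCoef Ω j k * (w j * (starRingEnd ℂ) (z k))‖
      ≤ ‖Ω‖ * (θ⁻¹ * ∑ j, ‖w j‖ ^ 2 + θ * ∑ k, ‖z k‖ ^ 2) := by
  set y : Fin N → ℂ := fun j => ∑ k, rotCoef Ω j k * (starRingEnd ℂ) (z k) with hy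
  have h1 : ∑ j, ∑ k, Complex.I * rotCoef Ω j k * (w j * (starRingEnd ℂ) (z k))
      = Complex.I * ∑ j, w j * y j := by
    simp only [hy, Finset.mul_sum]
    exact Finset.sum_congr rfl fun j _ => Finset.sum_congr rfl fun k _ => by ring
  have h2 : ∑ j, ‖y j‖ ^ 2 ≤ ‖Ω‖ ^ 2 * ∑ k, ‖z k‖ ^ 2 := by
    have a := sum_rotCoef_mul_sq_le Ω hN fun k => (z k).re
    have b := sum_rotCoef_mul_sq_le Ω hN fun k => (z k).im
    have e1 : ∀ j, ‖y j‖ ^ 2 = (∑ k, rotCoef Ω j k * (z k).re) ^ 2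
        + (∑ k, rotCoef Ω j k * (z k).im) ^ 2 := fun j => by
      rw [← Complex.normSq_eq_norm_sq, Complex.normSq_apply]
      have r : (y j).re = ∑ k, rotCoef Ω j k * (z k).re := by simp [hy]
      have i : (y j).im = - ∑ k, rotCoef Ω j k * (z k).im := by simp [hy]
      rw [r, i]; ring
    have e2 : ∀ k, ‖z k‖ ^ 2 = (z k).re ^ 2 + (z k).im ^ 2 := fun k => by
      rw [← Complex.normSq_eq_norm_sq, Complex.normSq_apply]; ring
    simp only [e1, e2, Finset.sum_add_distrib, mul_add]
    linarith
  have h3 : ‖∑ j, w j * y j‖ ≤ Real.sqrt (∑ j, ‖w j‖ ^ 2) * Real.sqrt (∑ j, ‖y j‖ ^ 2) := by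
    refine (norm_sum_le _ _).trans ?_
    simp_rw [norm_mul]
    exact Real.sum_mul_le_sqrt_mul_sqrt _ _ _
  have h4 : Real.sqrt (∑ j, ‖y j‖ ^ 2) ≤ ‖Ω‖ * Real.sqrt (∑ k, ‖z k‖ ^ 2) := by
    refine Real.sqrt_le_iff.2 ⟨by positivity, ?_⟩
    rw [mul_pow, Real.sq_sqrt (by positivity)]
    exact h2
  rw [h1, norm_mul, Complex.norm_I, one_mul]
  set A := Real.sqrt (∑ j, ‖w j‖ ^ 2)
  set B := Real.sqrt (∑ k, ‖z k‖ ^ 2)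
  have hA : ∑ j, ‖w j‖ ^ 2 = A ^ 2 := (Real.sq_sqrt (by positivity)).symm
  have hB : ∑ j, ‖z j‖ ^ 2 = B ^ 2 := (Real.sq_sqrt (by positivity)).symm
  rw [hA, hB]
  have h5 : 2 * (A * B) ≤ θ⁻¹ * A ^ 2 + θ * B ^ 2 := by
    have : 0 ≤ θ⁻¹ * (A - θ * B) ^ 2 := by positivity
    have e : θ⁻¹ * (A - θ * B) ^ 2 = θ⁻¹ * A ^ 2 + θ * B ^ 2 - 2 * (A * B) := by
      field_simp; ring
    linarith
  have hA0 : 0 ≤ A := Real.sqrt_nonneg _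
  calc 2 * ‖∑ j, w j * y j‖ ≤ 2 * (A * (‖Ω‖ * B)) := by gcongr; exact h3.trans (by gcongr)
    _ = ‖Ω‖ * (2 * (A * B)) := by ring
    _ ≤ _ := by gcongr

/-- Coercivity of the quadratic form when `|Ω|` is less than the smallest trap frequency. -/
lemma exists_coercive (hN : N = 2 ∨ N = 3) (hΩ : ‖Ω‖ < ⨅ j, γ j) :
    ∃ c > 0, ∀ s : Sig N, c * ‖s‖ ^ 2 ≤ quad γ Ω s := by
  set g := ⨅ j, γ j with hg
  have hgj : ∀ j, g ≤ γ j := fun j => ciInf_le (Finite.bddBelow_range γ) j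
  have hg0 : 0 < g := (norm_nonneg _).trans_lt hΩ
  have hrot : ∀ s : Sig N, 2 * ‖∑ j, ∑ k, Complex.I * rotCoef Ω j k * inner ℂ (X k s) (D j s)‖
      ≤ ‖Ω‖ * (g⁻¹ * ∑ j, ‖D j s‖ ^ 2 + g * ∑ k, ‖X k s‖ ^ 2) := by
    intro s
    have hI : ∀ j k, Integrable fun x =>
        Complex.I * rotCoef Ω j k * (D j s x * (starRingEnd ℂ) (X k s x)) :=
      fun j k => (L2.integrable_mul_conj (D j s) (X k s)).const_mul _
    have e : ∑ j, ∑ k, Complex.I * rotCoef Ω j k * inner ℂ (X k s) (D j s)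
        = ∫ x, ∑ j, ∑ k, Complex.I * rotCoef Ω j k * (D j s x * (starRingEnd ℂ) (X k s x)) := by
      rw [integral_finsetSum _ fun j _ => integrable_finsetSum _ fun k _ => hI j k]
      refine Finset.sum_congr rfl fun j _ => ?_
      rw [integral_finsetSum _ fun k _ => hI j k]
      refine Finset.sum_congr rfl fun k _ => ?_
      rw [integral_const_mul, L2.integral_mul_conj]
    have iD : Integrable fun x => ∑ j, ‖D j s x‖ ^ 2 :=
      integrable_finsetSum _ fun j _ => L2.integrable_norm_sq _
    have iX : Integrable fun x => ∑ j, ‖X j s x‖ ^ 2 :=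
      integrable_finsetSum _ fun j _ => L2.integrable_norm_sq _
    rw [e]
    calc _ ≤ 2 * ∫ x, ‖∑ j, ∑ k, Complex.I * rotCoef Ω j k
          * (D j s x * (starRingEnd ℂ) (X k s x))‖ := by
          gcongr; exact norm_integral_le_integral_norm _
      _ = ∫ x, 2 * ‖∑ j, ∑ k, Complex.I * rotCoef Ω j k
          * (D j s x * (starRingEnd ℂ) (X k s x))‖ := (integral_const_mul _ _).symm
      _ ≤ ∫ x, ‖Ω‖ * (g⁻¹ * ∑ j, ‖D j s x‖ ^ 2 + g * ∑ k, ‖X k s x‖ ^ 2) := by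
          refine integral_mono ?_ (((iD.const_mul _).add (iX.const_mul _)).const_mul _) fun x =>
            norm_rotation_le Ω hN (fun k => X k s x) (fun j => D j s x) hg0
          exact (integrable_finsetSum _ fun j _ => integrable_finsetSum _
            fun k _ => hI j k).norm.const_mul _
      _ = _ := by
          rw [integral_const_mul, integral_add (iD.const_mul _) (iX.const_mul _),
            integral_const_mul, integral_const_mul,
            integral_finsetSum _ fun j _ => L2.integrable_norm_sq _,
            integral_finsetSum _ fun j _ => L2.integrable_norm_sq _]
          simp_rw [L2.integral_norm_sq]
  have hquad : ∀ s : Sig N, (1 - ‖Ω‖ / g) * (∑ j, ‖D j s‖ ^ 2 + g ^ 2 * ∑ j, ‖X j s‖ ^ 2)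
      ≤ quad γ Ω s := by
    intro s
    have h1 : quad γ Ω s = ∑ j, ‖D j s‖ ^ 2 + ∑ j, γ j ^ 2 * ‖X j s‖ ^ 2
        + 2 * (∑ j, ∑ k, Complex.I * rotCoef Ω j k * inner ℂ (X k s) (D j s)).re := by
      rw [← quadForm_of_rep γ Ω hN (ae_eq_rfl (f := ι s)), quadForm,
        gradSq_of_rep (ae_eq_rfl (f := ι s)), lOmega,
        integral_LOmega_of_rep hN Ω (ae_eq_rfl (f := ι s)) (ae_eq_rfl (f := ι s))]
      congr 2
      have : ∀ᵐ x, V γ x * ‖ι s x‖ ^ 2 = ∑ j, γ j ^ 2 * ‖X j s x‖ ^ 2 := by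
        filter_upwards [ae_all_iff.2 (X_ae s)] with x hx
        rw [V, Finset.sum_mul]
        refine Finset.sum_congr rfl fun j _ => ?_
        rw [hx j, norm_mul, mul_pow, Complex.norm_real, Real.norm_eq_abs, sq_abs, mul_assoc]
      rw [integral_congr_ae this,
        integral_finsetSum _ fun j _ => (L2.integrable_norm_sq _).const_mul _]
      simp_rw [integral_const_mul, L2.integral_norm_sq]
    have h2 := hrot s
    have h3 := Complex.abs_re_le_norm (∑ j, ∑ k, Complex.I * rotCoef Ω j k
      * inner ℂ (X k s) (D j s))
    have h4 := (abs_le.1 h3).1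
    have h5 : g ^ 2 * ∑ j, ‖X j s‖ ^ 2 ≤ ∑ j, γ j ^ 2 * ‖X j s‖ ^ 2 := by
      rw [Finset.mul_sum]
      refine Finset.sum_le_sum fun j _ => ?_
      have := hgj j
      gcongr
    have h6 : (1 - ‖Ω‖ / g) * (∑ j, ‖D j s‖ ^ 2 + g ^ 2 * ∑ j, ‖X j s‖ ^ 2)
        = ∑ j, ‖D j s‖ ^ 2 + g ^ 2 * ∑ j, ‖X j s‖ ^ 2
          - ‖Ω‖ * (g⁻¹ * ∑ j, ‖D j s‖ ^ 2 + g * ∑ k, ‖X k s‖ ^ 2) := by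
      field_simp
    rw [h1, h6]
    linarith
  have hθ : 0 < 1 - ‖Ω‖ / g := by
    rw [sub_pos, div_lt_one hg0]; exact hΩ
  have hm : 0 < min 1 (g ^ 2) := by positivity
  refine ⟨(1 - ‖Ω‖ / g) * min 1 (g ^ 2) / 2, by positivity, fun s => ?_⟩
  refine le_trans ?_ (hquad s)
  rw [mul_div_assoc, mul_assoc]
  gcongr
  have j0 : Fin N := ⟨0, by omega⟩
  have h1 := norm_ι_sq_le s j0
  have h2 : ‖D j0 s‖ ^ 2 ≤ ∑ j, ‖D j s‖ ^ 2 :=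
    Finset.single_le_sum (f := fun j => ‖D j s‖ ^ 2) (fun _ _ => by positivity) (Finset.mem_univ _)
  have h3 : ‖X j0 s‖ ^ 2 ≤ ∑ j, ‖X j s‖ ^ 2 :=
    Finset.single_le_sum (f := fun j => ‖X j s‖ ^ 2) (fun _ _ => by positivity) (Finset.mem_univ _)
  have h4 : ‖s‖ ^ 2 ≤ 2 * (∑ j, ‖D j s‖ ^ 2 + ∑ j, ‖X j s‖ ^ 2) := by
    rw [Sig.norm_sq]; linarith
  have hD : 0 ≤ ∑ j, ‖D j s‖ ^ 2 := by positivity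
  have hX : 0 ≤ ∑ j, ‖X j s‖ ^ 2 := by positivity
  calc min 1 (g ^ 2) / 2 * ‖s‖ ^ 2
      ≤ min 1 (g ^ 2) / 2 * (2 * (∑ j, ‖D j s‖ ^ 2 + ∑ j, ‖X j s‖ ^ 2)) := by gcongr
    _ = min 1 (g ^ 2) * ∑ j, ‖D j s‖ ^ 2 + min 1 (g ^ 2) * ∑ j, ‖X j s‖ ^ 2 := by ring
    _ ≤ 1 * ∑ j, ‖D j s‖ ^ 2 + g ^ 2 * ∑ j, ‖X j s‖ ^ 2 := by
        gcongr
        · exact min_le_left _ _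
        · exact min_le_right _ _
    _ = _ := by ring

end QuadraticForm

/-! ### The translation estimate -/

section Translation

variable {N : ℕ}

open scoped ENNReal

/-- The norm of the gradient, `‖∇u‖₂`. -/
noncomputable def gradNorm (s : Sig N) : ℝ := Real.sqrt (∑ j, ‖D j s‖ ^ 2)

lemma gradNorm_nonneg (s : Sig N) : 0 ≤ gradNorm s := Real.sqrt_nonneg _

lemma gradNorm_sq (s : Sig N) : gradNorm s ^ 2 = ∑ j, ‖D j s‖ ^ 2 :=
  Real.sq_sqrt (by positivity)

lemma gradNorm_le (s : Sig N) : gradNorm s ≤ ‖s‖ := by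
  refine le_of_sq_le_sq ?_ (norm_nonneg _)
  rw [gradNorm_sq, Sig.norm_sq]
  have : 0 ≤ ∑ j, ‖X j s‖ ^ 2 := by positivity
  nlinarith [sq_nonneg ‖ι s‖]

lemma continuous_gradNorm : Continuous (gradNorm : Sig N → ℝ) := by
  unfold gradNorm
  fun_prop

/-- The operator norm is at most the Hilbert–Schmidt norm. -/
lemma opNorm_sq_le_sum {L : E N →L[ℝ] ℂ} : ‖L‖ ^ 2 ≤ ∑ j, ‖L (basisVec j)‖ ^ 2 := by
  have h : ‖L‖ ≤ Real.sqrt (∑ j, ‖L (basisVec j)‖ ^ 2) := by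
    refine L.opNorm_le_bound (Real.sqrt_nonneg _) fun x => ?_
    have hx : x = ∑ j, x j • basisVec j := by
      conv_lhs => rw [← (EuclideanSpace.basisFun (Fin N) ℝ).sum_repr x]
      simp
    conv_lhs => rw [hx, map_sum]
    refine (norm_sum_le _ _).trans ?_
    simp_rw [map_smul, norm_smul]
    refine (Real.sum_mul_le_sqrt_mul_sqrt _ _ _).trans ?_
    rw [mul_comm, EuclideanSpace.norm_eq]
  calc ‖L‖ ^ 2 ≤ Real.sqrt (∑ j, ‖L (basisVec j)‖ ^ 2) ^ 2 := by gcongr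
    _ = _ := Real.sq_sqrt (by positivity)

lemma lintegral_fderiv_sq_le {ψ : E N → ℂ} {s : Sig N} (h : IsTest ψ s) :
    ∫⁻ x, ‖fderiv ℝ ψ x‖ₑ ^ (2 : ℝ) ≤ ENNReal.ofReal (gradNorm s ^ 2) := by
  obtain ⟨-, -, -, h1⟩ := h
  have hI : Integrable fun x => ∑ j, ‖D j s x‖ ^ 2 :=
    integrable_finsetSum _ fun j _ => L2.integrable_norm_sq _
  have e : gradNorm s ^ 2 = ∫ x, ∑ j, ‖D j s x‖ ^ 2 := by
    rw [gradNorm_sq, integral_finsetSum _ fun j _ => L2.integrable_norm_sq _]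
    simp_rw [L2.integral_norm_sq]
  rw [e, ofReal_integral_eq_lintegral_ofReal hI (ae_of_all _ fun x => by positivity)]
  refine lintegral_mono_ae ?_
  filter_upwards [ae_all_iff.2 h1] with x hx
  have h2 := opNorm_sq_le_sum (L := fderiv ℝ ψ x)
  simp_rw [hx] at h2
  rw [← ofReal_norm, ENNReal.ofReal_rpow_of_nonneg (norm_nonneg _) (by norm_num)]
  exact ENNReal.ofReal_le_ofReal (by exact_mod_cast h2)

lemma IsTest.eLpNorm_translate_sub_le {ψ : E N → ℂ} {s : Sig N} (h : IsTest ψ s) (a : E N) :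
    eLpNorm (fun x => ψ (x - a) - ψ x) 2 volume ≤ ENNReal.ofReal (‖a‖ * gradNorm s) := by
  have hψ := h.1
  have hcont : Continuous (fderiv ℝ ψ) := hψ.continuous_fderiv (by simp)
  have hpt : ∀ x, ‖ψ (x - a) - ψ x‖ₑ ^ (2 : ℝ)
      ≤ ∫⁻ t in Set.Ioc (0 : ℝ) 1, ‖a‖ₑ ^ (2 : ℝ) * ‖fderiv ℝ ψ (x - t • a)‖ₑ ^ (2 : ℝ) := by
    intro x
    have hd : ∀ t : ℝ, HasDerivAt (fun t : ℝ => ψ (x - t • a)) (fderiv ℝ ψ (x - t • a) (-a)) t := by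
      intro t
      have h1 : HasDerivAt (fun t : ℝ => x - t • a) (-a) t := by
        simpa using ((hasDerivAt_id t).smul_const a).const_sub x
      exact ((hψ.differentiable (by simp)) (x - t • a)).hasFDerivAt.comp_hasDerivAt t h1
    have hci : Continuous fun t : ℝ => fderiv ℝ ψ (x - t • a) (-a) :=
      (hcont.comp (by fun_prop)).clm_apply continuous_const
    have hftc := intervalIntegral.integral_eq_sub_of_hasDerivAt (a := (0 : ℝ)) (b := 1)
      (fun t _ => hd t) (hci.intervalIntegrable _ _)
    rw [one_smul, zero_smul, sub_zero, intervalIntegral.integral_of_le zero_le_one] at hftc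
    have hmeas : Measurable fun t : ℝ => ‖fderiv ℝ ψ (x - t • a) (-a)‖ₑ := hci.measurable.enorm
    have h1 : ‖ψ (x - a) - ψ x‖ₑ
        ≤ ∫⁻ t in Set.Ioc (0 : ℝ) 1, ‖fderiv ℝ ψ (x - t • a) (-a)‖ₑ := by
      rw [← hftc]
      exact enorm_integral_le_lintegral_enorm _
    have h2 := ENNReal.lintegral_mul_norm_pow_le (μ := volume.restrict (Set.Ioc (0 : ℝ) 1))
      (f := fun _ => 1) (g := fun t => ‖fderiv ℝ ψ (x - t • a) (-a)‖ₑ ^ (2 : ℝ))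
      aemeasurable_const (hmeas.pow_const _).aemeasurable (p := 1 / 2) (q := 1 / 2)
      (by norm_num) (by norm_num) (by norm_num)
    have h3 : ∀ z : ℝ≥0∞, (1 : ℝ≥0∞) ^ (1 / 2 : ℝ) * (z ^ (2 : ℝ)) ^ (1 / 2 : ℝ) = z := by
      intro z
      rw [ENNReal.one_rpow, one_mul, ← ENNReal.rpow_mul]
      norm_num
    simp_rw [h3] at h2
    have h4 : (∫⁻ _ in Set.Ioc (0 : ℝ) 1, (1 : ℝ≥0∞)) = 1 := by simp
    rw [h4, ENNReal.one_rpow, one_mul] at h2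
    calc _ ≤ ((∫⁻ t in Set.Ioc (0 : ℝ) 1, ‖fderiv ℝ ψ (x - t • a) (-a)‖ₑ ^ (2 : ℝ))
            ^ (1 / 2 : ℝ)) ^ (2 : ℝ) := ENNReal.rpow_le_rpow (h1.trans h2) (by norm_num)
      _ = ∫⁻ t in Set.Ioc (0 : ℝ) 1, ‖fderiv ℝ ψ (x - t • a) (-a)‖ₑ ^ (2 : ℝ) := by
          rw [← ENNReal.rpow_mul]; norm_num
      _ ≤ _ := by
          refine lintegral_mono fun t => ?_
          rw [← ENNReal.mul_rpow_of_nonneg _ _ (by norm_num)]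
          refine ENNReal.rpow_le_rpow ?_ (by norm_num)
          rw [mul_comm, ← enorm_neg a]
          exact (fderiv ℝ ψ (x - t • a)).le_opENorm (-a)
  refine (ENNReal.rpow_le_rpow_iff (z := 2) (by norm_num)).1 ?_
  rw [eLpNorm_two_rpow]
  have hm : Measurable fun y => ‖fderiv ℝ ψ y‖ₑ ^ (2 : ℝ) := hcont.measurable.enorm.pow_const _
  calc _ ≤ ∫⁻ x, ∫⁻ t in Set.Ioc (0 : ℝ) 1,
        ‖a‖ₑ ^ (2 : ℝ) * ‖fderiv ℝ ψ (x - t • a)‖ₑ ^ (2 : ℝ) := lintegral_mono hpt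
    _ = ∫⁻ t in Set.Ioc (0 : ℝ) 1, ∫⁻ x,
        ‖a‖ₑ ^ (2 : ℝ) * ‖fderiv ℝ ψ (x - t • a)‖ₑ ^ (2 : ℝ) := by
        refine lintegral_lintegral_swap (Measurable.aemeasurable ?_)
        refine Measurable.const_mul ?_ _
        exact hm.comp (by fun_prop : Continuous fun p : E N × ℝ => p.1 - p.2 • a).measurable
    _ = ∫⁻ t in Set.Ioc (0 : ℝ) 1, ‖a‖ₑ ^ (2 : ℝ) * ∫⁻ x, ‖fderiv ℝ ψ x‖ₑ ^ (2 : ℝ) := by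
        refine lintegral_congr fun t => ?_
        have hm' : Measurable fun x => ‖fderiv ℝ ψ (x - t • a)‖ₑ ^ (2 : ℝ) :=
          hm.comp (measurable_id.sub_const _)
        rw [lintegral_const_mul _ hm']
        congr 1
        exact lintegral_sub_right_eq_self (fun y => ‖fderiv ℝ ψ y‖ₑ ^ (2 : ℝ)) (t • a)
    _ = ‖a‖ₑ ^ (2 : ℝ) * ∫⁻ x, ‖fderiv ℝ ψ x‖ₑ ^ (2 : ℝ) := by simp
    _ ≤ ‖a‖ₑ ^ (2 : ℝ) * ENNReal.ofReal (gradNorm s ^ 2) := by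
        gcongr
        exact lintegral_fderiv_sq_le h
    _ = _ := by
        rw [← ofReal_norm, ENNReal.ofReal_rpow_of_nonneg (norm_nonneg _) (by norm_num),
          ENNReal.ofReal_rpow_of_nonneg (mul_nonneg (norm_nonneg _) (gradNorm_nonneg _))
            (by norm_num), ← ENNReal.ofReal_mul (by positivity)]
        congr 1
        norm_cast
        ring

/-- Translations move an element of the energy space by at most the length of the translation
times the norm of the gradient. -/
lemma eLpNorm_translate_sub_le (s : Sig N) (a : E N) :
    eLpNorm (fun x => ι s (x - a) - ι s x) 2 volume ≤ ENNReal.ofReal (‖a‖ * gradNorm s) := by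
  have hmp : MeasurePreserving (fun x : E N => x - a) volume volume :=
    measurePreserving_sub_right volume a
  let T : L2 N →ₗᵢ[ℂ] L2 N := Lp.compMeasurePreservingₗᵢ ℂ (fun x : E N => x - a) hmp
  have hT : ∀ f : L2 N, ‖T f - f‖ₑ = eLpNorm (fun x => f (x - a) - f x) 2 volume := by
    intro f
    rw [← edist_eq_enorm_sub, Lp.edist_def]
    refine eLpNorm_congr_ae ?_
    filter_upwards [Lp.coeFn_compMeasurePreserving f hmp] with x hx
    rw [Pi.sub_apply]
    exact congrArg (· - f x) hx
  have key : ‖T (ι s) - ι s‖ ≤ ‖a‖ * gradNorm s := by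
    refine Sig.induction_test (p := fun s => ‖T (ι s) - ι s‖ ≤ ‖a‖ * gradNorm s) ?_ ?_ s
    · refine isClosed_le ?_ (continuous_const.mul continuous_gradNorm)
      exact ((T.continuous.comp (ι (N := N)).continuous).sub (ι (N := N)).continuous).norm
    · intro ψ s h
      rw [← ENNReal.ofReal_le_ofReal_iff (mul_nonneg (norm_nonneg _) (gradNorm_nonneg _)),
        ofReal_norm, hT]
      refine le_of_eq_of_le (eLpNorm_congr_ae ?_) (h.eLpNorm_translate_sub_le a)
      have h1 := h.2.2.1
      filter_upwards [h1, hmp.quasiMeasurePreserving.ae_eq_comp h1] with x hx hx'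
      rw [hx]
      exact congrArg (· - ι s x) hx'.symm
  rw [← hT, ← ofReal_norm]
  exact ENNReal.ofReal_le_ofReal key

lemma norm_mollifyL2_ι_sub_le (φ : ContDiffBump (0 : E N)) (s : Sig N) :
    ‖mollifyL2 φ (ι s) - ι s‖ ≤ φ.rOut * ‖s‖ := by
  refine norm_mollifyL2_sub_le φ (ι s) (mul_nonneg φ.rOut_pos.le (norm_nonneg _)) fun h hh => ?_
  refine (eLpNorm_translate_sub_le s h).trans (ENNReal.ofReal_le_ofReal ?_)
  have : ‖h‖ ≤ φ.rOut := (mem_ball_zero_iff.1 hh).le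
  exact mul_le_mul this (gradNorm_le s) (gradNorm_nonneg s) φ.rOut_pos.le

end Translation

/-! ### Compactness of the embedding into `L²` -/

section Rellich

variable {N : ℕ}

open scoped ENNReal

/-- Bounded sequences in a separable Hilbert space have weakly convergent subsequences. -/
lemma exists_weakly_convergent_subseq {H : Type*} [NormedAddCommGroup H] [InnerProductSpace ℂ H]
    [CompleteSpace H] [TopologicalSpace.SeparableSpace H] {f : ℕ → H} {C : ℝ}
    (hf : ∀ n, ‖f n‖ ≤ C) :
    ∃ (g : H) (k : ℕ → ℕ), StrictMono k ∧
      ∀ w : H, Tendsto (fun n => inner ℂ (f (k n)) w) atTop (𝓝 (inner ℂ g w)) := by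
  let x : ℕ → WeakDual ℂ H := fun n =>
    StrongDual.toWeakDual (InnerProductSpace.toDual ℂ H (f n))
  have hx : ∀ n, x n ∈ WeakDual.toStrongDual ⁻¹' Metric.closedBall (0 : StrongDual ℂ H) C := by
    intro n
    change InnerProductSpace.toDual ℂ H (f n) ∈ Metric.closedBall (0 : StrongDual ℂ H) C
    rw [mem_closedBall_zero_iff, LinearIsometryEquiv.norm_map]
    exact hf n
  obtain ⟨a, -, k, hk, hlim⟩ := WeakDual.isSeqCompact_closedBall ℂ H 0 C hx
  refine ⟨(InnerProductSpace.toDual ℂ H).symm (WeakDual.toStrongDual a), k, hk, fun w => ?_⟩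
  rw [InnerProductSpace.toDual_symm_apply]
  exact ((WeakDual.eval_continuous w).tendsto a).comp hlim

lemma memLp_mollify_kernel (φ : ContDiffBump (0 : E N)) (x : E N) :
    MemLp (fun t => ((φ.normed volume (x - t) : ℝ) : ℂ)) 2 volume :=
  memLp_test (ψ := fun t => φ.normed volume (x - t))
    (φ.continuous_normed.comp (continuous_const.sub continuous_id))
    (φ.hasCompactSupport_normed.comp_homeomorph (Homeomorph.subLeft x))

lemma mollify_eq_inner (φ : ContDiffBump (0 : E N)) (f : L2 N) (x : E N) :
    mollify φ f x = inner ℂ ((memLp_mollify_kernel φ x).toLp _) f := by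
  rw [mollify_apply, ← L2.integral_mul_conj]
  refine integral_congr_ae ?_
  filter_upwards [(memLp_mollify_kernel φ x).coeFn_toLp] with t ht
  rw [ht, Complex.conj_ofReal]
  ring

lemma exists_norm_mollify_le (φ : ContDiffBump (0 : E N)) :
    ∃ K, ∀ (f : L2 N) (x : E N), ‖mollify φ f x‖ ≤ K * ‖f‖ := by
  let w : E N → ℂ := fun x => ((φ.normed volume x : ℝ) : ℂ)
  have h0 : MemLp w 2 volume := memLp_test φ.continuous_normed φ.hasCompactSupport_normed
  refine ⟨(eLpNorm w 2 volume).toReal, fun f x => ?_⟩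
  rw [mollify_eq_inner]
  refine (norm_inner_le_norm _ _).trans (le_of_eq ?_)
  rw [Lp.norm_toLp]
  have e : eLpNorm (w ∘ fun t => x - t) 2 volume = eLpNorm w 2 volume :=
    eLpNorm_comp_measurePreserving h0.1 (Measure.measurePreserving_sub_left volume x)
  rw [← e]
  rfl

lemma norm_add_sq_le_two (a b : ℂ) : ‖a + b‖ ^ 2 ≤ 2 * ‖a‖ ^ 2 + 2 * ‖b‖ ^ 2 := by
  have h := norm_add_le a b
  have : ‖a + b‖ ^ 2 ≤ (‖a‖ + ‖b‖) ^ 2 := by gcongr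
  nlinarith [sq_nonneg (‖a‖ - ‖b‖)]

/-- A mass estimate: the part of `s` far out is controlled by the weight, the difference between
`s` and its mollification by the gradient, and what remains is the mollification on a ball. -/
lemma norm_ι_sq_le_mollify (φ : ContDiffBump (0 : E N)) {R : ℝ} (hR : 0 < R) (s : Sig N) :
    ‖ι s‖ ^ 2 ≤ 2 * (φ.rOut * ‖s‖) ^ 2 + R⁻¹ ^ 2 * ‖s‖ ^ 2
      + 2 * ∫ x in Metric.closedBall 0 R, ‖mollify φ (ι s) x‖ ^ 2 := by
  have h1 : Integrable fun x => 2 * ‖(mollifyL2 φ (ι s) - ι s) x‖ ^ 2 :=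
    (L2.integrable_norm_sq _).const_mul _
  have h2 : Integrable fun x => R⁻¹ ^ 2 * ∑ j, ‖X j s x‖ ^ 2 :=
    (integrable_finsetSum _ fun j _ => L2.integrable_norm_sq _).const_mul _
  have hm : Integrable fun x => ‖mollify φ (ι s) x‖ ^ 2 :=
    (memLp_two_iff_integrable_sq_norm (memLp_mollify φ _).1).1 (memLp_mollify φ _)
  have h3 : Integrable fun x =>
      2 * (Metric.closedBall (0 : E N) R).indicator (fun x => ‖mollify φ (ι s) x‖ ^ 2) x :=
    (hm.indicator measurableSet_closedBall).const_mul _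
  have hpt : ∀ᵐ x, ‖ι s x‖ ^ 2 ≤ 2 * ‖(mollifyL2 φ (ι s) - ι s) x‖ ^ 2
      + R⁻¹ ^ 2 * ∑ j, ‖X j s x‖ ^ 2
      + 2 * (Metric.closedBall (0 : E N) R).indicator (fun x => ‖mollify φ (ι s) x‖ ^ 2) x := by
    filter_upwards [Sig.ae_norm_mul s, mollifyL2_ae φ (ι s),
      Lp.coeFn_sub (mollifyL2 φ (ι s)) (ι s)] with x hx1 hx2 hx3
    rw [← hx1]
    by_cases hx : x ∈ Metric.closedBall (0 : E N) R
    · rw [Set.indicator_of_mem hx, hx3, Pi.sub_apply, hx2]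
      have e := norm_add_sq_le_two (-(mollify φ (ι s) x - ι s x)) (mollify φ (ι s) x)
      rw [norm_neg] at e
      have e2 : -(mollify φ (ι s) x - ι s x) + mollify φ (ι s) x = ι s x := by ring
      rw [e2] at e
      have : 0 ≤ R⁻¹ ^ 2 * (‖x‖ ^ 2 * ‖ι s x‖ ^ 2) := by positivity
      linarith
    · rw [Set.indicator_of_notMem hx]
      have hx' : R ≤ ‖x‖ := by
        rw [mem_closedBall_zero_iff, not_le] at hx; exact hx.le
      have h5 : 1 ≤ R⁻¹ ^ 2 * ‖x‖ ^ 2 := by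
        rw [← mul_pow]
        refine one_le_pow₀ ?_
        rwa [inv_mul_eq_div, one_le_div hR]
      have : 0 ≤ 2 * ‖(mollifyL2 φ (ι s) - ι s) x‖ ^ 2 := by positivity
      nlinarith [mul_le_mul_of_nonneg_right h5 (sq_nonneg ‖ι s x‖)]
  calc ‖ι s‖ ^ 2 = ∫ x, ‖ι s x‖ ^ 2 := (L2.integral_norm_sq _).symm
    _ ≤ _ := integral_mono_ae (L2.integrable_norm_sq _) ((h1.add h2).add h3) hpt
    _ = 2 * ‖mollifyL2 φ (ι s) - ι s‖ ^ 2 + R⁻¹ ^ 2 * ∑ j, ‖X j s‖ ^ 2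
        + 2 * ∫ x in Metric.closedBall 0 R, ‖mollify φ (ι s) x‖ ^ 2 := by
        rw [integral_add' (h1.add h2) h3, integral_add' h1 h2, integral_const_mul, integral_const_mul,
          integral_const_mul, integral_finsetSum _ fun j _ => L2.integrable_norm_sq _,
          integral_indicator measurableSet_closedBall]
        simp_rw [L2.integral_norm_sq]
    _ ≤ _ := by
        have a := norm_mollifyL2_ι_sub_le φ s
        have b := sum_norm_X_sq_le s
        gcongr

/-- The embedding of the energy space into `L²` is compact. Along a subsequence that converges
weakly in `L²`, mollifications converge pointwise and boundedly, hence in `L²` of every ball, and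
`norm_ι_sq_le_mollify` controls the rest uniformly. -/
theorem exists_subseq_cauchySeq_ι {s : ℕ → Sig N} {C : ℝ} (hs : ∀ n, ‖s n‖ ≤ C) :
    ∃ k : ℕ → ℕ, StrictMono k ∧ CauchySeq fun n => ι (s (k n)) := by
  have hC : 0 ≤ C := (norm_nonneg _).trans (hs 0)
  have hι : ∀ n, ‖ι (s n)‖ ≤ C := fun n =>
    (le_of_sq_le_sq (norm_ι_sq_le_norm_sq (s n)) (norm_nonneg _)).trans (hs n)
  have : Fact ((2 : ℝ≥0∞) ≠ ⊤) := ⟨by simp⟩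
  have : TopologicalSpace.SeparableSpace (L2 N) := inferInstance
  obtain ⟨g, k, hk, hw⟩ := exists_weakly_convergent_subseq hι
  refine ⟨k, hk, ?_⟩
  have hpt : ∀ (φ : ContDiffBump (0 : E N)) (x : E N),
      Tendsto (fun n => mollify φ (ι (s (k n))) x) atTop (𝓝 (mollify φ g x)) := fun φ x => by
    simp_rw [mollify_eq_inner]
    have := (Complex.continuous_conj.tendsto _).comp (hw ((memLp_mollify_kernel φ x).toLp _))
    simpa only [Function.comp_def, inner_conj_symm] using this
  have hA : ∀ (φ : ContDiffBump (0 : E N)) (R : ℝ), Tendsto (fun n =>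
      ∫ x in Metric.closedBall 0 R, ‖mollify φ (ι (s (k n))) x - mollify φ g x‖ ^ 2)
      atTop (𝓝 0) := fun φ R => by
    obtain ⟨K, hK⟩ := exists_norm_mollify_le φ
    have h00 : (0 : ℝ) = ∫ x : E N in Metric.closedBall 0 R, (0 : ℝ) := by simp
    rw [h00]
    refine tendsto_integral_of_dominated_convergence (fun _ => (|K| * C + |K| * ‖g‖) ^ 2)
      (fun n => ?_) ?_ (fun n => ae_of_all _ fun x => ?_) (ae_of_all _ fun x => ?_)
    · exact ((((contDiff_mollify φ _).continuous.sub
        (contDiff_mollify φ _).continuous).norm).pow 2).aestronglyMeasurable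
    · have : IsFiniteMeasure ((volume : Measure (E N)).restrict (Metric.closedBall 0 R)) :=
        isFiniteMeasure_restrict.2 (measure_closedBall_lt_top).ne
      exact integrable_const _
    · rw [Real.norm_of_nonneg (by positivity)]
      gcongr
      refine (norm_sub_le _ _).trans (add_le_add ?_ ?_)
      · refine (hK _ _).trans ?_
        exact mul_le_mul (le_abs_self K) (hι _) (norm_nonneg _) (abs_nonneg K)
      · refine (hK _ _).trans ?_
        exact mul_le_mul_of_nonneg_right (le_abs_self K) (norm_nonneg _)
    · have := ((hpt φ x).sub_const (mollify φ g x)).norm.pow 2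
      simpa using this
  rw [Metric.cauchySeq_iff]
  intro ε hε
  obtain ⟨R, hR, hR'⟩ : ∃ R : ℝ, 0 < R ∧ R⁻¹ ^ 2 * (2 * C) ^ 2 < ε ^ 2 / 4 := by
    have t : Tendsto (fun R : ℝ => R⁻¹ ^ 2 * (2 * C) ^ 2) atTop (𝓝 0) := by
      have := ((tendsto_inv_atTop_zero (𝕜 := ℝ)).pow 2).mul_const ((2 * C) ^ 2)
      rwa [zero_pow two_ne_zero, zero_mul] at this
    have := (t.eventually (gt_mem_nhds (by positivity : 0 < ε ^ 2 / 4))).and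
      (eventually_gt_atTop (0 : ℝ))
    obtain ⟨R, h1, h2⟩ := this.exists
    exact ⟨R, h2, h1⟩
  obtain ⟨m, hm⟩ : ∃ m : ℕ, 2 * ((bumpSeq (N := N) m).rOut * (2 * C)) ^ 2 < ε ^ 2 / 4 := by
    have t : Tendsto (fun m : ℕ => 2 * ((bumpSeq (N := N) m).rOut * (2 * C)) ^ 2) atTop (𝓝 0) := by
      have t0 : Tendsto (fun m : ℕ => (bumpSeq (N := N) m).rOut) atTop (𝓝 0) :=
        tendsto_one_div_add_atTop_nhds_zero_nat
      simpa using ((t0.mul_const (2 * C)).pow 2).const_mul 2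
    exact (t.eventually (gt_mem_nhds (by positivity : 0 < ε ^ 2 / 4))).exists
  set φ : ContDiffBump (0 : E N) := bumpSeq m
  obtain ⟨n₀, hn₀⟩ := eventually_atTop.1
    ((hA φ R).eventually (gt_mem_nhds (by positivity : 0 < ε ^ 2 / 16)))
  refine ⟨n₀, fun a ha b hb => ?_⟩
  rw [dist_eq_norm, ← map_sub]
  refine lt_of_pow_lt_pow_left₀ 2 hε.le ?_
  refine (norm_ι_sq_le_mollify φ hR (s (k a) - s (k b))).trans_lt ?_
  have hnorm : ‖s (k a) - s (k b)‖ ≤ 2 * C := by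
    refine (norm_sub_le _ _).trans ?_
    linarith [hs (k a), hs (k b)]
  have hint : ∀ n, IntegrableOn
      (fun x => ‖mollify φ (ι (s (k n))) x - mollify φ g x‖ ^ 2) (Metric.closedBall 0 R) := fun n =>
    ((((contDiff_mollify φ _).continuous.sub
      (contDiff_mollify φ _).continuous).norm).pow 2).continuousOn.integrableOn_compact
        (isCompact_closedBall _ _)
  have h3 : ∫ x in Metric.closedBall 0 R, ‖mollify φ (ι (s (k a) - s (k b))) x‖ ^ 2
      ≤ 2 * (∫ x in Metric.closedBall 0 R, ‖mollify φ (ι (s (k a))) x - mollify φ g x‖ ^ 2)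
        + 2 * ∫ x in Metric.closedBall 0 R, ‖mollify φ (ι (s (k b))) x - mollify φ g x‖ ^ 2 := by
    rw [← integral_const_mul, ← integral_const_mul,
      ← integral_add ((hint a).const_mul 2) ((hint b).const_mul 2)]
    refine integral_mono ?_ (((hint a).const_mul 2).add ((hint b).const_mul 2)) fun x => ?_
    · exact (((contDiff_mollify φ _).continuous.norm).pow 2).continuousOn.integrableOn_compact
        (isCompact_closedBall _ _)
    · have e : mollify φ (ι (s (k a) - s (k b))) x = (mollify φ (ι (s (k a))) x - mollify φ g x)
          + (-(mollify φ (ι (s (k b))) x - mollify φ g x)) := by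
        rw [map_sub, mollify_eq_inner, inner_sub_right, ← mollify_eq_inner, ← mollify_eq_inner]
        ring
      have := norm_add_sq_le_two (mollify φ (ι (s (k a))) x - mollify φ g x)
        (-(mollify φ (ι (s (k b))) x - mollify φ g x))
      rw [norm_neg] at this
      simpa only [e] using this
  have h4 : 2 * (φ.rOut * ‖s (k a) - s (k b)‖) ^ 2 ≤ 2 * (φ.rOut * (2 * C)) ^ 2 := by
    have := φ.rOut_pos.le
    gcongr
  have h5 : R⁻¹ ^ 2 * ‖s (k a) - s (k b)‖ ^ 2 ≤ R⁻¹ ^ 2 * (2 * C) ^ 2 := by gcongr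
  have h6 := hn₀ a ha
  have h7 := hn₀ b hb
  linarith

end Rellich

/-! ### The Gagliardo–Nirenberg inequality -/

section GagliardoNirenberg

variable {N : ℕ}

open scoped ENNReal NNReal

/-- Interpolation of `L^q` between `L^2` and `L^m`. -/
lemma lintegral_rpow_interpolate {ψ : E N → ℂ} (hψ : Continuous ψ) {θ m q : ℝ} (hθ0 : 0 ≤ θ)
    (hθ1 : θ ≤ 1) (hm : 0 ≤ m) (hq : q = 2 * (1 - θ) + m * θ) :
    ∫⁻ x, ‖ψ x‖ₑ ^ q ≤ (∫⁻ x, ‖ψ x‖ₑ ^ (2 : ℝ)) ^ (1 - θ) * (∫⁻ x, ‖ψ x‖ₑ ^ m) ^ θ := by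
  have hmeas : Measurable fun x => ‖ψ x‖ₑ := hψ.measurable.enorm
  have h := ENNReal.lintegral_mul_norm_pow_le (μ := (volume : Measure (E N)))
    (f := fun x => ‖ψ x‖ₑ ^ (2 : ℝ)) (g := fun x => ‖ψ x‖ₑ ^ m)
    (hmeas.pow_const _).aemeasurable (hmeas.pow_const _).aemeasurable (p := 1 - θ) (q := θ)
    (by linarith) hθ0 (by ring)
  refine le_of_eq_of_le (lintegral_congr fun x => ?_) h
  rw [← ENNReal.rpow_mul, ← ENNReal.rpow_mul,
    ← ENNReal.rpow_add_of_nonneg _ _ (mul_nonneg (by norm_num) (by linarith)) (mul_nonneg hm hθ0), hq]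

/-- The Gagliardo–Nirenberg inequality in dimension three, by interpolation with the Sobolev
embedding into `L^6`. -/
lemma gagliardoNirenberg_test_three {p : ℝ} (hp1 : 1 < p) (hp2 : p < 5) :
    ∃ C : ℝ≥0, ∀ ψ : E 3 → ℂ, ContDiff ℝ ((⊤ : ℕ∞) : WithTop ℕ∞) ψ → HasCompactSupport ψ →
      ∫⁻ x, ‖ψ x‖ₑ ^ (p + 1) ≤ C * (∫⁻ x, ‖fderiv ℝ ψ x‖ₑ ^ (2 : ℝ)) ^ (3 * (p - 1) / 4)
        * (∫⁻ x, ‖ψ x‖ₑ ^ (2 : ℝ)) ^ ((5 - p) / 4) := by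
  set K : ℝ≥0 := SNormLESNormFDerivOfEqConst ℂ (volume : Measure (E 3)) (2 : ℝ≥0)
  refine ⟨K ^ (6 * ((p - 1) / 4)), fun ψ hψ hc => ?_⟩
  have hS : eLpNorm ψ ((6 : ℝ≥0) : ℝ≥0∞) volume
      ≤ K * eLpNorm (fderiv ℝ ψ) ((2 : ℝ≥0) : ℝ≥0∞) volume := by
    refine eLpNorm_le_eLpNorm_fderiv_of_eq (volume : Measure (E 3)) (hψ.of_le (by simp)) hc
      (by norm_num) (by simp) ?_
    simp
    norm_num
  have h6 : ∫⁻ x, ‖ψ x‖ₑ ^ (6 : ℝ) = eLpNorm ψ ((6 : ℝ≥0) : ℝ≥0∞) volume ^ (6 : ℝ) := by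
    rw [eLpNorm_nnreal_eq_lintegral (by norm_num), ← ENNReal.rpow_mul]
    simp
  have h2 : eLpNorm (fderiv ℝ ψ) ((2 : ℝ≥0) : ℝ≥0∞) volume
      = (∫⁻ x, ‖fderiv ℝ ψ x‖ₑ ^ (2 : ℝ)) ^ (1 / 2 : ℝ) := by
    rw [eLpNorm_nnreal_eq_lintegral (by norm_num)]
    simp
  have hθ0 : 0 ≤ (p - 1) / 4 := by linarith
  refine (lintegral_rpow_interpolate (m := 6) (θ := (p - 1) / 4) (q := p + 1) hψ.continuous hθ0
    (by linarith) (by norm_num) (by ring)).trans ?_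
  rw [h6]
  calc (∫⁻ x, ‖ψ x‖ₑ ^ (2 : ℝ)) ^ (1 - (p - 1) / 4)
        * (eLpNorm ψ ((6 : ℝ≥0) : ℝ≥0∞) volume ^ (6 : ℝ)) ^ ((p - 1) / 4)
      ≤ (∫⁻ x, ‖ψ x‖ₑ ^ (2 : ℝ)) ^ (1 - (p - 1) / 4)
        * ((K * (∫⁻ x, ‖fderiv ℝ ψ x‖ₑ ^ (2 : ℝ)) ^ (1 / 2 : ℝ)) ^ (6 : ℝ)) ^ ((p - 1) / 4) := by
        gcongr
        exact hS.trans (by rw [h2])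
    _ = _ := by
        rw [← ENNReal.rpow_mul, ENNReal.mul_rpow_of_nonneg _ _ (by positivity), ← ENNReal.rpow_mul,
          ENNReal.coe_rpow_of_nonneg _ (by positivity), mul_comm,
          show (1 : ℝ) / 2 * (6 * ((p - 1) / 4)) = 3 * (p - 1) / 4 by ring,
          show 1 - (p - 1) / 4 = (5 - p) / 4 by ring]

/-- The Gagliardo–Nirenberg inequality in dimension two. The `L^1` Sobolev inequality
`‖v‖₂ ≤ C ‖∇v‖₁` for `v = |ψ|^((p+1)/2)` bounds `‖ψ‖_{p+1}^{p+1}` by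
`‖ψ‖_{p-1}^{p-1} ‖∇ψ‖₂²`, and interpolating `L^(p-1)` between `L²` and `L^(p+1)` allows the
`L^(p+1)` norm to be absorbed. -/
lemma gagliardoNirenberg_test_two {p : ℝ} (hp1 : 3 < p) :
    ∃ C : ℝ≥0, ∀ ψ : E 2 → ℂ, ContDiff ℝ ((⊤ : ℕ∞) : WithTop ℕ∞) ψ → HasCompactSupport ψ →
      ∫⁻ x, ‖ψ x‖ₑ ^ (p + 1) ≤ C * (∫⁻ x, ‖fderiv ℝ ψ x‖ₑ ^ (2 : ℝ)) ^ ((p - 1) / 2)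
        * (∫⁻ x, ‖ψ x‖ₑ ^ (2 : ℝ)) ^ (1 : ℝ) := by
  set K : ℝ≥0 := lintegralPowLePowLIntegralFDerivConst (volume : Measure (E 2)) 2
  let σ : ℝ≥0 := ⟨(p + 1) / 2, by linarith⟩
  have hσ : (σ : ℝ) = (p + 1) / 2 := rfl
  have hσ1 : (1 : ℝ) < σ := by rw [hσ]; linarith
  refine ⟨(K * σ ^ 2) ^ ((p - 1) / 2), fun ψ hψ hc => ?_⟩
  set A := ∫⁻ x, ‖ψ x‖ₑ ^ (p + 1) with hA
  set G := ∫⁻ x, ‖fderiv ℝ ψ x‖ₑ ^ (2 : ℝ) with hG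
  set M := ∫⁻ x, ‖ψ x‖ₑ ^ (2 : ℝ) with hM
  have hψm : Measurable fun x => ‖ψ x‖ₑ := hψ.continuous.measurable.enorm
  have hdm : Measurable fun x => ‖fderiv ℝ ψ x‖ₑ :=
    (hψ.continuous_fderiv (by simp)).measurable.enorm
  have hv : ContDiff ℝ 1 fun x => ‖ψ x‖ ^ (σ : ℝ) := (hψ.of_le (by simp)).norm_rpow hσ1
  have hvc : HasCompactSupport fun x => ‖ψ x‖ ^ (σ : ℝ) := hc.norm.rpow_const (by positivity)
  have h1 := lintegral_pow_le_pow_lintegral_fderiv (volume : Measure (E 2)) hv hvc (p := 2)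
    (by simpa using Real.HolderConjugate.two_two)
  have h2 : ∫⁻ x, ‖‖ψ x‖ ^ (σ : ℝ)‖ₑ ^ (2 : ℝ) = A := by
    refine lintegral_congr fun x => ?_
    rw [Real.enorm_rpow_of_nonneg (norm_nonneg _) (by positivity), enorm_norm, ← ENNReal.rpow_mul,
      hσ]
    congr 1
    ring
  have h3 : ∫⁻ x, ‖fderiv ℝ (fun x => ‖ψ x‖ ^ (σ : ℝ)) x‖ₑ
      ≤ σ * ((∫⁻ x, ‖ψ x‖ₑ ^ (p - 1)) ^ (1 / 2 : ℝ) * G ^ (1 / 2 : ℝ)) := by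
    calc _ ≤ ∫⁻ x, σ * (‖ψ x‖ₑ ^ ((σ : ℝ) - 1) * ‖fderiv ℝ ψ x‖ₑ) := by
          refine lintegral_mono fun x => ?_
          rw [← mul_assoc]
          exact enorm_fderiv_norm_rpow_le (hψ.differentiable (by simp)) (by exact_mod_cast hσ1)
      _ = σ * ∫⁻ x, ‖ψ x‖ₑ ^ ((σ : ℝ) - 1) * ‖fderiv ℝ ψ x‖ₑ :=
          lintegral_const_mul _ ((hψm.pow_const _).mul hdm)
      _ ≤ _ := by
          gcongr
          have := ENNReal.lintegral_mul_norm_pow_le (μ := (volume : Measure (E 2)))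
            (f := fun x => ‖ψ x‖ₑ ^ (p - 1)) (g := fun x => ‖fderiv ℝ ψ x‖ₑ ^ (2 : ℝ))
            (hψm.pow_const _).aemeasurable (hdm.pow_const _).aemeasurable (p := 1 / 2)
            (q := 1 / 2) (by norm_num) (by norm_num) (by norm_num)
          refine le_of_eq_of_le (lintegral_congr fun x => ?_) this
          rw [← ENNReal.rpow_mul, ← ENNReal.rpow_mul, hσ,
            show (p - 1) * (1 / 2) = (p + 1) / 2 - 1 by ring, show (2 : ℝ) * (1 / 2) = 1 by norm_num,
            ENNReal.rpow_one]
  have h4 : A ≤ (K * σ ^ 2 : ℝ≥0) * ((∫⁻ x, ‖ψ x‖ₑ ^ (p - 1)) * G) := by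
    rw [← h2]
    refine h1.trans ?_
    calc (K : ℝ≥0∞) * (∫⁻ x, ‖fderiv ℝ (fun x => ‖ψ x‖ ^ (σ : ℝ)) x‖ₑ) ^ (2 : ℝ)
        ≤ K * (σ * ((∫⁻ x, ‖ψ x‖ₑ ^ (p - 1)) ^ (1 / 2 : ℝ) * G ^ (1 / 2 : ℝ))) ^ (2 : ℝ) := by
          gcongr
      _ = _ := by
          rw [ENNReal.mul_rpow_of_nonneg _ _ (by norm_num),
            ENNReal.mul_rpow_of_nonneg _ _ (by norm_num), ← ENNReal.rpow_mul, ← ENNReal.rpow_mul]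
          norm_num
          ring
  have hp0 : p - 1 ≠ 0 := by linarith
  have hθ0 : 0 ≤ (p - 3) / (p - 1) := div_nonneg (by linarith) (by linarith)
  have hθ1 : 1 - (p - 3) / (p - 1) = 2 / (p - 1) := by field_simp; ring
  have h5 : ∫⁻ x, ‖ψ x‖ₑ ^ (p - 1) ≤ M ^ (2 / (p - 1)) * A ^ ((p - 3) / (p - 1)) := by
    rw [← hθ1]
    refine lintegral_rpow_interpolate hψ.continuous hθ0 ?_ (by linarith) ?_
    · rw [div_le_one (by linarith)]; linarith
    · field_simp; ring
  have hAtop : A ≠ ∞ := by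
    have := (hψ.continuous.memLp_of_hasCompactSupport (p := ENNReal.ofReal (p + 1))
      (μ := (volume : Measure (E 2))) hc)
    have h := lintegral_rpow_enorm_lt_top_of_eLpNorm_lt_top
      (by simp; linarith) (by simp) this.2
    rw [ENNReal.toReal_ofReal (by linarith)] at h
    exact h.ne
  by_cases hA0 : A = 0
  · rw [hA0]; exact bot_le
  have h6 : A ^ (2 / (p - 1)) ≤ (K * σ ^ 2 : ℝ≥0) * (M ^ (2 / (p - 1)) * G) := by
    have hne0 : A ^ ((p - 3) / (p - 1)) ≠ 0 := by
      simp [ENNReal.rpow_eq_zero_iff, hA0, hAtop]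
    have hnet : A ^ ((p - 3) / (p - 1)) ≠ ∞ := ENNReal.rpow_ne_top_of_nonneg hθ0 hAtop
    refine (ENNReal.mul_le_mul_iff_left hne0 hnet).1 ?_
    rw [← ENNReal.rpow_add _ _ hA0 hAtop, ← hθ1, sub_add_cancel, ENNReal.rpow_one, hθ1]
    calc A ≤ _ := h4
      _ ≤ (K * σ ^ 2 : ℝ≥0) * ((M ^ (2 / (p - 1)) * A ^ ((p - 3) / (p - 1))) * G) := by gcongr
      _ = _ := by ring
  have hb : 0 ≤ (p - 1) / 2 := by linarith
  calc A = (A ^ (2 / (p - 1))) ^ ((p - 1) / 2) := by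
        rw [← ENNReal.rpow_mul, show 2 / (p - 1) * ((p - 1) / 2) = 1 by field_simp,
          ENNReal.rpow_one]
    _ ≤ ((K * σ ^ 2 : ℝ≥0) * (M ^ (2 / (p - 1)) * G)) ^ ((p - 1) / 2) := by gcongr
    _ = _ := by
        rw [ENNReal.mul_rpow_of_nonneg _ _ hb, ENNReal.mul_rpow_of_nonneg _ _ hb,
          ← ENNReal.rpow_mul, show 2 / (p - 1) * ((p - 1) / 2) = 1 by field_simp,
          ENNReal.coe_rpow_of_nonneg _ hb]
        ring

/-- The Gagliardo–Nirenberg inequality for test functions. The exponent `b` of `‖∇ψ‖₂²` is at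
least `1` since `p` is mass-supercritical, and the exponent `a` of the mass is positive since `p`
is energy-subcritical. -/
lemma gagliardoNirenberg_test (hN : N = 2 ∨ N = 3) {p : ℝ} (hp1 : 1 + 4 / (N : ℝ) < p)
    (hp2 : (p : EReal) < twoStar N) :
    ∃ b a : ℝ, 1 ≤ b ∧ 0 < a ∧ a + b = (p + 1) / 2 ∧ ∃ C : ℝ≥0, ∀ ψ : E N → ℂ,
      ContDiff ℝ ((⊤ : ℕ∞) : WithTop ℕ∞) ψ → HasCompactSupport ψ →
      ∫⁻ x, ‖ψ x‖ₑ ^ (p + 1) ≤ C * (∫⁻ x, ‖fderiv ℝ ψ x‖ₑ ^ (2 : ℝ)) ^ b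
        * (∫⁻ x, ‖ψ x‖ₑ ^ (2 : ℝ)) ^ a := by
  rcases hN with rfl | rfl
  · norm_num at hp1
    exact ⟨(p - 1) / 2, 1, by linarith, one_pos, by ring, gagliardoNirenberg_test_two hp1⟩
  · norm_num at hp1
    rw [twoStar, if_neg (by norm_num), EReal.coe_lt_coe_iff] at hp2
    norm_num at hp2
    exact ⟨3 * (p - 1) / 4, (5 - p) / 4, by linarith, by linarith, by ring,
      gagliardoNirenberg_test_three (by linarith) hp2⟩

/-- The potential energy `‖u‖_{p+1}^{p+1}` on the energy space. -/
noncomputable def pot (p : ℝ) (s : Sig N) : ℝ := ∫ x, ‖ι s x‖ ^ (p + 1)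

lemma L2.lintegral_enorm_sq (f : L2 N) : ∫⁻ x, ‖f x‖ₑ ^ (2 : ℝ) = ENNReal.ofReal (‖f‖ ^ 2) := by
  rw [← L2.integral_norm_sq, ofReal_integral_eq_lintegral_ofReal (L2.integrable_norm_sq f)
    (ae_of_all _ fun x => by positivity)]
  refine lintegral_congr fun x => ?_
  rw [← ofReal_norm, ENNReal.ofReal_rpow_of_nonneg (norm_nonneg _) (by norm_num)]
  norm_cast

/-- The Gagliardo–Nirenberg inequality on the energy space. -/
theorem gagliardoNirenberg (hN : N = 2 ∨ N = 3) {p : ℝ} (hp1 : 1 + 4 / (N : ℝ) < p)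
    (hp2 : (p : EReal) < twoStar N) :
    ∃ b a : ℝ, 1 ≤ b ∧ 0 < a ∧ a + b = (p + 1) / 2 ∧ ∃ C : ℝ, 0 ≤ C ∧ ∀ s : Sig N,
      Integrable (fun x => ‖ι s x‖ ^ (p + 1)) ∧
      pot p s ≤ C * (gradNorm s ^ 2) ^ b * (‖ι s‖ ^ 2) ^ a := by
  obtain ⟨b, a, hb, ha, hab, C, hC⟩ := gagliardoNirenberg_test hN hp1 hp2
  have hp : 0 ≤ p + 1 := by linarith
  refine ⟨b, a, hb, ha, hab, C, C.2, ?_⟩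
  have hrhs : ∀ s : Sig N, 0 ≤ C * (gradNorm s ^ 2) ^ b * (‖ι s‖ ^ 2) ^ a := fun s => by
    have := gradNorm_nonneg s
    positivity
  have hcont : Continuous fun s : Sig N => C * (gradNorm s ^ 2) ^ b * (‖ι s‖ ^ 2) ^ a := by
    refine Continuous.mul (continuous_const.mul ?_) ?_
    · exact (continuous_gradNorm.pow 2).rpow_const fun _ => Or.inr (by linarith)
    · exact ((ι (N := N)).continuous.norm.pow 2).rpow_const fun _ => Or.inr ha.le
  have key : ∀ s : Sig N, ∫⁻ x, ‖ι s x‖ₑ ^ (p + 1)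
      ≤ ENNReal.ofReal (C * (gradNorm s ^ 2) ^ b * (‖ι s‖ ^ 2) ^ a) := by
    refine Sig.induction_test (p := fun s => ∫⁻ x, ‖ι s x‖ₑ ^ (p + 1)
      ≤ ENNReal.ofReal (C * (gradNorm s ^ 2) ^ b * (‖ι s‖ ^ 2) ^ a)) ?_ ?_
    -- Fatou's lemma along an almost everywhere convergent subsequence shows closedness.
    · refine IsSeqClosed.isClosed fun s t hs hst => ?_
      have hι : Tendsto (fun n => ι (s n)) atTop (𝓝 (ι t)) :=
        ((ι (N := N)).continuous.tendsto t).comp hst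
      obtain ⟨k, hk, hae⟩ := (tendstoInMeasure_of_tendsto_Lp hι).exists_seq_tendsto_ae
      have hlim : Tendsto (fun n => ENNReal.ofReal
          (C * (gradNorm (s (k n)) ^ 2) ^ b * (‖ι (s (k n))‖ ^ 2) ^ a)) atTop
          (𝓝 (ENNReal.ofReal (C * (gradNorm t ^ 2) ^ b * (‖ι t‖ ^ 2) ^ a))) :=
        ((ENNReal.continuous_ofReal.comp hcont).tendsto t).comp (hst.comp hk.tendsto_atTop)
      calc ∫⁻ x, ‖ι t x‖ₑ ^ (p + 1)
          = ∫⁻ x, liminf (fun n => ‖ι (s (k n)) x‖ₑ ^ (p + 1)) atTop := by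
            refine lintegral_congr_ae ?_
            filter_upwards [hae] with x hx
            exact (((ENNReal.continuous_rpow_const (y := p + 1)).tendsto _).comp
              ((continuous_enorm.tendsto _).comp hx)).liminf_eq.symm
        _ ≤ liminf (fun n => ∫⁻ x, ‖ι (s (k n)) x‖ₑ ^ (p + 1)) atTop :=
            lintegral_liminf_le fun n =>
              ((Lp.stronglyMeasurable _).measurable.enorm.pow_const _)
        _ ≤ liminf (fun n => ENNReal.ofReal
              (C * (gradNorm (s (k n)) ^ 2) ^ b * (‖ι (s (k n))‖ ^ 2) ^ a)) atTop :=
            liminf_le_liminf (Eventually.of_forall fun n => hs (k n))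
        _ = _ := hlim.liminf_eq
    · intro ψ s h
      have e1 : ∫⁻ x, ‖ι s x‖ₑ ^ (p + 1) = ∫⁻ x, ‖ψ x‖ₑ ^ (p + 1) := by
        refine lintegral_congr_ae ?_
        filter_upwards [h.2.2.1] with x hx
        rw [hx]
      have e2 : ∫⁻ x, ‖ψ x‖ₑ ^ (2 : ℝ) = ENNReal.ofReal (‖ι s‖ ^ 2) := by
        rw [← L2.lintegral_enorm_sq]
        refine lintegral_congr_ae ?_
        filter_upwards [h.2.2.1] with x hx
        rw [hx]
      rw [e1]
      refine (hC ψ h.1 h.2.1).trans ?_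
      rw [e2, ENNReal.ofReal_mul (by have := gradNorm_nonneg s; positivity),
        ENNReal.ofReal_mul (p := (C : ℝ)) C.2, ENNReal.ofReal_coe_nnreal,
        ← ENNReal.ofReal_rpow_of_nonneg (by positivity) (by linarith),
        ← ENNReal.ofReal_rpow_of_nonneg (by positivity) ha.le]
      gcongr
      exact lintegral_fderiv_sq_le h
  intro s
  have hm : AEStronglyMeasurable (fun x => ‖ι s x‖ ^ (p + 1)) volume :=
    ((Lp.stronglyMeasurable (ι s)).measurable.norm.pow_const _).aestronglyMeasurable
  have hof : ∀ x, ENNReal.ofReal (‖ι s x‖ ^ (p + 1)) = ‖ι s x‖ₑ ^ (p + 1) := fun x => by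
    rw [← ofReal_norm, ENNReal.ofReal_rpow_of_nonneg (norm_nonneg _) hp]
  constructor
  · refine ⟨hm, ?_⟩
    rw [hasFiniteIntegral_iff_ofReal (ae_of_all _ fun x => by positivity)]
    simp_rw [hof]
    exact (key s).trans_lt ENNReal.ofReal_lt_top
  · rw [pot, integral_eq_lintegral_of_nonneg_ae (ae_of_all _ fun x => by positivity) hm]
    simp_rw [hof]
    exact ENNReal.toReal_le_of_le_ofReal (hrhs s) (key s)

end GagliardoNirenberg

/-! ### The nonlinear term -/

section Potential

variable {N : ℕ} {p : ℝ}

lemma pot_nonneg (s : Sig N) : 0 ≤ pot p s :=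
  integral_nonneg fun x => by positivity

lemma ι_smul_ae (c : ℂ) (s : Sig N) : ∀ᵐ x, ι (c • s) x = c * ι s x := by
  rw [map_smul]
  filter_upwards [Lp.coeFn_smul c (ι s)] with x hx
  rw [hx]; rfl

lemma pot_smul {c : ℝ} (hc : 0 ≤ c) (s : Sig N) :
    pot p ((c : ℂ) • s) = c ^ (p + 1) * pot p s := by
  rw [pot, pot, ← integral_const_mul]
  refine integral_congr_ae ?_
  filter_upwards [ι_smul_ae (c : ℂ) s] with x hx
  rw [hx, norm_mul, Complex.norm_real, Real.norm_of_nonneg hc,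
    Real.mul_rpow hc (norm_nonneg _)]

/-- The tangent line inequality for the convex function `z ↦ |z|^(p+1)` on `ℂ`. -/
lemma norm_rpow_tangent (hp : 1 < p) (a b : ℂ) :
    ‖a‖ ^ (p + 1) + (p + 1) * (((‖a‖ ^ (p - 1) : ℝ) : ℂ) * a * (starRingEnd ℂ) b).re
      ≤ ‖a + b‖ ^ (p + 1) := by
  rcases eq_or_ne a 0 with rfl | ha
  · rw [norm_zero, Real.zero_rpow (by linarith : p + 1 ≠ 0)]
    simp
    positivity
  have hA : 0 < ‖a‖ := norm_pos_iff.2 ha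
  set d := (a * (starRingEnd ℂ) b).re / ‖a‖ with hd
  have h1 : ‖a‖ + d ≤ ‖a + b‖ := by
    have e : (a * (starRingEnd ℂ) (a + b)).re = ‖a‖ * (‖a‖ + d) := by
      rw [map_add, mul_add, Complex.add_re, Complex.mul_conj, Complex.ofReal_re,
        Complex.normSq_eq_norm_sq, hd]
      field_simp
    have h := Complex.re_le_norm (a * (starRingEnd ℂ) (a + b))
    rw [e, norm_mul, Complex.norm_conj] at h
    exact le_of_mul_le_mul_left h hA
  -- Bernoulli's inequality for the ratio of the two norms
  have h2 := one_add_mul_self_le_rpow_one_add (s := ‖a + b‖ / ‖a‖ - 1)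
    (by linarith [div_nonneg (norm_nonneg (a + b)) hA.le]) (p := p + 1) (by linarith)
  rw [add_sub_cancel, Real.div_rpow (norm_nonneg _) hA.le, le_div_iff₀ (by positivity)] at h2
  refine le_trans ?_ h2
  have h3 : (((‖a‖ ^ (p - 1) : ℝ) : ℂ) * a * (starRingEnd ℂ) b).re = ‖a‖ ^ p * d := by
    rw [mul_assoc, Complex.re_ofReal_mul, Real.rpow_sub_one hA.ne', hd]
    ring
  have h4 : ‖a‖ ^ (p + 1) = ‖a‖ ^ p * ‖a‖ := Real.rpow_add_one hA.ne' p
  rw [h3, h4]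
  have e2 : (1 + (p + 1) * (‖a + b‖ / ‖a‖ - 1)) * (‖a‖ ^ p * ‖a‖)
      = ‖a‖ ^ p * ‖a‖ + (p + 1) * (‖a‖ ^ p * (‖a + b‖ - ‖a‖)) := by
    field_simp
  rw [e2]
  have h5 : 0 < ‖a‖ ^ p := by positivity
  have h6 : d ≤ ‖a + b‖ - ‖a‖ := by linarith
  have h7 : 0 < p + 1 := by linarith
  gcongr

/-- An elementary form of Young's inequality. -/
lemma rpow_mul_le_add (hp : 0 < p) {a b ε : ℝ} (ha : 0 ≤ a) (hb : 0 ≤ b) (hε : 0 < ε) :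
    a ^ p * b ≤ ε * a ^ (p + 1) + ε⁻¹ ^ p * b ^ (p + 1) := by
  rcases le_total b (ε * a) with h | h
  · have e : a ^ (p + 1) = a ^ p * a := by
      rw [Real.rpow_add_one' ha (by linarith)]
    have h1 : 0 ≤ ε⁻¹ ^ p * b ^ (p + 1) := by positivity
    calc a ^ p * b ≤ a ^ p * (ε * a) := by gcongr
      _ = ε * a ^ (p + 1) := by rw [e]; ring
      _ ≤ _ := by linarith
  · have e : b ^ (p + 1) = b ^ p * b := by
      rw [Real.rpow_add_one' hb (by linarith)]
    have h1 : 0 ≤ ε * a ^ (p + 1) := by positivity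
    have h2 : a ≤ ε⁻¹ * b := by rwa [inv_mul_eq_div, le_div_iff₀ hε, mul_comm]
    calc a ^ p * b ≤ (ε⁻¹ * b) ^ p * b := by gcongr
      _ = ε⁻¹ ^ p * b ^ (p + 1) := by rw [Real.mul_rpow (by positivity) hb, e]; ring
      _ ≤ _ := by linarith

/-- The pairing `∫ |u|^(p-1) u v̄`, i.e. the derivative of the nonlinear term up to a factor. -/
noncomputable def nonlin (p : ℝ) (s v : Sig N) : ℂ :=
  ∫ x, ((‖ι s x‖ ^ (p - 1) : ℝ) : ℂ) * ι s x * (starRingEnd ℂ) (ι v x)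

lemma norm_nonlin_integrand (hp : 1 < p) (a b : ℂ) :
    ‖((‖a‖ ^ (p - 1) : ℝ) : ℂ) * a * (starRingEnd ℂ) b‖ = ‖a‖ ^ p * ‖b‖ := by
  rw [norm_mul, norm_mul, Complex.norm_conj, Complex.norm_real,
    Real.norm_of_nonneg (by positivity)]
  congr 1
  rw [← Real.rpow_add_one' (norm_nonneg _) (by linarith)]
  simp

lemma measurable_ι (s : Sig N) : Measurable (ι s) := (Lp.stronglyMeasurable (ι s)).measurable

lemma integrable_nonlin (hI : ∀ s : Sig N, Integrable (fun x => ‖ι s x‖ ^ (p + 1)))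
    (hp : 1 < p) (s v : Sig N) :
    Integrable fun x => ((‖ι s x‖ ^ (p - 1) : ℝ) : ℂ) * ι s x * (starRingEnd ℂ) (ι v x) := by
  refine ((hI s).add (hI v)).mono' ?_ (ae_of_all _ fun x => ?_)
  · have h1 := measurable_ι s
    have h2 := measurable_ι v
    refine Measurable.aestronglyMeasurable ?_
    exact ((Complex.measurable_ofReal.comp (h1.norm.pow_const _)).mul h1).mul
      (Complex.continuous_conj.measurable.comp h2)
  · rw [norm_nonlin_integrand hp]
    have := rpow_mul_le_add (p := p) (by linarith) (norm_nonneg (ι s x)) (norm_nonneg (ι v x))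
      one_pos
    simpa using this

lemma norm_nonlin_le (hI : ∀ s : Sig N, Integrable (fun x => ‖ι s x‖ ^ (p + 1)))
    (hp : 1 < p) (s v : Sig N) {ε : ℝ} (hε : 0 < ε) :
    ‖nonlin p s v‖ ≤ ε * pot p s + ε⁻¹ ^ p * pot p v := by
  refine (norm_integral_le_integral_norm _).trans ?_
  rw [pot, pot, ← integral_const_mul, ← integral_const_mul,
    ← integral_add ((hI s).const_mul _) ((hI v).const_mul _)]
  refine integral_mono (integrable_nonlin hI hp s v).norm
    (((hI s).const_mul _).add ((hI v).const_mul _)) fun x => ?_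
  change ‖((‖ι s x‖ ^ (p - 1) : ℝ) : ℂ) * ι s x * (starRingEnd ℂ) (ι v x)‖ ≤ _
  rw [norm_nonlin_integrand hp]
  exact rpow_mul_le_add (by linarith) (norm_nonneg _) (norm_nonneg _) hε

/-- Convexity of the nonlinear term. -/
lemma pot_tangent (hI : ∀ s : Sig N, Integrable (fun x => ‖ι s x‖ ^ (p + 1)))
    (hp : 1 < p) (s v : Sig N) :
    pot p s + (p + 1) * (nonlin p s v).re ≤ pot p (s + v) := by
  have hre : (nonlin p s v).re
      = ∫ x, (((‖ι s x‖ ^ (p - 1) : ℝ) : ℂ) * ι s x * (starRingEnd ℂ) (ι v x)).re :=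
    (integral_re (integrable_nonlin hI hp s v)).symm
  have hIre : Integrable fun x =>
      (((‖ι s x‖ ^ (p - 1) : ℝ) : ℂ) * ι s x * (starRingEnd ℂ) (ι v x)).re :=
    (integrable_nonlin hI hp s v).re
  rw [hre, pot, pot, ← integral_const_mul, ← integral_add (hI s) (hIre.const_mul _)]
  refine integral_mono_ae ((hI s).add (hIre.const_mul _)) (hI _) ?_
  rw [map_add]
  filter_upwards [Lp.coeFn_add (ι s) (ι v)] with x hx
  rw [hx]
  exact norm_rpow_tangent hp _ _

/-- Upper semicontinuity of the nonlinear term in a quantitative form. -/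
lemma eventually_pot_sub_le (hI : ∀ s : Sig N, Integrable (fun x => ‖ι s x‖ ^ (p + 1)))
    (hp : 1 < p) {α : Type*} {l : Filter α} {u w : α → Sig N} {K : ℝ}
    (hK : ∀ i, pot p (u i) ≤ K) (h : Tendsto (fun i => pot p (w i - u i)) l (𝓝 0)) {η : ℝ}
    (hη : 0 < η) : ∀ᶠ i in l, pot p (u i) - pot p (w i) ≤ η := by
  have hp1 : 0 < p + 1 := by linarith
  set ε := η / (2 * (p + 1) * (|K| + 1)) with hε
  have hε0 : 0 < ε := by positivity
  have h1 : Tendsto (fun i => (p + 1) * (ε⁻¹ ^ p * pot p (w i - u i))) l (𝓝 0) := by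
    simpa using (h.const_mul (ε⁻¹ ^ p)).const_mul (p + 1)
  filter_upwards [h1.eventually (gt_mem_nhds (half_pos hη))] with i hi
  have h2 := pot_tangent hI hp (u i) (w i - u i)
  rw [add_sub_cancel] at h2
  have h3 := norm_nonlin_le hI hp (u i) (w i - u i) hε0
  have h4 := (abs_le.1 (Complex.abs_re_le_norm (nonlin p (u i) (w i - u i)))).1
  have h5 : (p + 1) * (ε * pot p (u i)) ≤ η / 2 := by
    calc (p + 1) * (ε * pot p (u i)) ≤ (p + 1) * (ε * (|K| + 1)) := by
          gcongr
          linarith [hK i, le_abs_self K]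
      _ = η / 2 := by rw [hε]; field_simp
  have h6 : (p + 1) * (-(nonlin p (u i) (w i - u i)).re)
      ≤ (p + 1) * (ε * pot p (u i) + ε⁻¹ ^ p * pot p (w i - u i)) := by
    gcongr
    linarith
  linarith

/-- A lower bound for the nonlinear term: mass that the trap confines cannot spread out. -/
lemma exists_pot_lower_bound (hI : ∀ s : Sig N, Integrable (fun x => ‖ι s x‖ ^ (p + 1)))
    (hp : 1 < p) {q K : ℝ} (hq : 0 < q) :
    ∃ c > 0, ∀ s : Sig N, ‖ι s‖ ^ 2 = q → ∑ j, ‖X j s‖ ^ 2 ≤ K → c ≤ pot p s := by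
  obtain ⟨R, hR, hR'⟩ : ∃ R : ℝ, 0 < R ∧ R⁻¹ ^ 2 * |K| < q / 4 := by
    have t := ((tendsto_inv_atTop_zero (𝕜 := ℝ)).pow 2).mul_const |K|
    rw [zero_pow two_ne_zero, zero_mul] at t
    obtain ⟨R, h1, h2⟩ := ((t.eventually (gt_mem_nhds (by positivity : 0 < q / 4))).and
      (eventually_gt_atTop (0 : ℝ))).exists
    exact ⟨R, h2, h1⟩
  set B := Metric.closedBall (0 : E N) R
  set vol := (volume : Measure (E N)).real B
  have hvol : 0 ≤ vol := measureReal_nonneg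
  set δ := q / (4 * (vol + 1)) with hδ
  have hδ0 : 0 < δ := by positivity
  set A := δ⁻¹ ^ ((p - 1) / 2)
  have hA : 0 < A := by positivity
  refine ⟨q / 2 / A, by positivity, fun s hs hX => ?_⟩
  have hBfin : volume B ≠ ⊤ := measure_closedBall_lt_top.ne
  have i1 : Integrable fun x => R⁻¹ ^ 2 * ∑ j, ‖X j s x‖ ^ 2 :=
    (integrable_finsetSum _ fun j _ => L2.integrable_norm_sq _).const_mul _
  have i2 : Integrable fun x => B.indicator (fun _ => δ) x :=
    (integrable_indicator_iff measurableSet_closedBall).2 (integrableOn_const hBfin)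
  have i3 : Integrable fun x => A * ‖ι s x‖ ^ (p + 1) := (hI s).const_mul _
  have hpt : ∀ᵐ x, ‖ι s x‖ ^ 2 ≤ (R⁻¹ ^ 2 * ∑ j, ‖X j s x‖ ^ 2) + B.indicator (fun _ => δ) x
      + A * ‖ι s x‖ ^ (p + 1) := by
    filter_upwards [Sig.ae_norm_mul s] with x hx
    have h3 : 0 ≤ A * ‖ι s x‖ ^ (p + 1) := by positivity
    rw [← hx]
    by_cases hxB : x ∈ B
    · rw [Set.indicator_of_mem hxB]
      have h1 : 0 ≤ R⁻¹ ^ 2 * (‖x‖ ^ 2 * ‖ι s x‖ ^ 2) := by positivity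
      rcases le_total (‖ι s x‖ ^ 2) δ with h | h
      · linarith
      · have h4 : 1 ≤ (δ⁻¹ * ‖ι s x‖ ^ 2) ^ ((p - 1) / 2) := by
          refine Real.one_le_rpow ?_ (by linarith)
          rwa [inv_mul_eq_div, one_le_div hδ0]
        rw [Real.mul_rpow (by positivity) (by positivity), ← Real.rpow_natCast,
          ← Real.rpow_mul (norm_nonneg _)] at h4
        have h5 : ‖ι s x‖ ^ (p + 1) = ‖ι s x‖ ^ (((2 : ℕ) : ℝ) * ((p - 1) / 2)) * ‖ι s x‖ ^ 2 := by
          rw [← Real.rpow_natCast ‖ι s x‖ 2, ← Real.rpow_add' (norm_nonneg _)]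
          · congr 1; push_cast; ring
          · push_cast; intro h0; linarith
        have h6 : ‖ι s x‖ ^ 2 ≤ A * ‖ι s x‖ ^ (p + 1) := by
          rw [h5, ← mul_assoc]
          exact le_mul_of_one_le_left (by positivity) h4
        linarith
    · rw [Set.indicator_of_notMem hxB]
      have hx' : R ≤ ‖x‖ := by
        rw [mem_closedBall_zero_iff, not_le] at hxB; exact hxB.le
      have h5 : 1 ≤ R⁻¹ ^ 2 * ‖x‖ ^ 2 := by
        rw [← mul_pow]
        refine one_le_pow₀ ?_
        rwa [inv_mul_eq_div, one_le_div hR]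
      nlinarith [mul_le_mul_of_nonneg_right h5 (sq_nonneg ‖ι s x‖)]
  have h1 := integral_mono_ae (L2.integrable_norm_sq _) ((i1.add i2).add i3) hpt
  rw [L2.integral_norm_sq, integral_add' (i1.add i2) i3, integral_add' i1 i2, integral_const_mul,
    integral_const_mul, integral_finsetSum _ fun j _ => L2.integrable_norm_sq _,
    integral_indicator measurableSet_closedBall, setIntegral_const, smul_eq_mul] at h1
  simp_rw [L2.integral_norm_sq] at h1
  change _ ≤ _ + vol * δ + A * pot p s at h1
  have h2 : R⁻¹ ^ 2 * ∑ j, ‖X j s‖ ^ 2 ≤ q / 4 := by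
    refine le_trans ?_ hR'.le
    gcongr
    exact hX.trans (le_abs_self K)
  have h3 : vol * δ ≤ q / 4 := by
    rw [hδ, mul_div_assoc', div_le_div_iff₀ (by positivity) (by norm_num)]
    nlinarith
  rw [div_le_iff₀ hA]
  linarith [mul_comm A (pot p s)]

end Potential

/-! ### Ground state energy of the linear problem -/

section LinearGroundState

variable {N : ℕ} (γ : Fin N → ℝ) (Ω : EuclideanSpace ℝ (Fin 3))

/-- The bottom of the spectrum of the linear operator, `inf {t[u] : ‖u‖₂ = 1}`. -/
noncomputable def bottom : ℝ := sInf (quad γ Ω '' {s : Sig N | ‖ι s‖ ^ 2 = 1})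

lemma exists_mass_one : ∃ s : Sig N, ‖ι s‖ ^ 2 = 1 := by
  let φ : ContDiffBump (0 : E N) := ⟨1, 2, one_pos, one_lt_two⟩
  obtain ⟨s, hs⟩ := exists_isTest (contDiff_ofReal_comp φ.contDiff)
    (hasCompactSupport_ofReal φ.hasCompactSupport)
  have h0 : ι s ≠ 0 := by
    intro h
    have h1 : (fun x => ((φ x : ℝ) : ℂ)) =ᵐ[volume] 0 := by
      refine hs.2.2.1.trans ?_
      rw [h]
      exact Lp.coeFn_zero _ _ _
    have h2 := ((Complex.continuous_ofReal.comp φ.continuous).ae_eq_iff_eq volume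
      continuous_zero).1 h1
    have h3 := congrFun h2 0
    simp only [Function.comp_apply, Pi.zero_apply, Complex.ofReal_eq_zero] at h3
    rw [φ.one_of_mem_closedBall (by simp [φ])] at h3
    exact one_ne_zero h3
  refine ⟨((‖ι s‖⁻¹ : ℝ) : ℂ) • s, ?_⟩
  rw [map_smul, norm_smul, Complex.norm_real, norm_inv, norm_norm,
    inv_mul_cancel₀ (norm_ne_zero_iff.2 h0), one_pow]

lemma norm_ι_smul_sq (c : ℝ) (s : Sig N) : ‖ι ((c : ℂ) • s)‖ ^ 2 = c ^ 2 * ‖ι s‖ ^ 2 := by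
  rw [map_smul, norm_smul, Complex.norm_real, mul_pow, Real.norm_eq_abs, sq_abs]

variable {γ Ω} {c : ℝ}

lemma bottom_pos (hc : 0 < c) (hcoer : ∀ s : Sig N, c * ‖s‖ ^ 2 ≤ quad γ Ω s) :
    0 < bottom γ Ω := by
  obtain ⟨s, hs⟩ := exists_mass_one (N := N)
  refine hc.trans_le (le_csInf ⟨_, s, hs, rfl⟩ ?_)
  rintro _ ⟨s, hs, rfl⟩
  refine le_trans ?_ (hcoer s)
  have := norm_ι_sq_le_norm_sq s
  rw [hs] at this
  nlinarith

lemma bottom_mul_le (hc : 0 < c) (hcoer : ∀ s : Sig N, c * ‖s‖ ^ 2 ≤ quad γ Ω s) (s : Sig N) :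
    bottom γ Ω * ‖ι s‖ ^ 2 ≤ quad γ Ω s := by
  have hpos : ∀ s : Sig N, 0 ≤ quad γ Ω s := fun s => le_trans (by positivity) (hcoer s)
  rcases eq_or_ne (ι s) 0 with h | h
  · rw [h]; simpa using hpos s
  have hn : 0 < ‖ι s‖ := norm_pos_iff.2 h
  have h1 : bottom γ Ω ≤ quad γ Ω (((‖ι s‖⁻¹ : ℝ) : ℂ) • s) := by
    refine csInf_le ⟨0, ?_⟩ ⟨_, ?_, rfl⟩
    · rintro _ ⟨s, -, rfl⟩
      exact hpos s
    · rw [Set.mem_ofPred_eq, norm_ι_smul_sq, inv_pow, inv_mul_cancel₀ (by positivity)]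
  rw [quad_smul, inv_pow, inv_mul_eq_div, le_div_iff₀ (by positivity)] at h1
  exact h1

variable (γ Ω) in
lemma exists_quad_lt {η : ℝ} (hη : 0 < η) :
    ∃ s : Sig N, ‖ι s‖ ^ 2 = 1 ∧ quad γ Ω s < bottom γ Ω + η := by
  obtain ⟨s, hs⟩ := exists_mass_one (N := N)
  obtain ⟨_, ⟨s, hs, rfl⟩, h⟩ := exists_lt_of_csInf_lt
    (⟨_, s, hs, rfl⟩ : (quad γ Ω '' {s : Sig N | ‖ι s‖ ^ 2 = 1}).Nonempty)
    (lt_add_of_pos_right (bottom γ Ω) hη)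
  exact ⟨s, hs, h⟩

end LinearGroundState

/-! ### Minimizing sequences and minimizers -/

section Minimization

variable {N : ℕ} (γ : Fin N → ℝ) (Ω : EuclideanSpace ℝ (Fin 3)) (p : ℝ)

/-- The energy functional on the energy space. -/
noncomputable def enrg (s : Sig N) : ℝ := 1 / 2 * quad γ Ω s - 2 / (p + 1) * pot p s

/-- The admissible set `{‖u‖₂² = q, t[u] ≤ r}` in the energy space. -/
def Adm (r q : ℝ) : Set (Sig N) := {s | ‖ι s‖ ^ 2 = q ∧ quad γ Ω s ≤ r}

variable {γ Ω p}

/-- The energy infimum is strictly less than that of the linear problem. -/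
lemma exists_enrg_lt {c : ℝ} (hc : 0 < c) (hcoer : ∀ s : Sig N, c * ‖s‖ ^ 2 ≤ quad γ Ω s)
    (hI : ∀ s : Sig N, Integrable (fun x => ‖ι s x‖ ^ (p + 1))) (hp : 1 < p) {r q : ℝ}
    (hq : 0 < q) (hr : 2 * bottom γ Ω * q ≤ r) :
    ∃ s ∈ Adm γ Ω r q, enrg γ Ω p s < bottom γ Ω * q / 2 := by
  have hμ := bottom_pos hc hcoer
  set μ := bottom γ Ω with hμd
  obtain ⟨k, hk, hlow⟩ := exists_pot_lower_bound hI hp one_pos (K := 2 * μ / c)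
  have hp1 : 0 < p + 1 := by linarith
  set g := 2 / (p + 1) * (Real.sqrt q ^ (p + 1) * k) with hg
  have hsq : 0 < Real.sqrt q := Real.sqrt_pos.2 hq
  have hg0 : 0 < g := by positivity
  obtain ⟨s, hs, hs'⟩ := exists_quad_lt γ Ω (η := min μ (g / q)) (by positivity)
  have h1 : quad γ Ω s ≤ 2 * μ := by linarith [min_le_left μ (g / q)]
  have h2 : q * quad γ Ω s < q * μ + g := by
    have : quad γ Ω s < μ + g / q := hs'.trans_le (by gcongr; exact min_le_right _ _)
    calc q * quad γ Ω s < q * (μ + g / q) := by gcongr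
      _ = q * μ + g := by field_simp
  have hX : ∑ j, ‖X j s‖ ^ 2 ≤ 2 * μ / c := by
    rw [le_div_iff₀ hc, mul_comm]
    refine le_trans ?_ ((hcoer s).trans h1)
    exact mul_le_mul_of_nonneg_left (sum_norm_X_sq_le s) hc.le
  have h3 := hlow s hs hX
  refine ⟨((Real.sqrt q : ℝ) : ℂ) • s, ⟨?_, ?_⟩, ?_⟩
  · rw [norm_ι_smul_sq, hs, Real.sq_sqrt hq.le, mul_one]
  · rw [quad_smul, Real.sq_sqrt hq.le]
    calc q * quad γ Ω s ≤ q * (2 * μ) := by gcongr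
      _ ≤ r := by linarith
  · rw [enrg, quad_smul, Real.sq_sqrt hq.le, pot_smul hsq.le]
    have h4 : g ≤ 2 / (p + 1) * (Real.sqrt q ^ (p + 1) * pot p s) := by
      rw [hg]; gcongr
    linarith

/-- For small mass, admissible functions of energy below the linear level stay well inside the
ball `t ≤ r`. -/
lemma quad_le_of_enrg_le {C a b : ℝ} (hC : 0 ≤ C) (hb : 1 ≤ b) (hp : 1 < p)
    (hquad : ∀ s : Sig N, 0 ≤ quad γ Ω s)
    (hGN : ∀ s : Sig N, pot p s ≤ C * quad γ Ω s ^ b * (‖ι s‖ ^ 2) ^ a) {r q μ : ℝ} (hq : 0 < q)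
    (hsmall : 2 * (2 / (p + 1)) * C * r ^ (b - 1) * q ^ a ≤ 1 / 2) {s : Sig N}
    (hs : s ∈ Adm γ Ω r q) (he : enrg γ Ω p s ≤ μ * q / 2) : quad γ Ω s ≤ 2 * μ * q := by
  have h1 := hGN s
  rw [hs.1] at h1
  have h0 := hquad s
  have h2 : quad γ Ω s ^ b ≤ r ^ (b - 1) * quad γ Ω s := by
    have e : quad γ Ω s ^ b = quad γ Ω s ^ (b - 1) * quad γ Ω s := by
      rcases h0.eq_or_lt with h | h
      · rw [← h, Real.zero_rpow (by linarith)]; ring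
      · rw [Real.rpow_sub_one h.ne']; field_simp
    rw [e]
    have := Real.rpow_le_rpow h0 hs.2 (by linarith : 0 ≤ b - 1)
    gcongr
  have hp1 : 0 < p + 1 := by linarith
  have h3 : 2 / (p + 1) * pot p s ≤ 1 / 4 * quad γ Ω s := by
    calc 2 / (p + 1) * pot p s ≤ 2 / (p + 1) * (C * (r ^ (b - 1) * quad γ Ω s) * q ^ a) := by
          gcongr
          exact h1.trans (by gcongr)
      _ = (2 * (2 / (p + 1)) * C * r ^ (b - 1) * q ^ a) / 2 * quad γ Ω s := by ring
      _ ≤ (1 / 2) / 2 * quad γ Ω s := by gcongr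
      _ = _ := by ring
  unfold enrg at he
  linarith

/-- The compactness statement: a minimizing sequence that stays away from the boundary of the ball
`t ≤ r` has a subsequence converging to a minimizer. By compactness of the embedding into `L²` and
interpolation, a subsequence converges in `L²` and in `L^(p+1)`; the parallelogram law for the
quadratic form, applied to midpoints normalised to mass `q`, upgrades this to convergence in
the energy space. -/
lemma exists_subseq_tendsto_minimizer {c : ℝ} (hc : 0 < c)
    (hcoer : ∀ s : Sig N, c * ‖s‖ ^ 2 ≤ quad γ Ω s)
    (hI : ∀ s : Sig N, Integrable (fun x => ‖ι s x‖ ^ (p + 1))) (hp : 1 < p)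
    {C a b : ℝ} (hC : 0 ≤ C) (hb : 0 ≤ b) (ha : 0 < a)
    (hGN : ∀ s : Sig N, pot p s ≤ C * quad γ Ω s ^ b * (‖ι s‖ ^ 2) ^ a)
    (hqc : Continuous (quad γ Ω : Sig N → ℝ))
    {r q T J : ℝ} (hq : 0 < q) (hTr : T < r) {s : ℕ → Sig N}
    (hmass : ∀ n, ‖ι (s n)‖ ^ 2 = q) (hsT : ∀ n, quad γ Ω (s n) ≤ T)
    (hJ : ∀ w ∈ Adm γ Ω r q, J ≤ enrg γ Ω p w)
    (hlim : Tendsto (fun n => enrg γ Ω p (s n)) atTop (𝓝 J)) :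
    ∃ k : ℕ → ℕ, StrictMono k ∧ ∃ φ ∈ Adm γ Ω r q, enrg γ Ω p φ = J ∧
      Tendsto (fun n => s (k n)) atTop (𝓝 φ) := by
  have hpos : ∀ s : Sig N, 0 ≤ quad γ Ω s := fun s => le_trans (by positivity) (hcoer s)
  have hp1 : 0 < p + 1 := by linarith
  have hbd : ∀ n, ‖s n‖ ≤ Real.sqrt (T / c) := fun n => by
    refine Real.le_sqrt_of_sq_le ?_
    rw [le_div_iff₀ hc, mul_comm]
    exact (hcoer _).trans (hsT n)
  obtain ⟨k, hk, hcau⟩ := exists_subseq_cauchySeq_ι hbd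
  set v : ℕ → Sig N := fun n => s (k n) with hv
  have hvT : ∀ n, quad γ Ω (v n) ≤ T := fun n => hsT _
  have hvm : ∀ n, ‖ι (v n)‖ ^ 2 = q := fun n => hmass _
  have hve : Tendsto (fun n => enrg γ Ω p (v n)) atTop (𝓝 J) := hlim.comp hk.tendsto_atTop
  have hpotK : ∀ n, pot p (v n) ≤ C * T ^ b * q ^ a := fun n => by
    refine (hGN _).trans ?_
    rw [hvm]
    have := Real.rpow_le_rpow (hpos _) (hvT n) hb
    gcongr
  -- midpoints and half differences
  set h : ℝ := 1 / 2 with hh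
  set w : ℕ × ℕ → Sig N := fun i => (h : ℂ) • (v i.1 + v i.2) with hw
  set d : ℕ × ℕ → Sig N := fun i => (h : ℂ) • (v i.1 - v i.2) with hd
  have hwd1 : ∀ i, w i - v i.1 = -d i := fun i => by
    simp only [hw, hd, hh]
    push_cast
    module
  have hwd2 : ∀ i, w i - v i.2 = d i := fun i => by
    simp only [hw, hd, hh]
    push_cast
    module
  have hneg : ∀ x : Sig N, quad γ Ω (-x) = quad γ Ω x := fun x => by
    have := quad_smul γ Ω (-1) x
    simpa using this
  have hpar : ∀ i, quad γ Ω (w i) + quad γ Ω (d i)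
      = 1 / 2 * quad γ Ω (v i.1) + 1 / 2 * quad γ Ω (v i.2) := fun i => by
    simp only [hw, hd, quad_smul, sub_eq_add_neg, quad_add, hneg]
    have e : (form γ Ω (-v i.2) (v i.1)).re = -(form γ Ω (v i.2) (v i.1)).re := by
      have := form_smul_left γ Ω (-1) (v i.2) (v i.1)
      simp only [neg_smul, one_smul, map_neg, map_one, neg_mul, one_mul] at this
      rw [this, Complex.neg_re]
    rw [e, hh]
    ring
  have hparM : ∀ i, ‖ι (w i)‖ ^ 2 + ‖ι (d i)‖ ^ 2 = q := fun i => by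
    have := parallelogram_law_with_norm ℂ (ι (v i.1)) (ι (v i.2))
    simp only [hw, hd, norm_ι_smul_sq, map_add, map_sub, hh]
    nlinarith [hvm i.1, hvm i.2]
  have hdlim : Tendsto (fun i => ‖ι (d i)‖ ^ 2) atTop (𝓝 0) := by
    have h1 := cauchySeq_iff_tendsto_dist_atTop_0.1 hcau
    have h2 : ∀ i, ‖ι (d i)‖ ^ 2 = (1 / 4) * dist (ι (v i.1)) (ι (v i.2)) ^ 2 := fun i => by
      simp only [hd, norm_ι_smul_sq, map_sub, dist_eq_norm, hh]
      ring
    simp_rw [h2]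
    have h3 := (h1.pow 2).const_mul (1 / 4)
    rw [zero_pow two_ne_zero, mul_zero] at h3
    exact h3
  have hdT : ∀ i, quad γ Ω (d i) ≤ T := fun i => by
    linarith [hpar i, hpos (w i), hvT i.1, hvT i.2]
  have hwT : ∀ i, quad γ Ω (w i) ≤ T := fun i => by
    linarith [hpar i, hpos (d i), hvT i.1, hvT i.2]
  have hpd : Tendsto (fun i => pot p (d i)) atTop (𝓝 0) := by
    have h1 : Tendsto (fun i => C * T ^ b * (‖ι (d i)‖ ^ 2) ^ a) atTop (𝓝 0) := by
      have := (hdlim.rpow_const (p := a) (Or.inr ha.le)).const_mul (C * T ^ b)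
      rwa [Real.zero_rpow ha.ne', mul_zero] at this
    refine squeeze_zero (fun i => pot_nonneg _) (fun i => (hGN _).trans ?_) h1
    have := Real.rpow_le_rpow (hpos _) (hdT i) hb
    gcongr
  have hpneg : ∀ x : Sig N, pot p (-x) = pot p x := fun x => by
    rw [pot, pot]
    refine integral_congr_ae ?_
    rw [map_neg]
    filter_upwards [Lp.coeFn_neg (ι x)] with y hy
    rw [hy, Pi.neg_apply, norm_neg]
  -- the half differences tend to zero in the energy norm
  have hsmall : ∀ η > 0, ∀ᶠ i in (atTop : Filter (ℕ × ℕ)), quad γ Ω (d i) ≤ η := by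
    intro η hη
    have hη5 : 0 < η / 5 := by positivity
    have hηκ : 0 < η / 5 / (2 / (p + 1)) := by positivity
    have p1 := eventually_pot_sub_le hI hp (l := atTop) (u := fun i : ℕ × ℕ => v i.1) (w := w)
      (fun i => hpotK i.1) (by simpa only [hwd1, hpneg] using hpd) hηκ
    have p2 := eventually_pot_sub_le hI hp (l := atTop) (u := fun i : ℕ × ℕ => v i.2) (w := w)
      (fun i => hpotK i.2) (by simpa only [hwd2] using hpd) hηκ
    have t1 : Tendsto (fun i : ℕ × ℕ => i.1) atTop atTop := by
      rw [← prod_atTop_atTop_eq]; exact tendsto_fst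
    have t2 : Tendsto (fun i : ℕ × ℕ => i.2) atTop atTop := by
      rw [← prod_atTop_atTop_eq]; exact tendsto_snd
    have e1 := (hve.comp t1).eventually (gt_mem_nhds (by linarith : J < J + η / 5))
    have e2 := (hve.comp t2).eventually (gt_mem_nhds (by linarith : J < J + η / 5))
    have hσlim : Tendsto (fun i => q / (q - ‖ι (d i)‖ ^ 2)) atTop (𝓝 1) := by
      have := (tendsto_const_nhds (x := q)).div (hdlim.const_sub q) (by simpa using hq.ne')
      rw [sub_zero, div_self hq.ne'] at this
      exact this
    have s1 : ∀ᶠ i in (atTop : Filter (ℕ × ℕ)), q / (q - ‖ι (d i)‖ ^ 2) * T < r :=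
      (hσlim.mul_const T).eventually (gt_mem_nhds (by simpa using hTr))
    have s2 : ∀ᶠ i in (atTop : Filter (ℕ × ℕ)), (q / (q - ‖ι (d i)‖ ^ 2) - 1) * T < η / 5 :=
      ((hσlim.sub_const 1).mul_const T).eventually (gt_mem_nhds (by simpa using hη5))
    filter_upwards [p1, p2, e1, e2, s1, s2, hdlim.eventually (gt_mem_nhds hq)] with
      i p1 p2 e1 e2 s1 s2 s3
    have hm : ‖ι (w i)‖ ^ 2 = q - ‖ι (d i)‖ ^ 2 := by linarith [hparM i]
    rw [← hm] at s1 s2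
    have hwm : 0 < ‖ι (w i)‖ ^ 2 := by rw [hm]; linarith
    set σ := q / ‖ι (w i)‖ ^ 2 with hσ
    have hσ1 : 1 ≤ σ := by
      rw [hσ, one_le_div hwm, hm]
      linarith [sq_nonneg ‖ι (d i)‖]
    have hσs : 1 ≤ Real.sqrt σ := Real.one_le_sqrt.2 hσ1
    have hσ2 : Real.sqrt σ ^ 2 = σ := Real.sq_sqrt (by linarith)
    have hadm : ((Real.sqrt σ : ℝ) : ℂ) • w i ∈ Adm γ Ω r q := by
      refine ⟨?_, ?_⟩
      · rw [norm_ι_smul_sq, hσ2, hσ, div_mul_cancel₀ _ hwm.ne']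
      · rw [quad_smul, hσ2]
        refine le_trans ?_ s1.le
        have := hwT i
        gcongr
    have h1 := hJ _ hadm
    rw [enrg, quad_smul, hσ2, pot_smul (by positivity)] at h1
    have h2 : pot p (w i) ≤ Real.sqrt σ ^ (p + 1) * pot p (w i) :=
      le_mul_of_one_le_left (pot_nonneg _) (Real.one_le_rpow hσs hp1.le)
    have h3 : 2 / (p + 1) * pot p (w i) ≤ 2 / (p + 1) * (Real.sqrt σ ^ (p + 1) * pot p (w i)) := by
      gcongr
    have h4 : (σ - 1) * quad γ Ω (w i) ≤ (σ - 1) * T :=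
      mul_le_mul_of_nonneg_left (hwT i) (by linarith)
    have p1' : 2 / (p + 1) * (pot p (v i.1) - pot p (w i)) ≤ η / 5 := by
      rw [le_div_iff₀ (by positivity)] at p1
      linarith
    have p2' : 2 / (p + 1) * (pot p (v i.2) - pot p (w i)) ≤ η / 5 := by
      rw [le_div_iff₀ (by positivity)] at p2
      linarith
    simp only [Function.comp_apply, enrg] at e1 e2
    linarith [hpar i]
  have hcauchy : CauchySeq v := by
    rw [cauchySeq_iff_tendsto_dist_atTop_0]
    have hq0 : Tendsto (fun i => quad γ Ω (d i)) atTop (𝓝 0) := by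
      rw [Metric.tendsto_nhds]
      intro ε hε
      filter_upwards [hsmall (ε / 2) (by positivity)] with i hi
      rw [Real.dist_0_eq_abs, abs_of_nonneg (hpos _)]
      linarith
    have h1 : Tendsto (fun i => 4 * (quad γ Ω (d i) / c)) atTop (𝓝 0) := by
      simpa using (hq0.div_const c).const_mul 4
    have h2 : Tendsto (fun i : ℕ × ℕ => dist (v i.1) (v i.2) ^ 2) atTop (𝓝 0) := by
      refine squeeze_zero (fun i => by positivity) (fun i => ?_) h1
      have h3 : ‖d i‖ ^ 2 = 1 / 4 * dist (v i.1) (v i.2) ^ 2 := by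
        simp only [hd, norm_smul, dist_eq_norm, hh, Complex.norm_real]
        norm_num
        ring
      have h4 : ‖d i‖ ^ 2 ≤ quad γ Ω (d i) / c := by
        rw [le_div_iff₀ hc, mul_comm]; exact hcoer _
      linarith
    have h5 := h2.sqrt
    simpa [Real.sqrt_sq dist_nonneg] using h5
  obtain ⟨φ, hφ⟩ := cauchySeq_tendsto_of_complete hcauchy
  have hφm : ‖ι φ‖ ^ 2 = q := by
    have h1 : Tendsto (fun n => ‖ι (v n)‖ ^ 2) atTop (𝓝 (‖ι φ‖ ^ 2)) :=
      ((((ι (N := N)).continuous.norm.pow 2).tendsto φ).comp hφ)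
    simp_rw [hvm] at h1
    exact tendsto_nhds_unique h1 tendsto_const_nhds |>.symm ▸ rfl
  have hφq : Tendsto (fun n => quad γ Ω (v n)) atTop (𝓝 (quad γ Ω φ)) := (hqc.tendsto φ).comp hφ
  have hφT : quad γ Ω φ ≤ T := le_of_tendsto' hφq hvT
  have hadm : φ ∈ Adm γ Ω r q := ⟨hφm, hφT.trans hTr.le⟩
  refine ⟨k, hk, φ, hadm, le_antisymm ?_ (hJ φ hadm), hφ⟩
  have hsub : Tendsto (fun n => φ - v n) atTop (𝓝 0) := by
    simpa using (tendsto_const_nhds (x := φ)).sub hφ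
  have hpsub : Tendsto (fun n => pot p (φ - v n)) atTop (𝓝 0) := by
    have h1 : Continuous fun x : Sig N => C * quad γ Ω x ^ b * (‖ι x‖ ^ 2) ^ a :=
      (continuous_const.mul (hqc.rpow_const fun _ => Or.inr hb)).mul
        (((ι (N := N)).continuous.norm.pow 2).rpow_const fun _ => Or.inr ha.le)
    have h2 := (h1.tendsto 0).comp hsub
    have h3 : C * quad γ Ω (0 : Sig N) ^ b * (‖ι (0 : Sig N)‖ ^ 2) ^ a = 0 := by
      rw [map_zero, norm_zero, zero_pow two_ne_zero, Real.zero_rpow ha.ne', mul_zero]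
    rw [h3] at h2
    exact squeeze_zero (fun n => pot_nonneg _) (fun n => hGN _) h2
  refine le_of_forall_pos_le_add fun η hη => ?_
  have p1 := eventually_pot_sub_le hI hp (l := atTop) (u := v) (w := fun _ => φ) hpotK hpsub
    (η := η / (2 / (p + 1))) (by positivity)
  have h4 : Tendsto (fun n => enrg γ Ω p (v n) - 1 / 2 * quad γ Ω (v n)) atTop
      (𝓝 (J - 1 / 2 * quad γ Ω φ)) := hve.sub (hφq.const_mul _)
  have h5 : -(2 / (p + 1)) * pot p φ - η ≤ J - 1 / 2 * quad γ Ω φ := by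
    refine ge_of_tendsto h4 ?_
    filter_upwards [p1] with n hn
    rw [le_div_iff₀ (by positivity)] at hn
    rw [enrg]
    linarith
  rw [enrg]
  linarith

end Minimization

/-! ### The Euler–Lagrange equation -/

section EulerLagrange

variable {N : ℕ} {γ : Fin N → ℝ} {Ω : EuclideanSpace ℝ (Fin 3)} {p : ℝ}

lemma continuous_quad : Continuous (quad γ Ω : Sig N → ℝ) := by
  unfold quad form
  fun_prop

/-- First variation of the energy at a minimizer in the interior of the ball `t ≤ r`, in the real
direction `v`. By convexity of the nonlinear term, the energy along the normalised line
`φ + x v` is bounded above by an explicit differentiable function that agrees with it at `x = 0`,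
so that function has a local minimum there. -/
lemma euler_lagrange_re
    (hI : ∀ s : Sig N, Integrable (fun x => ‖ι s x‖ ^ (p + 1))) (hp : 1 < p) {r q : ℝ}
    (hq : 0 < q) {φ : Sig N} (hφ : ‖ι φ‖ ^ 2 = q) (hφr : quad γ Ω φ < r)
    (hmin : ∀ w ∈ Adm γ Ω r q, enrg γ Ω p φ ≤ enrg γ Ω p w) (v : Sig N) :
    (form γ Ω v φ).re + (2 * pot p φ - quad γ Ω φ) / q * (inner ℂ (ι v) (ι φ) : ℂ).re
      - 2 * (nonlin p φ v).re = 0 := by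
  have hp1 : 0 < p + 1 := by linarith
  set A := (inner ℂ (ι v) (ι φ) : ℂ).re with hA
  set B := ‖ι v‖ ^ 2
  set T₀ := quad γ Ω φ
  set T₁ := (form γ Ω v φ).re
  set T₂ := quad γ Ω v
  set P := pot p φ
  set L := (nonlin p φ v).re with hL
  let M : ℝ → ℝ := fun x => q + 2 * x * A + x ^ 2 * B
  let T : ℝ → ℝ := fun x => T₀ + 2 * x * T₁ + x ^ 2 * T₂
  let F : ℝ → ℝ := fun x => 1 / 2 * (q / M x * T x)
    - 2 / (p + 1) * ((q / M x) ^ ((p + 1) / 2) * (P + x * ((p + 1) * L)))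
  have hM : ∀ x : ℝ, ‖ι (φ + (x : ℂ) • v)‖ ^ 2 = M x := fun x => by
    have h := norm_add_sq (𝕜 := ℂ) (ι φ) (ι ((x : ℂ) • v))
    rw [← map_add, norm_ι_smul_sq, hφ] at h
    rw [h]
    have e : RCLike.re (inner ℂ (ι φ) (ι ((x : ℂ) • v))) = x * A := by
      rw [← inner_conj_symm, RCLike.conj_re, map_smul, inner_smul_left, Complex.conj_ofReal]
      exact Complex.re_ofReal_mul _ _
    rw [e]
    simp only [M]
    ring
  have hT : ∀ x : ℝ, quad γ Ω (φ + (x : ℂ) • v) = T x := fun x => by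
    rw [quad_add, quad_smul, form_smul_left, Complex.conj_ofReal, Complex.re_ofReal_mul]
    simp only [T]
    ring
  have hP : ∀ x : ℝ, P + x * ((p + 1) * L) ≤ pot p (φ + (x : ℂ) • v) := fun x => by
    have h := pot_tangent hI hp φ ((x : ℂ) • v)
    have e : (nonlin p φ ((x : ℂ) • v)).re = x * L := by
      have : nonlin p φ ((x : ℂ) • v) = x * nonlin p φ v := by
        rw [nonlin, nonlin, ← integral_const_mul]
        refine integral_congr_ae ?_
        filter_upwards [ι_smul_ae (x : ℂ) v] with y hy
        rw [hy, map_mul, Complex.conj_ofReal]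
        ring
      rw [this, Complex.re_ofReal_mul]
    rw [e] at h
    linarith
  have hM0 : M 0 = q := by simp [M]
  have hT0 : T 0 = T₀ := by simp [T]
  have dM : HasDerivAt M (2 * A) 0 := by
    have h1 := (((hasDerivAt_id (0 : ℝ)).const_mul 2).mul_const A).const_add q
    have h2 := ((hasDerivAt_id (0 : ℝ)).pow 2).mul_const B
    have := h1.add h2
    convert! this using 1
    simp
  have dT : HasDerivAt T (2 * T₁) 0 := by
    have h1 := (((hasDerivAt_id (0 : ℝ)).const_mul 2).mul_const T₁).const_add T₀
    have h2 := ((hasDerivAt_id (0 : ℝ)).pow 2).mul_const T₂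
    have := h1.add h2
    convert! this using 1
    simp
  have dσ : HasDerivAt (fun x => q / M x) (-(2 * A) / q) 0 := by
    have := (hasDerivAt_const (0 : ℝ) q).fun_div dM (by rw [hM0]; exact hq.ne')
    rw [hM0] at this
    convert! this using 1
    field_simp
    ring
  have hσ0 : q / M 0 = 1 := by rw [hM0, div_self hq.ne']
  have dF : HasDerivAt F (1 / 2 * (-(2 * A) / q * T₀ + 1 * (2 * T₁))
      - 2 / (p + 1) * (-(2 * A) / q * ((p + 1) / 2) * P + 1 * ((p + 1) * L))) 0 := by
    have d1 := (dσ.fun_mul dT).const_mul (1 / 2)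
    have d2 := dσ.rpow_const (p := (p + 1) / 2) (Or.inl (by rw [hσ0]; exact one_ne_zero))
    have d3 : HasDerivAt (fun x => P + x * ((p + 1) * L)) ((p + 1) * L) 0 := by
      simpa using ((hasDerivAt_id (0 : ℝ)).mul_const ((p + 1) * L)).const_add P
    have d4 := (d2.fun_mul d3).const_mul (2 / (p + 1))
    have d5 := d1.fun_sub d4
    simp only [hσ0, hT0, Real.one_rpow, mul_one, zero_mul, add_zero] at d5
    simpa only [F, one_mul] using d5
  have hloc : IsLocalMin F 0 := by
    have cM : ContinuousAt M 0 := dM.continuousAt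
    have e1 : ∀ᶠ x in 𝓝 (0 : ℝ), 0 < M x :=
      cM.eventually (lt_mem_nhds (by rw [hM0]; exact hq))
    have e2 : ∀ᶠ x in 𝓝 (0 : ℝ), q / M x * T x < r :=
      (dσ.fun_mul dT).continuousAt.eventually (gt_mem_nhds (by simpa only [hσ0, hT0, one_mul] using hφr))
    filter_upwards [e1, e2] with x hx1 hx2
    have hF0 : F 0 = enrg γ Ω p φ := by
      simp only [F, hσ0, hT0, Real.one_rpow, enrg]
      ring
    rw [hF0]
    set σ := q / M x with hσ
    have hσpos : 0 < σ := div_pos hq hx1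
    have hσ2 : Real.sqrt σ ^ 2 = σ := Real.sq_sqrt hσpos.le
    have hadm : ((Real.sqrt σ : ℝ) : ℂ) • (φ + (x : ℂ) • v) ∈ Adm γ Ω r q := by
      refine ⟨?_, ?_⟩
      · rw [norm_ι_smul_sq, hσ2, hM, hσ, div_mul_cancel₀ _ hx1.ne']
      · rw [quad_smul, hσ2, hT]
        exact hx2.le
    refine (hmin _ hadm).trans ?_
    have hsq : Real.sqrt σ ^ (p + 1) = σ ^ ((p + 1) / 2) := by
      rw [Real.sqrt_eq_rpow, ← Real.rpow_mul hσpos.le]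
      congr 1
      ring
    rw [enrg, quad_smul, hσ2, hT, pot_smul (Real.sqrt_nonneg _), hsq]
    have h1 := hP x
    have h2 : 2 / (p + 1) * (σ ^ ((p + 1) / 2) * (P + x * ((p + 1) * L)))
        ≤ 2 / (p + 1) * (σ ^ ((p + 1) / 2) * pot p (φ + (x : ℂ) • v)) := by
      gcongr
    simp only [F, ← hσ]
    linarith
  have h0 := hloc.hasDerivAt_eq_zero dF
  field_simp at h0 ⊢
  linarith

/-- The Euler–Lagrange equation of an interior minimizer, tested against every element of the
energy space. -/
lemma euler_lagrange
    (hI : ∀ s : Sig N, Integrable (fun x => ‖ι s x‖ ^ (p + 1))) (hp : 1 < p) {r q : ℝ}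
    (hq : 0 < q) {φ : Sig N} (hφ : ‖ι φ‖ ^ 2 = q) (hφr : quad γ Ω φ < r)
    (hmin : ∀ w ∈ Adm γ Ω r q, enrg γ Ω p φ ≤ enrg γ Ω p w) (v : Sig N) :
    form γ Ω v φ + (((2 * pot p φ - quad γ Ω φ) / q : ℝ) : ℂ) * inner ℂ (ι v) (ι φ)
      - 2 * nonlin p φ v = 0 := by
  have h1 := euler_lagrange_re hI hp hq hφ hφr hmin v
  have h2 := euler_lagrange_re hI hp hq hφ hφr hmin (Complex.I • v)
  have e : nonlin p φ (Complex.I • v) = -Complex.I * nonlin p φ v := by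
    rw [nonlin, nonlin, ← integral_const_mul]
    refine integral_congr_ae ?_
    filter_upwards [ι_smul_ae Complex.I v] with y hy
    rw [hy, map_mul, Complex.conj_I]
    ring
  have hre : ∀ z : ℂ, (-Complex.I * z).re = z.im := fun z => by simp
  rw [form_smul_left, map_smul, inner_smul_left, e, Complex.conj_I, hre, hre, hre] at h2
  have hr2 : ∀ z : ℂ, ((2 : ℂ) * z).re = 2 * z.re := fun z => by simp
  have hi2 : ∀ z : ℂ, ((2 : ℂ) * z).im = 2 * z.im := fun z => by simp
  apply Complex.ext
  · rw [Complex.sub_re, Complex.add_re, Complex.re_ofReal_mul, hr2]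
    exact h1
  · rw [Complex.sub_im, Complex.add_im, Complex.im_ofReal_mul, hi2]
    exact h2

end EulerLagrange

/-! ### From the energy space back to functions -/

section Functions

variable {N : ℕ} {γ : Fin N → ℝ} {Ω : EuclideanSpace ℝ (Fin 3)} {p : ℝ}

lemma energy_of_rep (hN : N = 2 ∨ N = 3) {u : E N → ℂ} {s : Sig N} (h : u =ᵐ[volume] ι s) :
    energy γ Ω p u = enrg γ Ω p s := by
  rw [energy, enrg, quadForm_of_rep γ Ω hN h, pot]
  congr 2
  refine integral_congr_ae ?_
  filter_upwards [h] with x hx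
  rw [hx]

lemma mem_admissible_iff (hN : N = 2 ∨ N = 3) {u : E N → ℂ} {s : Sig N} (h : u =ᵐ[volume] ι s)
    {r q : ℝ} : u ∈ admissible γ Ω r q ↔ s ∈ Adm γ Ω r q := by
  simp only [admissible, Adm, Set.mem_ofPred_eq, quadForm_of_rep γ Ω hN h, mass_of_rep h,
    memSigma_of_rep h, true_and]

lemma lambdaZero_eq (hN : N = 2 ∨ N = 3) : lambdaZero γ Ω = -bottom γ Ω := by
  rw [lambdaZero, bottom]
  congr 2
  ext t
  constructor
  · rintro ⟨u, ⟨hu, hm⟩, rfl⟩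
    obtain ⟨s, hs⟩ := hu.exists_rep
    exact ⟨s, (mass_of_rep hs).symm.trans hm, (quadForm_of_rep γ Ω hN hs).symm⟩
  · rintro ⟨s, hs, rfl⟩
    exact ⟨ι s, ⟨memSigma_of_rep ae_eq_rfl, (mass_of_rep ae_eq_rfl).trans hs⟩,
      quadForm_of_rep γ Ω hN ae_eq_rfl⟩

/-- The extended-real infimum `J_q^r` over functions is the real infimum over the energy space. -/
lemma J_eq (hN : N = 2 ∨ N = 3) {r q j : ℝ}
    (hj : IsGLB (enrg γ Ω p '' Adm γ Ω r q) j) : J γ Ω p r q = (j : EReal) := by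
  apply le_antisymm
  · refine EReal.le_of_forall_lt_iff_le.1 fun z hz => ?_
    obtain ⟨_, ⟨s, hs, rfl⟩, -, hsz⟩ := hj.exists_between (EReal.coe_lt_coe_iff.1 hz)
    refine (iInf₂_le (ι s : E N → ℂ) ((mem_admissible_iff hN ae_eq_rfl).2 hs)).trans ?_
    rw [energy_of_rep hN ae_eq_rfl]
    exact EReal.coe_le_coe_iff.2 hsz.le
  · refine le_iInf₂ fun u hu => ?_
    obtain ⟨s, hs⟩ := hu.1.exists_rep
    rw [energy_of_rep hN hs]
    exact EReal.coe_le_coe_iff.2 (hj.1 ⟨s, (mem_admissible_iff hN hs).1 hu, rfl⟩)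

lemma isStationarySol_of_rep (hN : N = 2 ∨ N = 3) {ω : ℝ} {u : E N → ℂ} {φ : Sig N}
    (h : u =ᵐ[volume] ι φ) (h0 : ι φ ≠ 0)
    (heq : ∀ v : Sig N, form γ Ω v φ + (ω : ℂ) * inner ℂ (ι v) (ι φ) - 2 * nonlin p φ v = 0) :
    IsStationarySol γ Ω p ω u := by
  refine ⟨memSigma_of_rep h, fun hu => h0 ?_, fun v hv => ?_⟩
  · exact (Lp.eq_zero_iff_ae_eq_zero).2 (h.symm.trans hu)
  · obtain ⟨s, hs⟩ := hv.exists_rep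
    have e : ∫ x, ((‖u x‖ ^ (p - 1) : ℝ) : ℂ) * u x * (starRingEnd ℂ) (v x) = nonlin p φ s := by
      refine integral_congr_ae ?_
      filter_upwards [h, hs] with x hx hx'
      rw [hx, hx']
    rw [integral_gradient_of_rep h hs, integral_mul_conj_of_rep h hs,
      integral_potential_of_rep γ h hs, integral_LOmega_of_rep hN Ω h hs, e]
    have := heq s
    rw [form] at this
    linear_combination this

end Functions

end RotNLS

open RotNLS in
theorem theorem1p9 (N : ℕ) (hN : N = 2 ∨ N = 3)
    (γ : Fin N → ℝ) (hγ : ∀ j, 0 < γ j)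
    (Ω : EuclideanSpace ℝ (Fin 3)) (hΩ2 : N = 2 → Ω 0 = 0 ∧ Ω 1 = 0)
    (hΩ : ‖Ω‖ < ⨅ j, γ j)
    (p : ℝ) (hp1 : 1 + 4 / (N : ℝ) < p) (hp2 : (p : EReal) < RotNLS.twoStar N)
    (r : ℝ) (hr : 0 < r) :
    ∃ q₀ : ℝ, 0 < q₀ ∧ ∃ C : ℝ, 0 < C ∧ ∀ q : ℝ, 0 < q → q < q₀ →
      (RotNLS.minimizers γ Ω p r q).Nonempty ∧
      (∀ u : ℕ → RotNLS.E N → ℂ,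
        RotNLS.IsMinimizingSeq γ Ω p r q u → RotNLS.PrecompactInSigma u) ∧
      (∀ φ ∈ RotNLS.minimizers γ Ω p r q,
        ∃ ω : ℝ, RotNLS.IsStationarySol γ Ω p ω φ ∧
          RotNLS.lambdaZero γ Ω < ω ∧
          ω ≤ RotNLS.lambdaZero γ Ω * (1 - C * q ^ ((p - 1) / 2))) := by
  obtain ⟨c, hc, hcoer⟩ := exists_coercive γ Ω hN hΩ
  obtain ⟨b, a, hb, ha, hab, C₀, hC₀, hGN₀⟩ := gagliardoNirenberg hN hp1 hp2
  have hp : 1 < p := lt_of_le_of_lt (by simp; positivity) hp1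
  have hp1' : 0 < p + 1 := by linarith
  have hI : ∀ s : Sig N, Integrable (fun x => ‖ι s x‖ ^ (p + 1)) := fun s => (hGN₀ s).1
  have hpos : ∀ s : Sig N, 0 ≤ quad γ Ω s := fun s => le_trans (by positivity) (hcoer s)
  set C := C₀ / c ^ b with hCd
  have hC : 0 ≤ C := by positivity
  have hGN : ∀ s : Sig N, pot p s ≤ C * quad γ Ω s ^ b * (‖ι s‖ ^ 2) ^ a := fun s => by
    refine (hGN₀ s).2.trans ?_
    have h1 : gradNorm s ^ 2 ≤ quad γ Ω s / c := by
      rw [le_div_iff₀ hc, mul_comm]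
      refine le_trans ?_ (hcoer s)
      have := gradNorm_le s
      have := gradNorm_nonneg s
      gcongr
    calc C₀ * (gradNorm s ^ 2) ^ b * (‖ι s‖ ^ 2) ^ a
        ≤ C₀ * (quad γ Ω s / c) ^ b * (‖ι s‖ ^ 2) ^ a := by
          gcongr
      _ = _ := by rw [Real.div_rpow (hpos s) hc.le, hCd]; ring
  set μ := bottom γ Ω with hμd
  have hμ : 0 < μ := bottom_pos hc hcoer
  -- smallness of the mass: the nonlinear term is absorbed, and `2 μ q < r`
  obtain ⟨q₁, hq₁, hsmall⟩ : ∃ q₁ > 0, ∀ q : ℝ, 0 < q → q < q₁ →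
      2 * (2 / (p + 1)) * C * r ^ (b - 1) * q ^ a ≤ 1 / 2 := by
    have h1 : Tendsto (fun q : ℝ => 2 * (2 / (p + 1)) * C * r ^ (b - 1) * q ^ a) (𝓝 0) (𝓝 0) := by
      have : ContinuousAt (fun q : ℝ => 2 * (2 / (p + 1)) * C * r ^ (b - 1) * q ^ a) 0 :=
        continuousAt_const.mul (continuousAt_id.rpow_const (Or.inr ha.le))
      have h2 := this.tendsto
      simpa only [Real.zero_rpow ha.ne', mul_zero] using h2
    obtain ⟨δ, hδ, h⟩ := Metric.eventually_nhds_iff.1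
      (h1.eventually (gt_mem_nhds (by norm_num : (0 : ℝ) < 1 / 2)))
    refine ⟨δ, hδ, fun q hq hqδ => (h ?_).le⟩
    rw [Real.dist_0_eq_abs, abs_of_pos hq]
    exact hqδ
  set C₁ := 2 * (C * (2 * μ) ^ b + 1) / μ with hC₁
  have hC₁0 : 0 < C₁ := by positivity
  refine ⟨min q₁ (r / (2 * μ)), by positivity, C₁, hC₁0, fun q hq hq0 => ?_⟩
  have hqs := hsmall q hq (hq0.trans_le (min_le_left _ _))
  have hqr : 2 * μ * q < r := by
    have := hq0.trans_le (min_le_right _ _)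
    rw [lt_div_iff₀ (by positivity)] at this
    linarith
  obtain ⟨s₀, hs₀, hs₀e⟩ := exists_enrg_lt hc hcoer hI hp hq hqr.le
  have hr0 : ∀ s ∈ Adm γ Ω r q, -(2 / (p + 1) * (C * r ^ b * q ^ a)) ≤ enrg γ Ω p s := fun s hs => by
    have h1 := hGN s
    rw [hs.1] at h1
    have h2 := Real.rpow_le_rpow (hpos s) hs.2 (by linarith : 0 ≤ b)
    have h3 : 2 / (p + 1) * pot p s ≤ 2 / (p + 1) * (C * r ^ b * q ^ a) := by
      gcongr
      exact h1.trans (by gcongr)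
    rw [enrg]
    linarith [hpos s]
  set j := sInf (enrg γ Ω p '' Adm γ Ω r q) with hj
  have hglb : IsGLB (enrg γ Ω p '' Adm γ Ω r q) j :=
    isGLB_csInf ⟨_, s₀, hs₀, rfl⟩ ⟨_, by rintro _ ⟨s, hs, rfl⟩; exact hr0 s hs⟩
  have hJ := J_eq hN hglb
  have hjle : ∀ w ∈ Adm γ Ω r q, j ≤ enrg γ Ω p w := fun w hw => hglb.1 ⟨w, hw, rfl⟩
  have hjlt : j < μ * q / 2 := (hjle s₀ hs₀).trans_lt hs₀e
  have hquadle : ∀ s ∈ Adm γ Ω r q, enrg γ Ω p s ≤ μ * q / 2 → quad γ Ω s ≤ 2 * μ * q :=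
    fun s hs he => quad_le_of_enrg_le hC hb hp hpos hGN hq hqs hs he
  -- every minimizing sequence has a subsequence converging to a minimizer
  have hcompact : ∀ s : ℕ → Sig N, (∀ n, s n ∈ Adm γ Ω r q) →
      Tendsto (fun n => enrg γ Ω p (s n)) atTop (𝓝 j) →
      ∃ k : ℕ → ℕ, StrictMono k ∧ ∃ φ ∈ Adm γ Ω r q, enrg γ Ω p φ = j ∧
        Tendsto (fun n => s (k n)) atTop (𝓝 φ) := by
    intro s hs hlim
    obtain ⟨n₀, hn₀⟩ := eventually_atTop.1 (hlim.eventually (gt_mem_nhds hjlt))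
    obtain ⟨k, hk, φ, h1, h2, h3⟩ := exists_subseq_tendsto_minimizer hc hcoer hI hp hC
      (by linarith : 0 ≤ b) ha hGN continuous_quad hq hqr (s := fun n => s (n + n₀))
      (fun n => (hs _).1) (fun n => hquadle _ (hs _) (hn₀ _ (by omega)).le) hjle
      (hlim.comp (tendsto_add_atTop_nat n₀))
    exact ⟨fun n => k n + n₀, fun m n hmn => by have := hk hmn; simpa using this, φ, h1, h2, h3⟩
  refine ⟨?_, ?_, ?_⟩
  · obtain ⟨x, -, hx, hxm⟩ := exists_seq_tendsto_sInf
      (⟨_, s₀, hs₀, rfl⟩ : (enrg γ Ω p '' Adm γ Ω r q).Nonempty) hglb.bddBelow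
    choose s hs hsx using hxm
    obtain ⟨-, -, φ, hφ, hφj, -⟩ := hcompact s hs (by simpa only [hsx] using hx)
    refine ⟨ι φ, (mem_admissible_iff hN ae_eq_rfl).2 hφ, ?_⟩
    rw [energy_of_rep hN ae_eq_rfl, hφj, hJ]
  · intro u hu k hk
    choose s hs using fun n => (hu.1 n).1.exists_rep
    have hadm : ∀ n, s n ∈ Adm γ Ω r q := fun n => (mem_admissible_iff hN (hs n)).1 (hu.1 n)
    have hlim : Tendsto (fun n => enrg γ Ω p (s n)) atTop (𝓝 j) := by
      have := hu.2
      rw [hJ] at this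
      simp_rw [fun n => energy_of_rep hN (γ := γ) (Ω := Ω) (p := p) (hs n)] at this
      exact EReal.tendsto_coe.1 this
    obtain ⟨l, hl, φ, -, -, hlφ⟩ := hcompact (fun n => s (k n)) (fun n => hadm _)
      (hlim.comp hk.tendsto_atTop)
    refine ⟨l, hl, ι φ, memSigma_of_rep ae_eq_rfl, ?_⟩
    simp_rw [fun n => sigmaNorm_of_rep (rep_sub (hs (k (l n))) (ae_eq_rfl (f := (ι φ : E N → ℂ))))]
    exact tendsto_iff_norm_sub_tendsto_zero.1 hlφ
  · intro u hu
    obtain ⟨φ, hφ⟩ := hu.1.1.exists_rep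
    have hφa : φ ∈ Adm γ Ω r q := (mem_admissible_iff hN hφ).1 hu.1
    have hφj : enrg γ Ω p φ = j := by
      have := hu.2
      rw [energy_of_rep hN hφ, hJ] at this
      exact EReal.coe_eq_coe_iff.1 this
    have hφq := hquadle φ hφa (by linarith)
    have hφ0 : ι φ ≠ 0 := fun h => by
      have := hφa.1
      rw [h, norm_zero] at this
      norm_num at this
      exact hq.ne this
    have hEL := euler_lagrange hI hp hq hφa.1 (hφq.trans_lt hqr) fun w hw => by
      rw [hφj]; exact hjle w hw
    refine ⟨_, isStationarySol_of_rep hN hφ hφ0 hEL, ?_, ?_⟩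
    · -- `ω q = -2 E(φ) + (2 - 4 / (p + 1)) ‖φ‖_{p+1}^{p+1}` and `E(φ) < μ q / 2`
      rw [lambdaZero_eq hN, lt_div_iff₀ hq]
      have h1 : enrg γ Ω p φ < μ * q / 2 := by rw [hφj]; exact hjlt
      rw [enrg] at h1
      have h2 : 2 / (p + 1) * pot p φ ≤ pot p φ :=
        mul_le_of_le_one_left (pot_nonneg φ) (by rw [div_le_one hp1']; linarith)
      linarith
    · rw [lambdaZero_eq hN, div_le_iff₀ hq]
      have h1 := bottom_mul_le hc hcoer φ
      rw [hφa.1] at h1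
      have h2 : pot p φ ≤ (C * (2 * μ) ^ b + 1) * (q ^ ((p - 1) / 2) * q) := by
        have e : q ^ b * q ^ a = q ^ ((p - 1) / 2) * q := by
          rw [← Real.rpow_add hq, ← Real.rpow_add_one hq.ne']
          congr 1
          linarith
        calc pot p φ ≤ C * quad γ Ω φ ^ b * q ^ a := by
              have := hGN φ
              rwa [hφa.1] at this
          _ ≤ C * (2 * μ * q) ^ b * q ^ a := by
              have := hpos φ
              gcongr
          _ = C * (2 * μ) ^ b * (q ^ ((p - 1) / 2) * q) := by
              rw [Real.mul_rpow (by positivity) hq.le, ← e]; ring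
          _ ≤ _ := by
              gcongr
              linarith
      have h3 : -μ * (1 - C₁ * q ^ ((p - 1) / 2)) * q
          = -(μ * q) + 2 * ((C * (2 * μ) ^ b + 1) * (q ^ ((p - 1) / 2) * q)) := by
        rw [hC₁]
        field_simp
        ring
      rw [h3]
      linarith
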